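/- Let $n\ge 1$ and let $\Gamma\subsetneq\mathbf{R}^n$ be an open convex cone with vertex at the origin, invariant under permutations of the coordinates, and containing the positive orthant $\Gamma_n=\{x\in\mathbf{R}^n : x_i>0 \text{ for all } i\}$. For a $C^2$ function $h:\mathbf{C}^n\to\mathbf{R}$ let $\lambda(h_{i\bar j}(z))\in\mathbf{R}^n$ denote the $n$-tuple of eigenvalues of the Hermitian matrix $h_{i\bar j}(z)=\frac{\partial^2 h}{\partial z_i\partial\bar z_j}(z)$. A continuous function $u:\mathbf{C}^n\to\mathbf{R}$ is called a (viscosity) $\Gamma$-solution if for every $C^2$ function $h:\mathbf{C}^n\to\mathbf{R}$ and every $z\in\mathbf{C}^n$: 1. if $u-h$ has a local maximum at $z$, then $\lambda(h_{i\bar j}(z))\in\overline{\Gamma}$; 2. if $u-h$ has a local minimum at $z$, then $\lambda(h_{i\bar j}(z))\in\mathbf{R}^n\setminus\Gamma$. **Theorem.** Let $u:\mathbf{C}^n\to\mathbf{R}$ be a $\Gamma$-solution and let $C\geq 0$ be such that $|u|<C$ on $\mathbf{C}^n$ and $u$ is Lipschitz with Lipschitz constant at most $C$ with respect to the Euclidean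 distance. Then $u$ is constant. -/

import Mathlib

open scoped NNReal

/-- The positive orthant `Γ_n ⊆ ℝⁿ`. -/
def positiveOrthant (n : ℕ) : Set (Fin n → ℝ) := {x | ∀ i, 0 < x i}

/-- The coordinate direction `∂/∂x_i` of `ℂⁿ`, where `z_i = x_i + √-1 y_i`. -/
noncomputable def dirX {n : ℕ} (i : Fin n) : EuclideanSpace ℂ (Fin n) :=
  EuclideanSpace.single i 1

/-- The coordinate direction `∂/∂y_i` of `ℂⁿ`, where `z_i = x_i + √-1 y_i`. -/
noncomputable def dirY {n : ℕ} (i : Fin n) : EuclideanSpace ℂ (Fin n) :=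
  EuclideanSpace.single i Complex.I

/-- The second derivative `D²h(z)(v, w)` of `h` as a function of `2n` real variables. -/
noncomputable def realHessian {n : ℕ} (h : EuclideanSpace ℂ (Fin n) → ℝ)
    (z v w : EuclideanSpace ℂ (Fin n)) : ℝ :=
  fderiv ℝ (fderiv ℝ h) z v w

/-- The complex Hessian `h_{i j̄} = ∂²h / ∂z_i ∂z̄_j` at `z`, with
`∂/∂z_i = (∂/∂x_i - √-1 ∂/∂y_i) / 2` and `∂/∂z̄_j = (∂/∂x_j + √-1 ∂/∂y_j) / 2`. -/
noncomputable def complexHessian {n : ℕ} (h : EuclideanSpace ℂ (Fin n) → ℝ)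
    (z : EuclideanSpace ℂ (Fin n)) : Matrix (Fin n) (Fin n) ℂ :=
  Matrix.of fun i j =>
    (1 / 4 : ℂ) *
      (((realHessian h z (dirX i) (dirX j) + realHessian h z (dirY i) (dirY j) : ℝ) : ℂ) +
        Complex.I *
          ((realHessian h z (dirX i) (dirY j) - realHessian h z (dirY i) (dirX j) : ℝ) : ℂ))

theorem realHessian_symm {n : ℕ} {h : EuclideanSpace ℂ (Fin n) → ℝ} (hh : ContDiff ℝ 2 h)
    (z v w : EuclideanSpace ℂ (Fin n)) : realHessian h z v w = realHessian h z w v :=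
  (hh.contDiffAt.isSymmSndFDerivAt (by simp)) v w

theorem complexHessian_isHermitian {n : ℕ} {h : EuclideanSpace ℂ (Fin n) → ℝ}
    (hh : ContDiff ℝ 2 h) (z : EuclideanSpace ℂ (Fin n)) :
    (complexHessian h z).IsHermitian := by
  ext i j
  simp only [complexHessian, Matrix.conjTranspose_apply, Matrix.of_apply]
  rw [realHessian_symm hh z (dirX j) (dirX i), realHessian_symm hh z (dirY j) (dirY i),
    realHessian_symm hh z (dirX j) (dirY i), realHessian_symm hh z (dirY j) (dirX i)]
  apply Complex.ext <;> simp

/-- The `n`-tuple `λ(h_{i j̄}(z))` of eigenvalues, with multiplicity, of the complex Hessian of a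
`C²` function `h`. (Mathlib lists them in decreasing order; the sets that they are tested against
are invariant under permutations of the coordinates.) -/
noncomputable def hessianEigenvalues {n : ℕ} {h : EuclideanSpace ℂ (Fin n) → ℝ}
    (hh : ContDiff ℝ 2 h) (z : EuclideanSpace ℂ (Fin n)) : Fin n → ℝ :=
  (complexHessian_isHermitian hh z).eigenvalues

/-- Viscosity `Γ`-subsolutions on `ℂⁿ`. -/
structure IsGammaSubsolution {n : ℕ} (Γ : Set (Fin n → ℝ))
    (u : EuclideanSpace ℂ (Fin n) → ℝ) : Prop where
  continuous : Continuous u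
  of_isLocalMax : ∀ (h : EuclideanSpace ℂ (Fin n) → ℝ) (hh : ContDiff ℝ 2 h)
    (z : EuclideanSpace ℂ (Fin n)), IsLocalMax (fun w => u w - h w) z →
      hessianEigenvalues hh z ∈ closure Γ

/-- Viscosity `Γ`-solutions on `ℂⁿ`. -/
structure IsGammaSolution {n : ℕ} (Γ : Set (Fin n → ℝ))
    (u : EuclideanSpace ℂ (Fin n) → ℝ) : Prop extends IsGammaSubsolution Γ u where
  of_isLocalMin : ∀ (h : EuclideanSpace ℂ (Fin n) → ℝ) (hh : ContDiff ℝ 2 h)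
    (z : EuclideanSpace ℂ (Fin n)), IsLocalMin (fun w => u w - h w) z →
      hessianEigenvalues hh z ∉ Γ

/-!
The proof is by induction on the number of directions of an orthonormal basis `e` of `ℂⁿ` along
which `u` is not known to be invariant (`IsDualSolution.eq_of_invariantAlong`). Let `u` be invariant
along `e i` for `i ∈ B`, and let `χ` be the indicator of the complement of `B`.

*The dual form of the equation.* The cone `Γ` is cut out by the linear forms `l` that are positive
on it, and by the theorems of Schur and Birkhoff it contains the eigenvalues of a Hermitian matrix
only if it contains its diagonal in every orthonormal basis. Hence a `Γ`-solution is, in the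
viscosity sense, a subsolution of all the linear equations `∑ l_i levi h z (e_i) = 0`, and it is not touched
from below by a function that is a strict subsolution of all of them
(`IsGammaSolution.isDualSolution`). Linear subsolutions can be
mollified. As the equations may be degenerate, this is proved by comparing `u` with a random walk
(`IsLapSubsolution.weightedLap_mollify_nonneg`). In particular `u` is subharmonic, so its averages
over large balls approach its supremum (`eventually_le_mollify_radialKernel`).

*If `χ` is not in `Γ`*, some form in the dual cone only has weights in `B`. Permuting the basis shows
that mollifications of `u` are subharmonic on the complex lines in the directions `e j`, `j ∉ B`, and
they are constant on them by Liouville's theorem (`IsDualSolution.invariantAlong_of_notMem`).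

*If `χ` is in `Γ`* and `u` is not constant, let `a` and `D` be its infimum and its oscillation, and
let `f` be a mollification of `u` at a small scale. The square of the nonnegative subsolution `f - a`
is a subsolution with a gain in the directions in which `f` varies. Averaging it over a huge ball
gives a comparison function that is strict at a point unless, near that point, `f` hardly varies
in some direction transverse to `e i`, `i ∈ B`; this is where `χ ∈ Γ` enters. Since `u` is a
supersolution, it is not touched from below by a strict subsolution. The points where `u` is almost
touched are therefore centres of large balls on which `u` is almost invariant along a further
direction. Adding an average of `u` over a ball of fixed radius to the comparison function ensures
that `u` still oscillates near these points
(`IsDualSolution.exists_almost_invariant_direction`). The translates of `u` to these points have a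
limit that is a nonconstant solution, invariant along one more direction
(`IsDualSolution.exists_limit_invariantAlong`), which contradicts the induction hypothesis.
-/

open MeasureTheory

set_option linter.unusedSectionVars false

/-! ### Second directional derivatives -/

section Calculus

variable {E : Type*} [NormedAddCommGroup E] [NormedSpace ℝ E]

/-- The directional derivative `∂_v f` as a function. -/
noncomputable def dirDeriv (v : E) (f : E → ℝ) : E → ℝ := fun x => fderiv ℝ f x v

/-- The second derivative `D²f(x)(v, v)`. -/
noncomputable def hess (f : E → ℝ) (x v : E) : ℝ := fderiv ℝ (fderiv ℝ f) x v v

theorem ContDiff.dirDeriv {f : E → ℝ} {k l : WithTop ℕ∞} (hf : ContDiff ℝ l f) (h : k + 1 ≤ l)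
    (v : E) : ContDiff ℝ k (dirDeriv v f) :=
  (hf.fderiv_right h).clm_apply contDiff_const

theorem differentiable_fderiv_of_contDiff {f : E → ℝ} (hf : ContDiff ℝ 2 f) :
    Differentiable ℝ (fderiv ℝ f) :=
  (hf.fderiv_right (m := 1) (by norm_num)).differentiable (by norm_num)

theorem hess_eq_dirDeriv {f : E → ℝ} (hf : ContDiff ℝ 2 f) (x v : E) :
    hess f x v = dirDeriv v (dirDeriv v f) x := by
  unfold hess dirDeriv
  rw [fderiv_clm_apply (differentiable_fderiv_of_contDiff hf x) (differentiableAt_const v)]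
  simp

theorem hasDerivAt_line {f : E → ℝ} (hf : Differentiable ℝ f) (x v : E) (t : ℝ) :
    HasDerivAt (fun s : ℝ => f (x + s • v)) (dirDeriv v f (x + t • v)) t := by
  have h1 : HasDerivAt (fun s : ℝ => x + s • v) v t := by
    simpa using ((hasDerivAt_id t).smul_const v).const_add x
  exact (hf (x + t • v)).hasFDerivAt.comp_hasDerivAt t h1

theorem hess_add {f g : E → ℝ} (hf : ContDiff ℝ 2 f) (hg : ContDiff ℝ 2 g) (x v : E) :
    hess (fun y => f y + g y) x v = hess f x v + hess g x v := by
  have h1 : fderiv ℝ (fun y => f y + g y) = fun y => fderiv ℝ f y + fderiv ℝ g y := by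
    ext1 y
    exact fderiv_fun_add (hf.differentiable (by norm_num) y) (hg.differentiable (by norm_num) y)
  unfold hess
  rw [h1, fderiv_fun_add (differentiable_fderiv_of_contDiff hf x)
    (differentiable_fderiv_of_contDiff hg x)]
  rfl

theorem hess_const_mul {f : E → ℝ} (hf : ContDiff ℝ 2 f) (c : ℝ) (x v : E) :
    hess (fun y => c * f y) x v = c * hess f x v := by
  have h1 : fderiv ℝ (fun y => c * f y) = fun y => c • fderiv ℝ f y := by
    ext1 y
    exact fderiv_const_mul (hf.differentiable (by norm_num) y) c
  unfold hess
  rw [h1, fderiv_fun_const_smul (differentiable_fderiv_of_contDiff hf x)]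
  rfl

theorem hess_comp_add_right (f : E → ℝ) (a x v : E) :
    hess (fun y => f (y + a)) x v = hess f (x + a) v := by
  have h1 : fderiv ℝ (fun y => f (y + a)) = fun y => fderiv ℝ f (y + a) := by
    ext1 y
    exact fderiv_comp_add_right a
  unfold hess
  rw [h1, fderiv_comp_add_right a]

theorem continuous_hess {f : E → ℝ} (hf : ContDiff ℝ 2 f) (v : E) :
    Continuous fun x => hess f x v := by
  have := (hf.fderiv_right (m := 1) (by norm_num)).continuous_fderiv (by norm_num)
  exact (this.clm_apply continuous_const).clm_apply continuous_const

theorem hess_finset_sum {ι : Type*} (s : Finset ι) {f : ι → E → ℝ}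
    (hf : ∀ i ∈ s, ContDiff ℝ 2 (f i)) (x v : E) :
    hess (fun y => ∑ i ∈ s, f i y) x v = ∑ i ∈ s, hess (f i) x v := by
  classical
  induction s using Finset.induction_on with
  | empty => simp [hess]
  | insert a s ha ih =>
    simp only [Finset.sum_insert ha]
    rw [hess_add (hf a (by simp))
      (ContDiff.sum fun i hi => hf i (by simp [hi])), ih fun i hi => hf i (by simp [hi])]

/-- At a local maximum of a `C¹` function of one variable, a second derivative is nonpositive. -/
theorem second_deriv_nonpos_of_isLocalMax {φ φ' : ℝ → ℝ} {c t : ℝ}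
    (h1 : ∀ᶠ s in nhds t, HasDerivAt φ (φ' s) s) (h2 : HasDerivAt φ' c t)
    (hmax : IsLocalMax φ t) : c ≤ 0 := by
  by_contra! hc
  have hd : deriv φ =ᶠ[nhds t] φ' := h1.mono fun s hs => hs.deriv
  have hdd : deriv (deriv φ) t = c := by rw [hd.deriv_eq, h2.deriv]
  have hmin : IsLocalMin φ t := isLocalMin_of_deriv_deriv_pos (by rw [hdd]; exact hc)
    hmax.deriv_eq_zero h1.self_of_nhds.continuousAt
  have hconst : φ =ᶠ[nhds t] fun _ => φ t := by
    filter_upwards [hmax, hmin] with s hs1 hs2 using le_antisymm hs1 hs2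
  have h3 : deriv φ =ᶠ[nhds t] fun _ => 0 := by
    have := hconst.deriv
    simpa using this
  have : deriv (deriv φ) t = 0 := by rw [h3.deriv_eq]; simp
  linarith

end Calculus

section ComplexCalculus

variable {E : Type*} [NormedAddCommGroup E] [NormedSpace ℝ E]

theorem hess_norm_sq_sub [InnerProductSpace ℂ E] [IsScalarTower ℝ ℂ E] (a x v : E) :
    hess (fun y => ‖y - a‖ ^ 2) x v = 2 * ‖v‖ ^ 2 := by
  have hq : ContDiff ℝ 2 fun y : E => ‖y - a‖ ^ 2 :=
    (contDiff_norm_sq ℂ).comp (contDiff_id.sub contDiff_const)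
  have hexp : ∀ (w : E) (s : ℝ), ‖w + s • v‖ ^ 2
      = ‖w‖ ^ 2 + 2 * s * (inner ℂ w v).re + s ^ 2 * ‖v‖ ^ 2 := by
    intro w s
    rw [← algebraMap_smul ℂ s v, norm_add_sq (𝕜 := ℂ), inner_smul_right, norm_smul, mul_pow]
    simp
    ring
  have h1 : dirDeriv v (fun y => ‖y - a‖ ^ 2) = fun y => 2 * (inner ℂ (y - a) v).re := by
    ext1 y
    have e1 := hasDerivAt_line (hq.differentiable (by norm_num)) y v 0
    have e2 : HasDerivAt (fun s : ℝ => ‖y + s • v - a‖ ^ 2) (2 * (inner ℂ (y - a) v).re) 0 := by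
      have : (fun s : ℝ => ‖y + s • v - a‖ ^ 2) = fun s : ℝ =>
          ‖y - a‖ ^ 2 + 2 * s * (inner ℂ (y - a) v).re + s ^ 2 * ‖v‖ ^ 2 := by
        ext1 s
        rw [← hexp]; congr 2; abel
      rw [this]
      have := ((((hasDerivAt_id (0:ℝ)).const_mul 2).mul_const (inner ℂ (y - a) v).re).const_add
        (‖y - a‖ ^ 2)).add (((hasDerivAt_id (0:ℝ)).pow 2).mul_const (‖v‖ ^ 2))
      exact this.congr_deriv (by simp)
    have := e1.unique e2
    simpa using this
  rw [hess_eq_dirDeriv hq]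
  have hd : Differentiable ℝ (dirDeriv v fun y : E => ‖y - a‖ ^ 2) :=
    (hq.dirDeriv (k := 1) (by norm_num) v).differentiable (by norm_num)
  have e1 := hasDerivAt_line hd x v 0
  have e2 : HasDerivAt (fun s : ℝ => dirDeriv v (fun y => ‖y - a‖ ^ 2) (x + s • v))
      (2 * ‖v‖ ^ 2) 0 := by
    have : (fun s : ℝ => dirDeriv v (fun y => ‖y - a‖ ^ 2) (x + s • v)) = fun s : ℝ =>
        2 * ((inner ℂ (x - a) v).re + s * ‖v‖ ^ 2) := by
      ext1 s
      rw [h1]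
      change 2 * (inner ℂ (x + s • v - a) v).re = _
      rw [add_sub_right_comm, inner_add_left, ← algebraMap_smul ℂ s v, inner_smul_left,
        inner_self_eq_norm_sq_to_K]
      simp [← Complex.ofReal_pow, inner_sub_left]
    rw [this]
    have := (((hasDerivAt_id (0:ℝ)).mul_const (‖v‖ ^ 2)).const_add
      (inner ℂ (x - a) v).re).const_mul 2
    simpa using this
  have := e1.unique e2
  simpa using this

/-- Four times the Levi form of `f` at `x`, as a quadratic form in `v`:
`D²f(x)(v, v) + D²f(x)(iv, iv)`. -/
noncomputable def levi [NormedSpace ℂ E] (f : E → ℝ) (x v : E) : ℝ :=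
  hess f x v + hess f x (Complex.I • v)

end ComplexCalculus

/-! ### Convolution with compactly supported kernels -/

section Mollify

variable {E : Type*} [NormedAddCommGroup E] [NormedSpace ℝ E] [FiniteDimensional ℝ E]
  [MeasurableSpace E] [BorelSpace E] (μ : Measure E) [μ.IsAddHaarMeasure]

/-- The convolution `x ↦ ∫ κ(y) u(x - y) dy` of `u` with a kernel `κ`. -/
noncomputable def mollify (κ u : E → ℝ) (x : E) : ℝ := ∫ y, κ y * u (x - y) ∂μ

/-- Nonnegative smooth functions of compact support and integral one. -/
structure IsMollifier (κ : E → ℝ) : Prop where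
  contDiff : ContDiff ℝ (⊤ : ℕ∞) κ
  compact : HasCompactSupport κ
  nonneg : ∀ x, 0 ≤ κ x
  integral : ∫ y, κ y ∂μ = 1

variable {μ} {κ u f : E → ℝ}

theorem mollify_integrable (hκ : Continuous κ) (hc : HasCompactSupport κ) (hu : Continuous u)
    (x : E) : Integrable (fun y => κ y * u (x - y)) μ :=
  (hκ.mul (hu.comp (continuous_const.sub continuous_id))).integrable_of_hasCompactSupport
    hc.mul_right

theorem mollify_eq_convolution (κ u : E → ℝ) :
    mollify μ κ u = convolution κ u (ContinuousLinearMap.lsmul ℝ ℝ) μ := by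
  ext x
  simp [mollify, convolution]

theorem contDiff_mollify {k : ℕ∞} (hκ : ContDiff ℝ k κ) (hc : HasCompactSupport κ)
    (hu : Continuous u) : ContDiff ℝ k (mollify μ κ u) := by
  rw [mollify_eq_convolution]
  exact hc.contDiff_convolution_left _ hκ hu.locallyIntegrable

theorem dirDeriv_mollify (hκ : ContDiff ℝ 1 κ) (hc : HasCompactSupport κ) (hu : Continuous u)
    (v : E) : dirDeriv v (mollify μ κ u) = mollify μ (dirDeriv v κ) u := by
  ext x
  have h := hc.hasFDerivAt_convolution_left (μ := μ) (ContinuousLinearMap.lsmul ℝ ℝ) hκ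
    (hu.locallyIntegrable) x
  rw [← mollify_eq_convolution] at h
  unfold dirDeriv
  rw [h.fderiv]
  have hint : ConvolutionExistsAt (fderiv ℝ κ) u x
      ((ContinuousLinearMap.lsmul ℝ ℝ).precompL E) μ :=
    (hc.fderiv ℝ).convolutionExists_left _ (hκ.continuous_fderiv (by norm_num))
      hu.locallyIntegrable x
  unfold convolution
  rw [ContinuousLinearMap.integral_apply hint]
  simp [mollify, ContinuousLinearMap.precompL_apply]

theorem HasCompactSupport.dirDeriv (hc : HasCompactSupport κ) (v : E) :
    HasCompactSupport (dirDeriv v κ) := by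
  have := (hc.fderiv ℝ)
  exact this.comp_left (g := fun L : E →L[ℝ] ℝ => L v) (by simp)

/-- Integration by parts: a derivative may be moved from the kernel to the function. -/
theorem mollify_dirDeriv (hκ : ContDiff ℝ 1 κ) (hc : HasCompactSupport κ) (hf : ContDiff ℝ 1 f)
    (v : E) : mollify μ (dirDeriv v κ) f = mollify μ κ (dirDeriv v f) := by
  ext x
  have hg : ContDiff ℝ 1 fun y => f (x - y) := hf.comp (contDiff_const.sub contDiff_id)
  have hfd : ∀ y, fderiv ℝ (fun y => f (x - y)) y v = - dirDeriv v f (x - y) := by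
    intro y
    have h1 : HasFDerivAt (fun y : E => x - y) (-ContinuousLinearMap.id ℝ E) y := by
      simpa using (hasFDerivAt_id y).const_sub x
    have h2 := ((hf.differentiable (by norm_num) (x - y)).hasFDerivAt).comp y h1
    have h3 := h2.fderiv
    simp only [Function.comp_def] at h3
    rw [h3]
    simp [dirDeriv]
  have hcd : Continuous (dirDeriv v κ) := (hκ.dirDeriv (k := 0) (by norm_num) v).continuous
  have hfc : Continuous (dirDeriv v f) := (hf.dirDeriv (k := 0) (by norm_num) v).continuous
  have hib := integral_mul_fderiv_eq_neg_fderiv_mul_of_integrable (μ := μ) (f := κ)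
    (g := fun y => f (x - y)) (v := v)
    (mollify_integrable hcd (hc.dirDeriv v) hf.continuous x)
    (by simp only [hfd, mul_neg]; exact (mollify_integrable hκ.continuous hc hfc x).neg)
    (mollify_integrable hκ.continuous hc hf.continuous x)
    (fun y _ => hκ.differentiable (by norm_num) y)
    (fun y _ => hg.differentiable (by norm_num) y)
  simp only [hfd, mul_neg, integral_neg, neg_inj] at hib
  exact hib.symm

theorem hess_mollify (hκ : ContDiff ℝ 2 κ) (hc : HasCompactSupport κ) (hu : Continuous u)
    (x v : E) : hess (mollify μ κ u) x v = mollify μ (dirDeriv v (dirDeriv v κ)) u x := by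
  have h1 : ContDiff ℝ 1 κ := hκ.of_le (by norm_num)
  rw [hess_eq_dirDeriv (contDiff_mollify (k := 2) (mod_cast hκ) hc hu), dirDeriv_mollify h1 hc hu,
    dirDeriv_mollify (hκ.dirDeriv (k := 1) (by norm_num) v) (hc.dirDeriv v) hu]

theorem hess_mollify' (hκ : ContDiff ℝ 2 κ) (hc : HasCompactSupport κ) (hf : ContDiff ℝ 2 f)
    (x v : E) : hess (mollify μ κ f) x v = mollify μ κ (fun y => hess f y v) x := by
  have h1 : ContDiff ℝ 1 κ := hκ.of_le (by norm_num)
  rw [hess_mollify hκ hc hf.continuous,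
    mollify_dirDeriv (hκ.dirDeriv (k := 1) (by norm_num) v) (hc.dirDeriv v)
      (hf.of_le (by norm_num)),
    mollify_dirDeriv h1 hc (hf.dirDeriv (k := 1) (by norm_num) v)]
  simp only [hess_eq_dirDeriv hf]

theorem abs_mollify_le (hκ : Continuous κ) (hc : HasCompactSupport κ) {C : ℝ}
    (hC : ∀ x, |u x| ≤ C) (x : E) : |mollify μ κ u x| ≤ (∫ y, |κ y| ∂μ) * C := by
  unfold mollify
  have hi : Integrable (fun y => |κ y| * C) μ :=
    ((hκ.integrable_of_hasCompactSupport hc).abs).mul_const C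
  rw [← integral_mul_const, ← Real.norm_eq_abs]
  refine norm_integral_le_of_norm_le hi (Filter.Eventually.of_forall fun y => ?_)
  rw [Real.norm_eq_abs, abs_mul]
  exact mul_le_mul_of_nonneg_left (hC _) (abs_nonneg _)

theorem mollify_sub_apply {C : ℝ≥0} (hκ : Continuous κ) (hc : HasCompactSupport κ)
    (hu : LipschitzWith C u) (x y : E) :
    |mollify μ κ u x - mollify μ κ u y| ≤ (∫ y, |κ y| ∂μ) * C * ‖x - y‖ := by
  unfold mollify
  rw [← integral_sub (mollify_integrable hκ hc hu.continuous x)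
    (mollify_integrable hκ hc hu.continuous y)]
  have hi : Integrable (fun y => |κ y|) μ :=
    ((hκ.integrable_of_hasCompactSupport hc).abs)
  rw [mul_assoc, ← integral_mul_const, ← Real.norm_eq_abs]
  refine norm_integral_le_of_norm_le (hi.mul_const _) (Filter.Eventually.of_forall fun z => ?_)
  rw [Real.norm_eq_abs, ← mul_sub, abs_mul]
  refine mul_le_mul_of_nonneg_left ?_ (abs_nonneg _)
  have := hu.dist_le_mul (x - z) (y - z)
  simpa [dist_eq_norm] using this

namespace IsMollifier

variable (hκ : IsMollifier μ κ)
include hκ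

theorem contDiff_nat (k : ℕ∞) : ContDiff ℝ k κ := hκ.contDiff.of_le (by exact_mod_cast le_top)

theorem integrable : Integrable κ μ :=
  hκ.contDiff.continuous.integrable_of_hasCompactSupport hκ.compact

theorem integrable_mul (hu : Continuous u) (x : E) : Integrable (fun y => κ y * u (x - y)) μ :=
  mollify_integrable hκ.contDiff.continuous hκ.compact hu x

theorem contDiff_mollify (hu : Continuous u) (k : ℕ∞) : ContDiff ℝ k (mollify μ κ u) :=
  _root_.contDiff_mollify (hκ.contDiff_nat k) hκ.compact hu

theorem mollify_const (c : ℝ) (x : E) : mollify μ κ (fun _ => c) x = c := by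
  simp [mollify, integral_mul_const, hκ.integral]

theorem mollify_sub_const (hf : Continuous f) (c : ℝ) (x : E) :
    mollify μ κ (fun y => f y - c) x = mollify μ κ f x - c := by
  unfold mollify
  simp only [mul_sub]
  rw [integral_sub (hκ.integrable_mul hf x) (hκ.integrable.mul_const _), integral_mul_const,
    hκ.integral, one_mul]

theorem mollify_mono {u v : E → ℝ} (hu : Continuous u) (hv : Continuous v) {x : E}
    (h : ∀ y, κ y ≠ 0 → u (x - y) ≤ v (x - y)) : mollify μ κ u x ≤ mollify μ κ v x := by
  refine integral_mono (hκ.integrable_mul hu x) (hκ.integrable_mul hv x) fun y => ?_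
  by_cases hy : κ y = 0
  · simp [hy]
  · exact mul_le_mul_of_nonneg_left (h y hy) (hκ.nonneg y)

theorem mollify_le {c : ℝ} (hu : Continuous u) {x : E} (h : ∀ y, κ y ≠ 0 → u (x - y) ≤ c) :
    mollify μ κ u x ≤ c := by
  have := hκ.mollify_mono hu (continuous_const (y := c)) h
  rwa [hκ.mollify_const] at this

theorem le_mollify {c : ℝ} (hu : Continuous u) {x : E} (h : ∀ y, κ y ≠ 0 → c ≤ u (x - y)) :
    c ≤ mollify μ κ u x := by
  have := hκ.mollify_mono (continuous_const (y := c)) hu h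
  rwa [hκ.mollify_const] at this

theorem integral_abs : ∫ y, |κ y| ∂μ = 1 := by
  simp only [abs_of_nonneg (hκ.nonneg _), hκ.integral]

theorem lipschitz_mollify {C : ℝ≥0} (hu : LipschitzWith C u) : LipschitzWith C (mollify μ κ u) := by
  refine LipschitzWith.of_dist_le_mul fun x y => ?_
  have := mollify_sub_apply (μ := μ) hκ.contDiff.continuous hκ.compact hu x y
  rwa [hκ.integral_abs, one_mul, ← dist_eq_norm, ← Real.dist_eq] at this

theorem abs_mollify_sub_le {ε : ℝ} (hs : ∀ y, κ y ≠ 0 → ‖y‖ ≤ ε) {C : ℝ≥0}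
    (hu : LipschitzWith C u) (x : E) : |mollify μ κ u x - u x| ≤ C * ε := by
  have h : ∀ y, κ y ≠ 0 → |u (x - y) - u x| ≤ C * ε := fun y hy => by
    have := hu.dist_le_mul (x - y) x
    rw [Real.dist_eq, dist_eq_norm] at this
    refine this.trans ?_
    simpa using mul_le_mul_of_nonneg_left (hs y hy) C.2
  rw [abs_le]
  constructor
  · have := hκ.le_mollify hu.continuous (x := x) (c := u x - C * ε) fun y hy => by
      have := (abs_le.1 (h y hy)).1
      linarith
    linarith
  · have := hκ.mollify_le hu.continuous (x := x) (c := u x + C * ε) fun y hy => by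
      have := (abs_le.1 (h y hy)).2
      linarith
    linarith

end IsMollifier

end Mollify

/-! ### Viscosity subsolutions of linear equations and random walks -/

section Penalise

variable {E : Type*} [NormedAddCommGroup E] [NormedSpace ℝ E] [FiniteDimensional ℝ E]

/-- A bounded function need not attain its supremum, but it does after subtracting a small multiple
of `‖y - x₀‖²`, at a point where its value is at least the value at `x₀`. -/
theorem exists_penalised_max {G : E → ℝ} (hG : Continuous G) {C : ℝ} (hC : ∀ x, G x ≤ C)
    {δ : ℝ} (hδ : 0 < δ) (x₀ : E) :
    ∃ x₁, G x₀ ≤ G x₁ ∧ ∀ y, G y - δ * ‖y - x₀‖ ^ 2 ≤ G x₁ - δ * ‖x₁ - x₀‖ ^ 2 := by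
  have : ProperSpace E := FiniteDimensional.proper ℝ E
  have hF : Continuous fun y => G y - δ * ‖y - x₀‖ ^ 2 := by fun_prop
  obtain ⟨x₁, hx₁⟩ := hF.exists_forall_ge' x₀ (by
    have h1 : Filter.Tendsto (fun y => ‖y - x₀‖) (Filter.cocompact E) Filter.atTop := by
      have := tendsto_norm_cocompact_atTop (E := E)
      refine this.comp ?_
      exact (Homeomorph.subRight x₀).isClosedEmbedding.tendsto_cocompact
    have h2 : Filter.Tendsto (fun y => δ * ‖y - x₀‖ ^ 2) (Filter.cocompact E) Filter.atTop :=
      ((Filter.tendsto_pow_atTop (by norm_num)).comp h1).const_mul_atTop hδ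
    filter_upwards [h2.eventually_ge_atTop (C - G x₀)] with y hy
    have := hC y
    simp only [sub_self, norm_zero]
    linarith)
  refine ⟨x₁, ?_, hx₁⟩
  have := hx₁ x₀
  simp only [sub_self, norm_zero] at this
  have h3 : 0 ≤ δ * ‖x₁ - x₀‖ ^ 2 := by positivity
  linarith

end Penalise

section Taylor

variable {E : Type*} [NormedAddCommGroup E] [NormedSpace ℝ E]

/-- If the second derivative in the direction `v` is `K`-Lipschitz, the symmetric second difference
is approximated by the second derivative to third order. -/
theorem abs_second_difference_sub_le {f : E → ℝ} (hf : ContDiff ℝ 2 f) {K : ℝ} {v : E}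
    (hK : ∀ x y, |hess f x v - hess f y v| ≤ K * ‖x - y‖) (x : E) {s : ℝ} (hs : 0 ≤ s) :
    |f (x + s • v) + f (x - s • v) - 2 * f x - s ^ 2 * hess f x v| ≤ 2 * K * ‖v‖ * s ^ 3 := by
  have hline : ∀ {g : E → ℝ}, Differentiable ℝ g → ∀ t : ℝ,
      HasDerivAt (fun s : ℝ => g (x - s • v)) (- dirDeriv v g (x - t • v)) t := by
    intro g hg t
    have := (hasDerivAt_line hg x v (-t)).comp t (hasDerivAt_neg t)
    simpa [Function.comp_def, sub_eq_add_neg] using this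
  have hd1 : Differentiable ℝ f := hf.differentiable (by norm_num)
  have hd2 : Differentiable ℝ (dirDeriv v f) :=
    (hf.dirDeriv (k := 1) (by norm_num) v).differentiable (by norm_num)
  have hK0 : 0 ≤ K * ‖v‖ := by
    have := (abs_nonneg _).trans (hK (0 + v) 0)
    simpa using this
  let φ : ℝ → ℝ := fun t => f (x + t • v) + f (x - t • v) - 2 * f x - t ^ 2 * hess f x v
  let ψ : ℝ → ℝ := fun t => dirDeriv v f (x + t • v) - dirDeriv v f (x - t • v)
    - 2 * t * hess f x v
  have hφ : ∀ t, HasDerivAt φ (ψ t) t := fun t => by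
    have := (((hasDerivAt_line hd1 x v t).add (hline hd1 t)).sub_const (2 * f x)).sub
      (((hasDerivAt_id t).pow 2).mul_const (hess f x v))
    refine this.congr_deriv ?_
    simp only [ψ, id]
    push_cast
    ring
  have hψ : ∀ t, HasDerivAt ψ (hess f (x + t • v) v + hess f (x - t • v) v - 2 * hess f x v) t :=
      fun t => by
    have := ((hasDerivAt_line hd2 x v t).sub (hline hd2 t)).sub
      (((hasDerivAt_id t).const_mul 2).mul_const (hess f x v))
    refine this.congr_deriv ?_
    rw [hess_eq_dirDeriv hf (x + t • v), hess_eq_dirDeriv hf (x - t • v)]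
    ring
  have hψ' : ∀ t ∈ Set.Icc 0 s,
      ‖hess f (x + t • v) v + hess f (x - t • v) v - 2 * hess f x v‖ ≤ 2 * K * ‖v‖ * s := by
    intro t ht
    have e1 := hK (x + t • v) x
    have e2 := hK (x - t • v) x
    have n1 : ‖x + t • v - x‖ = t * ‖v‖ := by
      rw [add_sub_cancel_left, norm_smul, Real.norm_of_nonneg ht.1]
    have n2 : ‖x - t • v - x‖ = t * ‖v‖ := by
      rw [sub_sub_cancel_left, norm_neg, norm_smul, Real.norm_of_nonneg ht.1]
    rw [n1] at e1
    rw [n2] at e2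
    have e3 : K * (t * ‖v‖) ≤ K * ‖v‖ * s := by nlinarith [ht.2]
    rw [Real.norm_eq_abs, abs_le]
    rw [abs_le] at e1 e2
    constructor <;> linarith [e1.1, e1.2, e2.1, e2.2]
  have hψb : ∀ t ∈ Set.Icc 0 s, ‖ψ t‖ ≤ 2 * K * ‖v‖ * s * s := by
    intro t ht
    have := (convex_Icc 0 s).norm_image_sub_le_of_norm_hasDerivWithin_le
      (fun t _ => (hψ t).hasDerivWithinAt) hψ' (Set.left_mem_Icc.2 hs) ht
    have h0 : ψ 0 = 0 := by simp [ψ]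
    rw [h0, sub_zero, sub_zero, Real.norm_of_nonneg ht.1] at this
    refine this.trans ?_
    exact mul_le_mul_of_nonneg_left ht.2 (by nlinarith)
  have := (convex_Icc 0 s).norm_image_sub_le_of_norm_hasDerivWithin_le
      (fun t _ => (hφ t).hasDerivWithinAt) hψb (Set.left_mem_Icc.2 hs) (Set.right_mem_Icc.2 hs)
  have h0 : φ 0 = 0 := by simp [φ]; ring
  rw [h0, sub_zero, sub_zero, Real.norm_of_nonneg hs, Real.norm_eq_abs] at this
  refine this.trans (le_of_eq ?_)
  ring

end Taylor

section Walk

variable {E : Type*} [NormedAddCommGroup E] [NormedSpace ℝ E] {ι : Type*} [Fintype ι]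

/-- The operator `f ↦ ∑ l_k ∂²f/∂b_k²`. -/
noncomputable def weightedLap (l : ι → ℝ) (b : ι → E) (f : E → ℝ) (x : E) : ℝ :=
  ∑ k, l k * hess f x (b k)

/-- One step of the random walk that moves by `± s b_k` with probability proportional to `l_k`. -/
noncomputable def walk (l : ι → ℝ) (b : ι → E) (s : ℝ) (f : E → ℝ) (x : E) : ℝ :=
  (2 * ∑ k, l k)⁻¹ * ∑ k, l k * (f (x + s • b k) + f (x - s • b k))

variable {l : ι → ℝ} {b : ι → E} {s : ℝ} {f g : E → ℝ}

theorem walk_mono (hl : ∀ k, 0 ≤ l k) (h : ∀ x, f x ≤ g x) (x : E) :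
    walk l b s f x ≤ walk l b s g x := by
  unfold walk
  have : 0 ≤ ∑ k, l k := Finset.sum_nonneg fun k _ => hl k
  gcongr with k
  · exact hl k
  · exact h _
  · exact h _

theorem walk_sub (hW : 0 < ∑ k, l k) (x : E) :
    walk l b s f x - f x
      = (2 * ∑ k, l k)⁻¹ * ∑ k, l k * (f (x + s • b k) + f (x - s • b k) - 2 * f x) := by
  unfold walk
  simp only [mul_sub, Finset.sum_sub_distrib, ← Finset.sum_mul]
  field_simp

theorem walk_const (hW : 0 < ∑ k, l k) (c : ℝ) (x : E) : walk l b s (fun _ => c) x = c := by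
  have := walk_sub (l := l) (b := b) (s := s) (f := fun _ => c) hW x
  have h2 : c + c - 2 * c = 0 := by ring
  simp only [h2, mul_zero, Finset.sum_const_zero] at this
  linarith

theorem walk_add (x : E) :
    walk l b s (fun y => f y + g y) x = walk l b s f x + walk l b s g x := by
  unfold walk
  rw [← mul_add, ← Finset.sum_add_distrib]
  congr 1
  exact Finset.sum_congr rfl fun k _ => by ring

theorem walk_const_mul (c : ℝ) (x : E) :
    walk l b s (fun y => c * f y) x = c * walk l b s f x := by
  unfold walk
  generalize (2 * ∑ k, l k)⁻¹ = W
  rw [mul_left_comm c]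
  congr 1
  rw [Finset.mul_sum]
  exact Finset.sum_congr rfl fun k _ => by ring

theorem walk_add_const (hW : 0 < ∑ k, l k) (c : ℝ) (x : E) :
    walk l b s (fun y => f y + c) x = walk l b s f x + c := by
  rw [walk_add (g := fun _ => c), walk_const hW]

theorem contDiff_walk {k : WithTop ℕ∞} (hf : ContDiff ℝ k f) : ContDiff ℝ k (walk l b s f) := by
  refine contDiff_const.mul (ContDiff.sum fun k _ => contDiff_const.mul ?_)
  exact (hf.comp (contDiff_id.add contDiff_const)).add (hf.comp (contDiff_id.sub contDiff_const))

theorem continuous_walk (hf : Continuous f) : Continuous (walk l b s f) := by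
  unfold walk
  fun_prop

theorem hess_walk (hf : ContDiff ℝ 2 f) (x v : E) :
    hess (walk l b s f) x v = walk l b s (fun y => hess f y v) x := by
  have h1 : ∀ a : E, ContDiff ℝ 2 fun y => f (y + a) := fun a =>
    hf.comp (contDiff_id.add contDiff_const)
  have h2 : ∀ k, ContDiff ℝ 2 fun y => f (y + s • b k) + f (y - s • b k) := fun k =>
    (h1 _).add (hf.comp (contDiff_id.sub contDiff_const))
  unfold walk
  rw [hess_const_mul (ContDiff.sum fun k _ => contDiff_const.mul (h2 k)),
    hess_finset_sum _ fun k _ => contDiff_const.mul (h2 k)]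
  congr 1
  refine Finset.sum_congr rfl fun k _ => ?_
  rw [hess_const_mul (h2 k)]
  simp only [sub_eq_add_neg]
  rw [hess_add (h1 _) (h1 _), hess_comp_add_right, hess_comp_add_right]

/-- `|walk g - g|` is controlled by the modulus of continuity of `g`. -/
theorem abs_walk_sub_le (hl : ∀ k, 0 ≤ l k) (hW : 0 < ∑ k, l k) {B : ℝ} (hB : ∀ k, ‖b k‖ ≤ B)
    (hs : 0 ≤ s) {K : ℝ} (hK0 : 0 ≤ K) (hK : ∀ x y, |g x - g y| ≤ K * ‖x - y‖) (x : E) :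
    |walk l b s g x - g x| ≤ K * B * s := by
  have key : ∀ y, ‖y - x‖ ≤ B * s → |g y - g x| ≤ K * B * s := fun y hy =>
    (hK y x).trans (by rw [mul_assoc]; exact mul_le_mul_of_nonneg_left hy hK0)
  have hn : ∀ k, ‖s • b k‖ ≤ B * s := fun k => by
    rw [norm_smul, Real.norm_of_nonneg hs, mul_comm]
    exact mul_le_mul_of_nonneg_right (hB k) hs
  rw [walk_sub hW, abs_mul, abs_of_pos (by positivity), inv_mul_le_iff₀ (by positivity)]
  refine (Finset.abs_sum_le_sum_abs _ _).trans ?_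
  rw [mul_assoc, Finset.sum_mul, Finset.mul_sum]
  refine Finset.sum_le_sum fun k _ => ?_
  rw [abs_mul, abs_of_nonneg (hl k)]
  have e1 := key (x + s • b k) (by simpa using hn k)
  have e2 := key (x - s • b k) (by simpa using hn k)
  have e3 : |g (x + s • b k) + g (x - s • b k) - 2 * g x| ≤ 2 * (K * B * s) := by
    rw [abs_le] at *
    constructor <;> linarith [e1.1, e1.2, e2.1, e2.2]
  calc _ ≤ l k * (2 * (K * B * s)) := mul_le_mul_of_nonneg_left e3 (hl k)
    _ = _ := by ring

theorem abs_walk_sub_lap_le (hl : ∀ k, 0 ≤ l k) (hW : 0 < ∑ k, l k) {B : ℝ}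
    (hB : ∀ k, ‖b k‖ ≤ B) (hs : 0 ≤ s) (hf : ContDiff ℝ 2 f) {K : ℝ} (hK0 : 0 ≤ K)
    (hK : ∀ k x y, |hess f x (b k) - hess f y (b k)| ≤ K * ‖x - y‖) (x : E) :
    |walk l b s f x - f x - s ^ 2 / (2 * ∑ k, l k) * weightedLap l b f x| ≤ K * B * s ^ 3 := by
  have e : walk l b s f x - f x - s ^ 2 / (2 * ∑ k, l k) * weightedLap l b f x
      = (2 * ∑ k, l k)⁻¹ * ∑ k, l k *
        (f (x + s • b k) + f (x - s • b k) - 2 * f x - s ^ 2 * hess f x (b k)) := by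
    rw [walk_sub hW, weightedLap, div_eq_inv_mul]
    generalize (2 * ∑ k, l k)⁻¹ = W
    rw [mul_assoc, ← mul_sub, Finset.mul_sum, ← Finset.sum_sub_distrib]
    congr 1
    exact Finset.sum_congr rfl fun k _ => by ring
  rw [e, abs_mul, abs_of_pos (by positivity), inv_mul_le_iff₀ (by positivity)]
  refine (Finset.abs_sum_le_sum_abs _ _).trans ?_
  rw [mul_assoc, Finset.sum_mul, Finset.mul_sum]
  refine Finset.sum_le_sum fun k _ => ?_
  rw [abs_mul, abs_of_nonneg (hl k)]
  have e3 := abs_second_difference_sub_le hf (hK k) x hs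
  have e4 : 2 * K * ‖b k‖ * s ^ 3 ≤ 2 * (K * B * s ^ 3) := by
    have : K * ‖b k‖ * s ^ 3 ≤ K * B * s ^ 3 := by
      have := hB k
      gcongr
    linarith
  calc _ ≤ l k * (2 * (K * B * s ^ 3)) := mul_le_mul_of_nonneg_left (e3.trans e4) (hl k)
    _ = _ := by ring

end Walk

section Viscosity

variable {E : Type*} [NormedAddCommGroup E] [NormedSpace ℝ E] [FiniteDimensional ℝ E]
  [InnerProductSpace ℂ E] [IsScalarTower ℝ ℂ E] {ι : Type*} [Fintype ι]
  {l : ι → ℝ} {b : ι → E} {s : ℝ} {u f : E → ℝ}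

/-- Viscosity subsolutions of the linear equation `∑ l_k ∂²u/∂b_k² = 0`. -/
def IsLapSubsolution (l : ι → ℝ) (b : ι → E) (u : E → ℝ) : Prop :=
  ∀ h : E → ℝ, ContDiff ℝ 2 h → ∀ z, IsLocalMax (fun w => u w - h w) z → 0 ≤ weightedLap l b h z

/-- Comparison with one step of the walk: an upper bound `f + M` of a viscosity subsolution
survives averaging, up to third order in the step. -/
theorem IsLapSubsolution.le_walk (hvis : IsLapSubsolution l b u) (hl : ∀ k, 0 ≤ l k)
    (hW : 0 < ∑ k, l k) {B : ℝ} (hB : ∀ k, ‖b k‖ ≤ B) (hs : 0 ≤ s) (hu : Continuous u) {C : ℝ}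
    (huC : ∀ x, u x ≤ C) {C' : ℝ} (hfC : ∀ x, C' ≤ f x) (hf : ContDiff ℝ 2 f) {K : ℝ}
    (hK0 : 0 ≤ K) (hK : ∀ k x y, |hess f x (b k) - hess f y (b k)| ≤ K * ‖x - y‖) {M : ℝ}
    (hM : ∀ x, u x ≤ f x + M) (x : E) :
    u x ≤ walk l b s f x + (M + 2 * K * B * s ^ 3) := by
  set W := ∑ k, l k with hWdef
  have hg : ContDiff ℝ 2 (walk l b s f) := contDiff_walk hf
  have key : ∀ δ : ℝ, 0 < δ →
      u x - walk l b s f x ≤ M + 2 * K * B * s ^ 3 + δ * (B ^ 2 * s ^ 2) := by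
    intro δ hδ
    -- At an almost maximum `x₁` of `u - walk f` the equation gives `0 ≤ L (walk f) ≈ L f`, up to a
    -- multiple of `δ`, where `L = weightedLap l b`, so that `walk f ≥ f` at `x₁` up to third order in `s`.
    obtain ⟨x₁, h1, h2⟩ := exists_penalised_max (G := fun y => u y - walk l b s f y)
      (hu.sub hg.continuous) (C := C - C') (fun y => by
        have e1 := huC y
        have e2 := walk_mono (l := l) (b := b) (s := s) hl hfC y
        rw [walk_const hW] at e2
        linarith) hδ x
    have hq : ContDiff ℝ 2 fun y : E => ‖y - x‖ ^ 2 :=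
      (contDiff_norm_sq ℂ).comp (contDiff_id.sub contDiff_const)
    have hlap := hvis (fun y => walk l b s f y + δ * ‖y - x‖ ^ 2)
      (hg.add (contDiff_const.mul hq)) x₁
      (Filter.Eventually.of_forall fun y => by have := h2 y; simp only; linarith)
    have e1 : weightedLap l b (fun y => walk l b s f y + δ * ‖y - x‖ ^ 2) x₁
        ≤ weightedLap l b f x₁ + W * (K * B * s) + δ * (2 * W * B ^ 2) := by
      have hterm : ∀ k, l k * hess (fun y => walk l b s f y + δ * ‖y - x‖ ^ 2) x₁ (b k)
          ≤ l k * hess f x₁ (b k) + l k * (K * B * s) + δ * (2 * l k * B ^ 2) := by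
        intro k
        rw [hess_add hg (contDiff_const.mul hq), hess_const_mul hq, hess_norm_sq_sub,
          hess_walk hf]
        have a1 := (abs_le.1 (abs_walk_sub_le (g := fun y => hess f y (b k)) hl hW hB hs hK0
          (hK k) x₁)).2
        have a2 : ‖b k‖ ^ 2 ≤ B ^ 2 := pow_le_pow_left₀ (norm_nonneg _) (hB k) 2
        have a3 : walk l b s (fun y => hess f y (b k)) x₁ + δ * (2 * ‖b k‖ ^ 2)
            ≤ hess f x₁ (b k) + K * B * s + δ * (2 * B ^ 2) := by nlinarith
        calc _ ≤ l k * (hess f x₁ (b k) + K * B * s + δ * (2 * B ^ 2)) :=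
              mul_le_mul_of_nonneg_left a3 (hl k)
          _ = _ := by ring
      refine (Finset.sum_le_sum fun k _ => hterm k).trans (le_of_eq ?_)
      simp only [weightedLap, Finset.sum_add_distrib, Finset.sum_mul, Finset.mul_sum, hWdef]
    have e2 : -(W * (K * B * s) + δ * (2 * W * B ^ 2)) ≤ weightedLap l b f x₁ := by linarith
    have e3 := (abs_le.1 (abs_walk_sub_lap_le hl hW hB hs hf hK0 hK x₁)).1
    rw [← hWdef] at e3
    have e4 : s ^ 2 / (2 * W) * -(W * (K * B * s) + δ * (2 * W * B ^ 2))
        ≤ s ^ 2 / (2 * W) * weightedLap l b f x₁ :=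
      mul_le_mul_of_nonneg_left e2 (by positivity)
    have e5 : s ^ 2 / (2 * W) * -(W * (K * B * s) + δ * (2 * W * B ^ 2))
        = -(K * B * s ^ 3 / 2 + δ * (B ^ 2 * s ^ 2)) := by
      field_simp
    have e6 := hM x₁
    have e7 : 0 ≤ K * B * s ^ 3 := by
      have h8 := (abs_nonneg _).trans (abs_walk_sub_lap_le hl hW hB hs hf hK0 hK x₁)
      exact h8
    linarith
  have hlim : Filter.Tendsto (fun δ : ℝ => M + 2 * K * B * s ^ 3 + δ * (B ^ 2 * s ^ 2))
      (nhdsWithin 0 (Set.Ioi 0)) (nhds (M + 2 * K * B * s ^ 3 + 0 * (B ^ 2 * s ^ 2))) := by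
    refine Filter.Tendsto.mono_left ?_ nhdsWithin_le_nhds
    exact (Continuous.tendsto (by fun_prop) 0)
  have := ge_of_tendsto hlim (Filter.eventually_of_mem self_mem_nhdsWithin fun δ hδ => key δ hδ)
  linarith

end Viscosity

section Mollifier

variable {E : Type*} [NormedAddCommGroup E] [NormedSpace ℝ E] [FiniteDimensional ℝ E]
  [MeasurableSpace E] [BorelSpace E] (μ : Measure E) [μ.IsAddHaarMeasure]

theorem exists_isMollifier {ε : ℝ} (hε : 0 < ε) :
    ∃ κ : E → ℝ, IsMollifier μ κ ∧ ∀ y, κ y ≠ 0 → ‖y‖ ≤ ε := by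
  let φ : ContDiffBump (0 : E) := ⟨ε / 2, ε, by positivity, by linarith⟩
  refine ⟨φ.normed μ, ⟨φ.contDiff_normed, φ.hasCompactSupport_normed, φ.nonneg_normed,
    φ.integral_normed⟩, fun y hy => ?_⟩
  have : y ∈ Function.support (φ.normed μ) := hy
  rw [φ.support_normed_eq] at this
  exact (mem_ball_zero_iff.1 this).le

variable {μ} {ι : Type*} [Fintype ι] {l : ι → ℝ} {b : ι → E} {s : ℝ} {u f κ : E → ℝ}

theorem mollify_comp_add_right (a x : E) :
    mollify μ κ (fun y => f (y + a)) x = mollify μ κ f (x + a) := by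
  unfold mollify
  simp only [sub_add_eq_add_sub]

theorem mollify_walk (hκ : Continuous κ) (hc : HasCompactSupport κ) (hf : Continuous f) :
    mollify μ κ (walk l b s f) = walk l b s (mollify μ κ f) := by
  ext x
  have hi : ∀ a : E, Integrable (fun y => κ y * f (x + a - y)) μ := fun a =>
    mollify_integrable hκ hc hf (x + a)
  have e : ∀ y, κ y * walk l b s f (x - y) = (2 * ∑ k, l k)⁻¹ *
      ∑ k, l k * (κ y * f (x + s • b k - y) + κ y * f (x + -(s • b k) - y)) := by
    intro y
    unfold walk
    rw [mul_left_comm]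
    congr 1
    rw [Finset.mul_sum]
    refine Finset.sum_congr rfl fun k _ => ?_
    rw [show x - y + s • b k = x + s • b k - y by abel,
      show x - y - s • b k = x + -(s • b k) - y by abel]
    ring
  rw [mollify]
  simp only [e]
  rw [integral_const_mul, walk]
  congr 1
  rw [integral_finsetSum _ fun k _ =>
    Integrable.const_mul (f := fun y => κ y * f (x + s • b k - y) + κ y * f (x + -(s • b k) - y))
      ((hi _).add (hi _)) _]
  refine Finset.sum_congr rfl fun k _ => ?_
  rw [integral_const_mul, integral_add (hi _) (hi _), sub_eq_add_neg x]
  rfl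

theorem mollify_walk_iterate (hκ : Continuous κ) (hc : HasCompactSupport κ) (N : ℕ) :
    ∀ {f : E → ℝ}, Continuous f →
      mollify μ κ ((walk l b s)^[N] f) = (walk l b s)^[N] (mollify μ κ f) := by
  induction N with
  | zero => intro f _; rfl
  | succ N ih =>
    intro f hf
    rw [Function.iterate_succ_apply, Function.iterate_succ_apply, ih (continuous_walk hf),
      mollify_walk hκ hc hf]

theorem continuous_walk_iterate (hf : Continuous f) (N : ℕ) :
    Continuous ((walk l b s)^[N] f) := by
  induction N with
  | zero => exact hf
  | succ N ih => rw [Function.iterate_succ_apply']; exact continuous_walk ih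

theorem walk_iterate_le_add (hl : ∀ k, 0 ≤ l k) (hW : 0 < ∑ k, l k) {g : E → ℝ} {c : ℝ}
    (h : ∀ x, f x ≤ g x + c) (N : ℕ) (x : E) :
    (walk l b s)^[N] f x ≤ (walk l b s)^[N] g x + c := by
  induction N generalizing x with
  | zero => exact h x
  | succ N ih =>
    rw [Function.iterate_succ_apply', Function.iterate_succ_apply', ← walk_add_const hW]
    exact walk_mono hl ih x

theorem hess_mollify_lipschitz (hκ : ContDiff ℝ 2 κ) (hc : HasCompactSupport κ) {C : ℝ≥0}
    (hu : LipschitzWith C u) (b : ι → E) :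
    ∃ K, 0 ≤ K ∧ ∀ k x y, |hess (mollify μ κ u) x (b k) - hess (mollify μ κ u) y (b k)|
      ≤ K * ‖x - y‖ := by
  have hnn : ∀ k, 0 ≤ (∫ y, |dirDeriv (b k) (dirDeriv (b k) κ) y| ∂μ) * C := fun k =>
    mul_nonneg (integral_nonneg fun _ => abs_nonneg _) C.2
  refine ⟨∑ k, (∫ y, |dirDeriv (b k) (dirDeriv (b k) κ) y| ∂μ) * C,
    Finset.sum_nonneg fun k _ => hnn k, fun k x y => ?_⟩
  rw [hess_mollify hκ hc hu.continuous, hess_mollify hκ hc hu.continuous]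
  have h2 : Continuous (dirDeriv (b k) (dirDeriv (b k) κ)) :=
    ((hκ.dirDeriv (k := 1) (by norm_num) _).dirDeriv (k := 0) (by norm_num) _).continuous
  refine (mollify_sub_apply h2 ((hc.dirDeriv _).dirDeriv _) hu x y).trans ?_
  refine mul_le_mul_of_nonneg_right ?_ (norm_nonneg _)
  exact Finset.single_le_sum (f := fun k => (∫ y, |dirDeriv (b k) (dirDeriv (b k) κ) y| ∂μ) * C)
    (fun k _ => hnn k) (Finset.mem_univ k)

theorem hess_mollify_bounded (hκ : ContDiff ℝ 2 κ) (hc : HasCompactSupport κ) (hu : Continuous u)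
    {C : ℝ} (hC : ∀ x, |u x| ≤ C) (v : E) : ∃ G, ∀ x, |hess (mollify μ κ u) x v| ≤ G := by
  refine ⟨(∫ y, |dirDeriv v (dirDeriv v κ) y| ∂μ) * C, fun x => ?_⟩
  rw [hess_mollify hκ hc hu]
  exact abs_mollify_le ((hκ.dirDeriv (k := 1) (by norm_num) _).dirDeriv (k := 0)
    (by norm_num) _).continuous ((hc.dirDeriv _).dirDeriv _) hC x

theorem two_le_infty : (2 : WithTop ℕ∞) ≤ ((⊤ : ℕ∞) : WithTop ℕ∞) := by
  exact WithTop.coe_le_coe.2 (le_top : (2 : ℕ∞) ≤ ⊤)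

theorem weightedLap_mollify (hκ : ContDiff ℝ (⊤ : ℕ∞) κ) (hc : HasCompactSupport κ)
    (hu : Continuous u) : ∃ κ' : E → ℝ, ContDiff ℝ (⊤ : ℕ∞) κ' ∧ HasCompactSupport κ' ∧
      weightedLap l b (mollify μ κ u) = mollify μ κ' u := by
  have h2 : ∀ v, ContDiff ℝ (⊤ : ℕ∞) (dirDeriv v (dirDeriv v κ)) := fun v =>
    (hκ.dirDeriv (k := ((⊤ : ℕ∞) : WithTop ℕ∞)) (by simp) v).dirDeriv (by simp) v
  have hc2 : ∀ v, HasCompactSupport (dirDeriv v (dirDeriv v κ)) := fun v =>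
    (hc.dirDeriv _).dirDeriv _
  have hcs : ∀ s : Finset ι, HasCompactSupport
      fun y => ∑ k ∈ s, l k * dirDeriv (b k) (dirDeriv (b k) κ) y := by
    classical
    intro s
    induction s using Finset.induction_on with
    | empty => simp only [Finset.sum_empty]; exact HasCompactSupport.zero
    | insert a s ha ih =>
      simp only [Finset.sum_insert ha]
      exact ((hc2 (b a)).mul_left (f := fun _ => l a)).add ih
  refine ⟨fun y => ∑ k, l k * dirDeriv (b k) (dirDeriv (b k) κ) y,
    ContDiff.sum fun k _ => contDiff_const.mul (h2 _), hcs _, ?_⟩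
  ext x
  unfold weightedLap
  simp only [hess_mollify (hκ.of_le two_le_infty) hc hu]
  unfold mollify
  simp only [Finset.sum_mul]
  rw [integral_finsetSum]
  · refine Finset.sum_congr rfl fun k _ => ?_
    simp only [mul_assoc, integral_const_mul]
  · intro k _
    simp only [mul_assoc]
    exact (mollify_integrable (h2 _).continuous (hc2 _) hu x).const_mul _

end Mollifier

section Iterate

variable {E : Type*} [NormedAddCommGroup E] [NormedSpace ℝ E] {ι : Type*} [Fintype ι]
  {l : ι → ℝ} {b : ι → E} {s : ℝ}

/-- Upper bound for the walk after `N` steps in terms of the generator at the starting point. -/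
theorem walk_iterate_le (hl : ∀ k, 0 ≤ l k) (hW : 0 < ∑ k, l k) {v g : E → ℝ} {a β c : ℝ}
    (ha : 0 ≤ a) (hc : 0 ≤ c)
    (hv : ∀ x, walk l b s v x ≤ v x + a * g x + β) (hg : ∀ x, walk l b s g x ≤ g x + c) (N : ℕ) :
    ∀ x, (walk l b s)^[N] v x ≤ v x + N * a * g x + (N * β + N ^ 2 * (a * c)) := by
  induction N with
  | zero => intro x; simp
  | succ N ih =>
    intro x
    rw [Function.iterate_succ_apply']
    refine (walk_mono hl ih x).trans ?_
    rw [walk_add_const hW, walk_add, walk_const_mul]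
    have h1 := hv x
    have h2 : N * a * walk l b s g x ≤ N * a * (g x + c) :=
      mul_le_mul_of_nonneg_left (hg x) (by positivity)
    have h3 : 0 ≤ a * c := by positivity
    have h4 : 0 ≤ (N : ℝ) * (a * c) := by positivity
    push_cast
    nlinarith

end Iterate

section Viscosity

variable {E : Type*} [NormedAddCommGroup E] [NormedSpace ℝ E] [FiniteDimensional ℝ E]
  [MeasurableSpace E] [BorelSpace E] {μ : Measure E} [μ.IsAddHaarMeasure]
  [InnerProductSpace ℂ E] [IsScalarTower ℝ ℂ E] {ι : Type*} [Fintype ι]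
  {l : ι → ℝ} {b : ι → E} {s : ℝ} {u f : E → ℝ}

theorem IsLapSubsolution.le_walk_iterate (hvis : IsLapSubsolution l b u) (hl : ∀ k, 0 ≤ l k)
    (hW : 0 < ∑ k, l k) {B : ℝ} (hB : ∀ k, ‖b k‖ ≤ B) (hs : 0 ≤ s) (hu : Continuous u) {C : ℝ}
    (huC : ∀ x, u x ≤ C) {C' : ℝ} (hfC : ∀ x, C' ≤ f x) (hf : ContDiff ℝ 2 f) {K : ℝ}
    (hK0 : 0 ≤ K) (hK : ∀ k x y, |hess f x (b k) - hess f y (b k)| ≤ K * ‖x - y‖) {M : ℝ}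
    (hM : ∀ x, u x ≤ f x + M) (N : ℕ) (x : E) :
    u x ≤ (walk l b s)^[N] f x + (M + N * (2 * K * B * s ^ 3)) := by
  induction N generalizing f M x with
  | zero => simpa using hM x
  | succ N ih =>
    rw [Function.iterate_succ_apply]
    have := ih (f := walk l b s f) (M := M + 2 * K * B * s ^ 3) ?_ (contDiff_walk hf) ?_ ?_ x
    · refine this.trans (le_of_eq ?_)
      push_cast
      ring
    · intro x
      have := walk_mono (l := l) (b := b) (s := s) hl hfC x
      rwa [walk_const hW] at this
    · intro k x y
      rw [hess_walk hf, hess_walk hf, walk, walk, ← mul_sub, ← Finset.sum_sub_distrib, abs_mul,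
        abs_of_pos (by positivity), inv_mul_le_iff₀ (by positivity)]
      refine (Finset.abs_sum_le_sum_abs _ _).trans ?_
      rw [mul_assoc, Finset.sum_mul, Finset.mul_sum]
      refine Finset.sum_le_sum fun j _ => ?_
      rw [← mul_sub, abs_mul, abs_of_nonneg (hl j)]
      have e1 := hK k (x + s • b j) (y + s • b j)
      have e2 := hK k (x - s • b j) (y - s • b j)
      rw [add_sub_add_right_eq_sub] at e1
      rw [sub_sub_sub_cancel_right] at e2
      have e3 : |hess f (x + s • b j) (b k) + hess f (x - s • b j) (b k)
          - (hess f (y + s • b j) (b k) + hess f (y - s • b j) (b k))| ≤ 2 * (K * ‖x - y‖) := by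
        rw [abs_le] at *
        constructor <;> linarith [e1.1, e1.2, e2.1, e2.2]
      calc _ ≤ l j * (2 * (K * ‖x - y‖)) := mul_le_mul_of_nonneg_left e3 (hl j)
        _ = _ := by ring
    · exact fun x => hvis.le_walk hl hW hB hs hu huC hfC hf hK0 hK hM x

/-- A bounded Lipschitz viscosity subsolution of `∑ l_k ∂²u/∂b_k² = 0` becomes a classical
subsolution after mollification. The operator may be degenerate.

The number `N` of steps of size `s` of the walk is chosen with `N s² = τ` fixed. The walk started at
a smooth approximation of `u` stays above `u` up to small errors, and it commutes with
mollification; as `s → 0` this gives `v ≤ v + c τ L v + O(τ²)` for the mollified function `v`, with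
`L` the operator and `c > 0`. -/
theorem IsLapSubsolution.weightedLap_mollify_nonneg (hvis : IsLapSubsolution l b u)
    (hl : ∀ k, 0 ≤ l k) (hW : 0 < ∑ k, l k) {C : ℝ≥0} (hu : LipschitzWith C u) {C' : ℝ}
    (huC : ∀ x, |u x| ≤ C') {η : E → ℝ} (hη : IsMollifier μ η) (x : E) :
    0 ≤ weightedLap l b (mollify μ η u) x := by
  set W := ∑ k, l k with hWdef
  set v := mollify μ η u with hv
  set B : ℝ := ∑ k, ‖b k‖ with hBdef
  have hB0 : 0 ≤ B := Finset.sum_nonneg fun k _ => norm_nonneg _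
  have hB : ∀ k, ‖b k‖ ≤ B := fun k =>
    Finset.single_le_sum (f := fun k => ‖b k‖) (fun k _ => norm_nonneg _) (Finset.mem_univ k)
  have hvC : ContDiff ℝ 2 v := hη.contDiff_mollify hu.continuous 2
  obtain ⟨Kv, hKv0, hKv⟩ := hess_mollify_lipschitz (μ := μ) (hη.contDiff_nat 2) hη.compact hu b
  obtain ⟨κ', hκ', hκ'c, hgκ⟩ := weightedLap_mollify (μ := μ) (l := l) (b := b) hη.contDiff
    hη.compact hu.continuous
  rw [← hv] at hgκ hKv
  set g := weightedLap l b v with hg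
  have hκ'2 : ContDiff ℝ 2 κ' := hκ'.of_le two_le_infty
  have hgC : ContDiff ℝ 2 g := by
    rw [hgκ]; exact contDiff_mollify (k := 2) (mod_cast hκ'2) hκ'c hu.continuous
  obtain ⟨Kg, hKg0, hKg⟩ := hess_mollify_lipschitz (μ := μ) hκ'2 hκ'c hu b
  rw [← hgκ] at hKg
  choose G hG using fun k => hess_mollify_bounded (μ := μ) hκ'2 hκ'c hu.continuous huC (b k)
  rw [← hgκ] at hG
  set G' := ∑ k, l k * G k
  have hG' : ∀ x, weightedLap l b g x ≤ G' := fun x =>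
    Finset.sum_le_sum fun k _ => mul_le_mul_of_nonneg_left ((le_abs_self _).trans (hG k x)) (hl k)
  have hG'0 : 0 ≤ G' := Finset.sum_nonneg fun k _ =>
    mul_nonneg (hl k) ((abs_nonneg _).trans (hG k 0))
  set c₀ := G' / (2 * W) + Kg * B with hc₀
  have hc₀0 : 0 ≤ c₀ := by positivity
  -- The effect of `N` steps of size `s` on `v`, for an arbitrary precision `ε`. The terms after the
  -- first are the third order error of each step, the variation of `g = L v` along the walk, and
  -- twice the distance between `u` and its approximation.
  have hsteps : ∀ ε : ℝ, 0 < ε → ∃ K, ∀ s, 0 ≤ s → s ≤ 1 → ∀ N : ℕ,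
      0 ≤ N * s ^ 2 / (2 * W) * g x + N * (s ^ 2 * s) * K
        + (N * s ^ 2) ^ 2 * c₀ / (2 * W) + 2 * (C * ε) := by
    intro ε hε
    obtain ⟨κ, hκ, hκε⟩ := exists_isMollifier (E := E) μ hε
    obtain ⟨K, hK0, hK⟩ := hess_mollify_lipschitz (μ := μ) (hκ.contDiff_nat 2) hκ.compact hu b
    refine ⟨Kv * B + 2 * K * B, fun s hs hs1 N => ?_⟩
    set f := mollify μ κ u
    have hfu : ∀ x, |f x - u x| ≤ C * ε := hκ.abs_mollify_sub_le hκε hu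
    have hfC : ContDiff ℝ 2 f := hκ.contDiff_mollify hu.continuous 2
    have h1 := hvis.le_walk_iterate (f := f) (s := s) hl hW hB hs hu.continuous (C := C')
      (fun x => (le_abs_self _).trans (huC x)) (C' := -C' - C * ε)
      (fun x => by have := (abs_le.1 (hfu x)).1; have := (abs_le.1 (huC x)).1; linarith) hfC hK0 hK
      (M := C * ε) (fun x => by have := (abs_le.1 (hfu x)).1; linarith) N
    set M' := (C : ℝ) * ε + N * (2 * K * B * s ^ 3) with hM'
    have h2 : ∀ y, u y ≤ (walk l b s)^[N] u y + (C * ε + M') := fun y => by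
      have := walk_iterate_le_add (l := l) (b := b) (s := s) (f := f) (g := u) (c := C * ε) hl hW
        (fun x => by have := (abs_le.1 (hfu x)).2; linarith) N y
      linarith [h1 y]
    have h3 : v x ≤ (walk l b s)^[N] v x + (C * ε + M') := by
      have e1 : Continuous ((walk l b s)^[N] u) := continuous_walk_iterate hu.continuous N
      have e2 := hη.mollify_mono (x := x) (u := fun y => u y - (C * ε + M'))
        (v := (walk l b s)^[N] u) (hu.continuous.sub continuous_const) e1
        (fun y _ => by have := h2 (x - y); linarith)
      rw [mollify_walk_iterate hη.contDiff.continuous hη.compact N hu.continuous] at e2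
      have e3 := hη.mollify_sub_const hu.continuous (C * ε + M') x
      rw [e3] at e2
      linarith
    have h4 := walk_iterate_le (l := l) (b := b) (s := s) (v := v) (g := g) (a := s ^ 2 / (2 * W))
      (β := Kv * B * s ^ 3) (c := c₀ * s ^ 2) hl hW (by positivity) (by positivity)
      (fun x => by
        have := (abs_le.1 (abs_walk_sub_lap_le hl hW hB hs hvC hKv0 hKv x)).2
        rw [← hg, ← hWdef] at this
        linarith)
      (fun x => by
        have e1 := (abs_le.1 (abs_walk_sub_lap_le hl hW hB hs hgC hKg0 hKg x)).2
        rw [← hWdef] at e1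
        have e2 : s ^ 2 / (2 * W) * weightedLap l b g x ≤ s ^ 2 / (2 * W) * G' :=
          mul_le_mul_of_nonneg_left (hG' x) (by positivity)
        have e3 : Kg * B * s ^ 3 ≤ Kg * B * s ^ 2 :=
          mul_le_mul_of_nonneg_left (pow_le_pow_of_le_one hs hs1 (by norm_num)) (by positivity)
        have e4 : c₀ * s ^ 2 = s ^ 2 / (2 * W) * G' + Kg * B * s ^ 2 := by
          rw [hc₀]; ring
        linarith) N x
    have h5 : (N : ℝ) ^ 2 * (s ^ 2 / (2 * W) * (c₀ * s ^ 2)) = (N * s ^ 2) ^ 2 * c₀ / (2 * W) := by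
      ring
    have h6 : (N : ℝ) * (s ^ 2 / (2 * W)) * g x = N * s ^ 2 / (2 * W) * g x := by ring
    rw [h5, h6] at h4
    have h7 : (N : ℝ) * (s ^ 2 * s) * (Kv * B + 2 * K * B)
      = N * (Kv * B * s ^ 3) + N * (2 * K * B * s ^ 3) := by ring
    rw [h7]
    linarith
  have hsmall_steps : ∀ ε : ℝ, 0 < ε → ∀ τ : ℝ, 0 < τ →
      0 ≤ τ / (2 * W) * g x + τ ^ 2 * c₀ / (2 * W) + 2 * (C * ε) := by
    intro ε hε τ hτ
    obtain ⟨K, hK⟩ := hsteps ε hε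
    have hs0 : Filter.Tendsto (fun N : ℕ => √(τ / N)) Filter.atTop (nhds 0) := by
      have := (tendsto_const_div_atTop_nhds_zero_nat τ).sqrt
      simpa using this
    have hlim : Filter.Tendsto (fun N : ℕ => τ / (2 * W) * g x + τ * √(τ / N) * K
        + τ ^ 2 * c₀ / (2 * W) + 2 * (C * ε)) Filter.atTop
        (nhds (τ / (2 * W) * g x + τ * 0 * K + τ ^ 2 * c₀ / (2 * W) + 2 * (C * ε))) :=
      ((((hs0.const_mul τ).mul_const K).const_add _).add_const _).add_const _
    have hev : ∀ᶠ N : ℕ in Filter.atTop, 0 ≤ τ / (2 * W) * g x + τ * √(τ / N) * K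
        + τ ^ 2 * c₀ / (2 * W) + 2 * (C * ε) := by
      filter_upwards [hs0.eventually (eventually_le_nhds zero_lt_one),
        Filter.eventually_gt_atTop 0] with N hN hN0
      have hN0' : (0 : ℝ) < N := by exact_mod_cast hN0
      have h := hK √(τ / N) (Real.sqrt_nonneg _) hN N
      have h2 : (N : ℝ) * √(τ / N) ^ 2 = τ := by
        rw [Real.sq_sqrt (by positivity)]; field_simp
      rw [← mul_assoc (N : ℝ), h2] at h
      exact h
    have := ge_of_tendsto hlim hev
    simpa using this
  have hexact : ∀ τ : ℝ, 0 < τ → 0 ≤ g x + τ * c₀ := by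
    intro τ hτ
    have hlim : Filter.Tendsto (fun ε : ℝ => τ / (2 * W) * g x + τ ^ 2 * c₀ / (2 * W) + 2 * (C * ε))
        (nhdsWithin 0 (Set.Ioi 0))
        (nhds (τ / (2 * W) * g x + τ ^ 2 * c₀ / (2 * W) + 2 * (C * 0))) :=
      (Continuous.tendsto (by fun_prop) 0).mono_left nhdsWithin_le_nhds
    have := ge_of_tendsto hlim (Filter.eventually_of_mem self_mem_nhdsWithin
      fun ε hε => hsmall_steps ε hε τ hτ)
    have e : τ / (2 * W) * g x + τ ^ 2 * c₀ / (2 * W) + 2 * (C * 0)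
        = τ / (2 * W) * (g x + τ * c₀) := by ring
    rw [e] at this
    exact nonneg_of_mul_nonneg_right this (by positivity)
  have hlim : Filter.Tendsto (fun τ : ℝ => g x + τ * c₀) (nhdsWithin 0 (Set.Ioi 0))
      (nhds (g x + 0 * c₀)) :=
    (Continuous.tendsto (by fun_prop) 0).mono_left nhdsWithin_le_nhds
  have := ge_of_tendsto hlim (Filter.eventually_of_mem self_mem_nhdsWithin fun τ hτ => hexact τ hτ)
  simpa using this

end Viscosity

/-! ### Radial averages of subharmonic functions -/

section Radial

variable {E : Type*} [NormedAddCommGroup E] [NormedSpace ℝ E] [FiniteDimensional ℝ E]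
  [MeasurableSpace E] [BorelSpace E] {μ : Measure E} [μ.IsAddHaarMeasure]
  {ι : Type*} [Fintype ι] (b : Module.Basis ι ℝ E)

/-- The square of the Euclidean norm for which the basis `b` is orthonormal. -/
noncomputable def coordSq (y : E) : ℝ := ∑ k, (b.repr y k) ^ 2

/-- The radial bump function `g(|y|²)`, where `g(t) = (1 - t)⁻² exp(-1/(1 - t))` for `t < 1`. -/
noncomputable def radialBump (y : E) : ℝ :=
  ((1 - coordSq b y)⁻¹) ^ 2 * expNegInvGlue (1 - coordSq b y)

/-- Half of the primitive `∫_t^∞ g` of the profile of `radialBump`, at `t = |y|²`. -/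
noncomputable def radialPotential (y : E) : ℝ := 2⁻¹ * expNegInvGlue (1 - coordSq b y)

theorem hasDerivAt_expNegInvGlue (x : ℝ) :
    HasDerivAt expNegInvGlue ((x⁻¹) ^ 2 * expNegInvGlue x) x := by
  have := expNegInvGlue.hasDerivAt_polynomial_eval_inv_mul 1 x
  simpa using this

theorem contDiff_coordSq {k : WithTop ℕ∞} : ContDiff ℝ k (coordSq b) := by
  refine ContDiff.sum fun i _ => ContDiff.pow ?_ 2
  have : (fun y => b.repr y i) = fun y => LinearMap.toContinuousLinearMap (b.coord i) y := by
    ext y; simp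
  rw [this]
  exact ContinuousLinearMap.contDiff _

theorem norm_le_of_coordSq_le_one {y : E} (h : coordSq b y ≤ 1) : ‖y‖ ≤ ∑ k, ‖b k‖ := by
  conv_lhs => rw [← b.sum_repr y]
  refine (norm_sum_le _ _).trans (Finset.sum_le_sum fun k _ => ?_)
  rw [norm_smul]
  have h1 : (b.repr y k) ^ 2 ≤ 1 :=
    (Finset.single_le_sum (f := fun k => (b.repr y k) ^ 2) (fun _ _ => sq_nonneg _)
      (Finset.mem_univ k)).trans h
  have h2 : ‖b.repr y k‖ ≤ 1 := by
    rw [Real.norm_eq_abs]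
    exact (sq_le_one_iff_abs_le_one _).1 h1
  exact mul_le_of_le_one_left (norm_nonneg _) h2

theorem radialBump_contDiff : ContDiff ℝ (⊤ : ℕ∞) (radialBump b) := by
  have := expNegInvGlue.contDiff_polynomial_eval_inv_mul (n := (⊤ : ℕ∞))
    (Polynomial.X ^ 2)
  have h2 := this.comp (contDiff_const (c := (1 : ℝ)).sub (contDiff_coordSq b))
  have h3 : radialBump b = (fun x => Polynomial.eval x⁻¹ (Polynomial.X ^ 2) * expNegInvGlue x) ∘
      fun x => 1 - coordSq b x := by
    ext y
    simp [radialBump]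
  rw [h3]
  exact h2

theorem radialPotential_contDiff : ContDiff ℝ (⊤ : ℕ∞) (radialPotential b) :=
  contDiff_const.mul (expNegInvGlue.contDiff.comp (contDiff_const.sub (contDiff_coordSq b)))

theorem radialBump_nonneg (y : E) : 0 ≤ radialBump b y :=
  mul_nonneg (sq_nonneg _) (expNegInvGlue.nonneg _)

theorem radialBump_pos {y : E} (h : coordSq b y < 1) : 0 < radialBump b y := by
  have h1 : 0 < 1 - coordSq b y := by linarith
  exact mul_pos (pow_pos (inv_pos.2 h1) 2) (expNegInvGlue.pos_of_pos h1)

theorem expNegInvGlue_coordSq_eq_zero {y : E} (h : ¬ coordSq b y ≤ 1) :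
    expNegInvGlue (1 - coordSq b y) = 0 := expNegInvGlue.zero_of_nonpos (by linarith)

theorem hasCompactSupport_of_coordSq {κ : E → ℝ} (h : ∀ y, ¬ coordSq b y ≤ 1 → κ y = 0) :
    HasCompactSupport κ := by
  have : ProperSpace E := FiniteDimensional.proper ℝ E
  refine HasCompactSupport.intro (isCompact_closedBall (0 : E) (∑ k, ‖b k‖)) fun y hy => ?_
  refine h y fun h1 => hy ?_
  rw [mem_closedBall_zero_iff]
  exact norm_le_of_coordSq_le_one b h1

theorem radialBump_hasCompactSupport : HasCompactSupport (radialBump b) :=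
  hasCompactSupport_of_coordSq b fun y hy => by
    rw [radialBump, expNegInvGlue_coordSq_eq_zero b hy, mul_zero]

theorem radialPotential_hasCompactSupport : HasCompactSupport (radialPotential b) :=
  hasCompactSupport_of_coordSq b fun y hy => by
    rw [radialPotential, expNegInvGlue_coordSq_eq_zero b hy, mul_zero]

theorem dirDeriv_radialPotential (k : ι) (y : E) :
    dirDeriv (b k) (radialPotential b) y = - (b.repr y k * radialBump b y) := by
  have e1 := hasDerivAt_line ((radialPotential_contDiff b).differentiable (by simp)) y (b k) 0
  have hQ : ∀ t : ℝ, coordSq b (y + t • b k) = coordSq b y + (2 * t * b.repr y k + t ^ 2) := by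
    classical
    intro t
    unfold coordSq
    have : ∀ j, (b.repr (y + t • b k) j) ^ 2 = (b.repr y j) ^ 2
        + if k = j then 2 * t * b.repr y k + t ^ 2 else 0 := by
      intro j
      simp only [map_add, map_smul, Module.Basis.repr_self, Finsupp.add_apply, Finsupp.smul_apply,
        Finsupp.single_apply, smul_eq_mul]
      split_ifs with h
      · subst h; ring
      · ring
    simp only [this, Finset.sum_add_distrib, Finset.sum_ite_eq, Finset.mem_univ, if_true]
  have e2 : HasDerivAt (fun t : ℝ => radialPotential b (y + t • b k))
      (- (b.repr y k * radialBump b y)) 0 := by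
    unfold radialPotential
    simp only [hQ]
    have h1 : HasDerivAt (fun t : ℝ => 1 - (coordSq b y + (2 * t * b.repr y k + t ^ 2)))
        (-(2 * b.repr y k)) 0 := by
      have := (((((hasDerivAt_id (0:ℝ)).const_mul 2).mul_const (b.repr y k)).add
        ((hasDerivAt_id (0:ℝ)).pow 2)).const_add (coordSq b y)).const_sub 1
      exact this.congr_deriv (by simp)
    have h0 : 1 - (coordSq b y + (2 * 0 * b.repr y k + 0 ^ 2)) = 1 - coordSq b y := by ring
    have h2 := hasDerivAt_expNegInvGlue (1 - (coordSq b y + (2 * 0 * b.repr y k + 0 ^ 2)))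
    have h3 := (h2.comp (0 : ℝ) h1).const_mul (2⁻¹ : ℝ)
    refine h3.congr_deriv ?_
    rw [h0, radialBump]
    ring
  have := e1.unique e2
  simpa using this

/-- The sub-mean value inequality for smooth functions and the radial bump: the derivative of
`r ↦ ∫ η(y) v(x - r y) dy` is `r` times the integral of the Laplacian against the potential, because
`y ↦ y η(y)` is minus the gradient of the potential. -/
theorem submean_smooth {v : E → ℝ} (hv : ContDiff ℝ 2 v) {C : ℝ≥0} (hL : LipschitzWith C v)
    (hlap : ∀ x, 0 ≤ weightedLap (fun _ => 1) b v x) (x : E) {r : ℝ} (hr : 0 ≤ r) :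
    (∫ y, radialBump b y ∂μ) * v x ≤ ∫ y, radialBump b y * v (x - r • y) ∂μ := by
  set η := radialBump b with hη
  have hηc : Continuous η := (radialBump_contDiff b).continuous
  have hηs : HasCompactSupport η := radialBump_hasCompactSupport b
  have hvc : Continuous v := hv.continuous
  have hfv : Continuous (fderiv ℝ v) := hv.continuous_fderiv (by norm_num)
  have hbound : Integrable (fun y => C * (η y * ‖y‖)) μ :=
    ((hηc.mul continuous_norm).integrable_of_hasCompactSupport hηs.mul_right).const_mul _
  have hderiv : ∀ r : ℝ, HasDerivAt (fun r : ℝ => ∫ y, η y * v (x - r • y) ∂μ)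
      (∫ y, η y * (- dirDeriv y v (x - r • y)) ∂μ) r := by
    intro r
    refine (hasDerivAt_integral_of_dominated_loc_of_deriv_le
      (F := fun (r : ℝ) y => η y * v (x - r • y))
      (F' := fun (r : ℝ) y => η y * (- dirDeriv y v (x - r • y)))
      (bound := fun y => C * (η y * ‖y‖)) Filter.univ_mem
      (Filter.Eventually.of_forall fun r => ?_) ?_ ?_ ?_ hbound ?_).2
    · exact (hηc.mul (hvc.comp (by fun_prop))).aestronglyMeasurable
    · exact (hηc.mul (hvc.comp (by fun_prop))).integrable_of_hasCompactSupport hηs.mul_right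
    · refine (hηc.mul (Continuous.neg ?_)).aestronglyMeasurable
      exact (hfv.comp (by fun_prop : Continuous fun y : E => x - r • y)).clm_apply continuous_id
    · refine Filter.Eventually.of_forall fun y s _ => ?_
      rw [norm_mul, norm_neg, Real.norm_of_nonneg (radialBump_nonneg b y)]
      have h1 : ‖dirDeriv y v (x - s • y)‖ ≤ C * ‖y‖ :=
        ((fderiv ℝ v _).le_opNorm y).trans
          (mul_le_mul_of_nonneg_right (norm_fderiv_le_of_lipschitz ℝ hL) (norm_nonneg _))
      calc η y * ‖dirDeriv y v (x - s • y)‖ ≤ η y * (C * ‖y‖) :=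
            mul_le_mul_of_nonneg_left h1 (radialBump_nonneg b y)
        _ = _ := by ring
    · refine Filter.Eventually.of_forall fun y s _ => ?_
      have h1 := hasDerivAt_line (hv.differentiable (by norm_num)) x (-y) s
      have h2 : dirDeriv (-y) v (x + s • -y) = - dirDeriv y v (x - s • y) := by
        simp [dirDeriv, sub_eq_add_neg]
      rw [h2] at h1
      have h3 := h1.const_mul (η y)
      simpa [sub_eq_add_neg] using h3
  have hnonneg : ∀ r : ℝ, 0 ≤ r → 0 ≤ ∫ y, η y * (- dirDeriv y v (x - r • y)) ∂μ := by
    intro r hr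
    have hd1 : ∀ k, ContDiff ℝ 1 (dirDeriv (b k) v) := fun k => hv.dirDeriv (by norm_num) _
    let F : ι → E → ℝ := fun k z => dirDeriv (b k) v (x + r • z)
    have haff : ContDiff ℝ 1 fun z : E => x + r • z := by fun_prop
    have hF : ∀ k, ContDiff ℝ 1 (F k) := fun k => (hd1 k).comp haff
    have hFd : ∀ k z, dirDeriv (b k) (F k) z = r * hess v (x + r • z) (b k) := by
      intro k z
      have h1 := hasDerivAt_line ((hF k).differentiable (by norm_num)) z (b k) 0
      have h2 := hasDerivAt_line ((hd1 k).differentiable (by norm_num)) (x + r • z) (r • b k) 0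
      have h3 : (fun s : ℝ => dirDeriv (b k) v (x + r • z + s • r • b k))
          = fun s : ℝ => F k (z + s • b k) := by
        ext1 s
        simp only [F, smul_add, smul_comm s r, add_assoc]
      rw [h3] at h2
      have h4 := h1.unique h2
      rw [zero_smul, zero_smul, add_zero, add_zero] at h4
      rw [h4, hess_eq_dirDeriv hv]
      simp [dirDeriv]
    have hP := radialPotential_contDiff b
    have hP1 : ContDiff ℝ 1 (radialPotential b) := hP.of_le (by
      exact WithTop.coe_le_coe.2 (le_top : (1 : ℕ∞) ≤ ⊤))
    have hPs := radialPotential_hasCompactSupport b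
    have hterm : ∀ y, η y * (- dirDeriv y v (x - r • y))
        = ∑ k, dirDeriv (b k) (radialPotential b) y * F k (0 - y) := by
      intro y
      simp only [dirDeriv_radialPotential, F, zero_sub, smul_neg, ← sub_eq_add_neg]
      have : dirDeriv y v (x - r • y) = ∑ k, b.repr y k * dirDeriv (b k) v (x - r • y) := by
        unfold dirDeriv
        conv_lhs => rw [← b.sum_repr y]
        rw [map_sum]
        simp only [b.sum_repr, map_smul, smul_eq_mul]
      rw [this, mul_neg, Finset.mul_sum, ← Finset.sum_neg_distrib]
      exact Finset.sum_congr rfl fun k _ => by ring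
    have hdP : ∀ k, Continuous (dirDeriv (b k) (radialPotential b)) := fun k =>
      (hP1.dirDeriv (k := 0) (by norm_num) _).continuous
    have hsum : ∫ y, η y * (- dirDeriv y v (x - r • y)) ∂μ
        = ∑ k, mollify μ (radialPotential b) (dirDeriv (b k) (F k)) 0 := by
      simp only [hterm]
      rw [integral_finsetSum _ fun k _ =>
        mollify_integrable (hdP k) (hPs.dirDeriv _) (hF k).continuous 0]
      refine Finset.sum_congr rfl fun k _ => ?_
      rw [← mollify_dirDeriv hP1 hPs (hF k)]
      rfl
    rw [hsum]
    unfold mollify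
    have hhc : ∀ k, Continuous (dirDeriv (b k) (F k)) := fun k =>
      ((hF k).dirDeriv (k := 0) (by norm_num) _).continuous
    rw [← integral_finsetSum _ fun k _ => mollify_integrable hP1.continuous hPs (hhc k) 0]
    refine integral_nonneg fun y => ?_
    simp only [Pi.zero_apply]
    rw [← Finset.mul_sum]
    refine mul_nonneg (mul_nonneg (by norm_num) (expNegInvGlue.nonneg _)) ?_
    simp only [hFd, ← Finset.mul_sum]
    have := hlap (x + r • (0 - y))
    simp only [weightedLap, one_mul] at this
    exact mul_nonneg hr this
  have hmono : MonotoneOn (fun r : ℝ => ∫ y, η y * v (x - r • y) ∂μ) (Set.Ici 0) := by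
    refine monotoneOn_of_deriv_nonneg (convex_Ici 0)
      (fun r _ => (hderiv r).continuousAt.continuousWithinAt)
      (fun r _ => (hderiv r).differentiableAt.differentiableWithinAt) fun r hr => ?_
    rw [(hderiv r).deriv]
    rw [interior_Ici] at hr
    exact hnonneg r (le_of_lt hr)
  have := hmono (Set.mem_Ici.2 le_rfl) (Set.mem_Ici.2 hr) hr
  simpa [integral_mul_const] using this

end Radial

section Averages

variable {E : Type*} [NormedAddCommGroup E] [NormedSpace ℝ E] [FiniteDimensional ℝ E]
  [MeasurableSpace E] [BorelSpace E] (μ : Measure E) [μ.IsAddHaarMeasure]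
  {ι : Type*} [Fintype ι] (b : Module.Basis ι ℝ E)

/-- The radial bump at scale `r`, normalised to have integral one. -/
noncomputable def radialKernel (r : ℝ) (y : E) : ℝ :=
  (∫ y, radialBump b y ∂μ)⁻¹ * ((r ^ Module.finrank ℝ E)⁻¹ * radialBump b (r⁻¹ • y))

theorem integral_radialBump_pos : 0 < ∫ y, radialBump b y ∂μ := by
  refine Continuous.integral_pos_of_hasCompactSupport_nonneg_nonzero (x := 0)
    (radialBump_contDiff b).continuous (radialBump_hasCompactSupport b) (radialBump_nonneg b) ?_
  refine (radialBump_pos b ?_).ne'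
  simp [coordSq]

variable {r : ℝ}

theorem mollify_radialKernel (hr : 0 < r) (u : E → ℝ) (x : E) :
    mollify μ (radialKernel μ b r) u x
      = (∫ y, radialBump b y ∂μ)⁻¹ * ∫ y, radialBump b y * u (x - r • y) ∂μ := by
  have h := Measure.integral_comp_inv_smul μ (fun y => radialBump b y * u (x - r • y)) r
  rw [abs_of_pos (pow_pos hr _), smul_eq_mul] at h
  have hpos : 0 < r ^ Module.finrank ℝ E := pow_pos hr _
  have h2 : ∫ y, radialBump b y * u (x - r • y) ∂μ
      = (r ^ Module.finrank ℝ E)⁻¹ * ∫ y, radialBump b (r⁻¹ • y) * u (x - r • r⁻¹ • y) ∂μ := by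
    rw [h, inv_mul_cancel_left₀ hpos.ne']
  rw [h2, mollify, ← integral_const_mul, ← integral_const_mul]
  simp only [radialKernel, smul_inv_smul₀ hr.ne', mul_assoc]

theorem isMollifier_radialKernel (hr : 0 < r) : IsMollifier μ (radialKernel μ b r) where
  contDiff := contDiff_const.mul (contDiff_const.mul
    ((radialBump_contDiff b).comp (contDiff_const.smul contDiff_id)))
  compact := by
    have h := (radialBump_hasCompactSupport b).comp_smul (inv_ne_zero hr.ne')
    exact (h.mul_left (f := fun _ => (r ^ Module.finrank ℝ E)⁻¹)).mul_left
      (f := fun _ => (∫ y, radialBump b y ∂μ)⁻¹)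
  nonneg := fun y => mul_nonneg (inv_nonneg.2 (integral_radialBump_pos μ b).le)
    (mul_nonneg (inv_nonneg.2 (pow_pos hr _).le) (radialBump_nonneg b _))
  integral := by
    have h := mollify_radialKernel μ b hr (fun _ => 1) 0
    simp only [mollify, mul_one] at h
    rw [h, inv_mul_cancel₀ (integral_radialBump_pos μ b).ne']

theorem radialKernel_pos (hr : 0 < r) {y : E} (hy : coordSq b y < r ^ 2) :
    0 < radialKernel μ b r y := by
  refine mul_pos (inv_pos.2 (integral_radialBump_pos μ b)) (mul_pos (inv_pos.2 (pow_pos hr _))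
    (radialBump_pos b ?_))
  have : coordSq b (r⁻¹ • y) = (r ^ 2)⁻¹ * coordSq b y := by
    simp only [coordSq, map_smul, Finsupp.smul_apply, smul_eq_mul, mul_pow, inv_pow,
      ← Finset.mul_sum]
  rw [this, inv_mul_lt_iff₀ (by positivity)]
  simpa using hy

theorem eventually_radialKernel_pos (R : ℝ) :
    ∀ᶠ r in Filter.atTop, ∀ y : E, ‖y‖ ≤ R → 0 < radialKernel μ b r y := by
  have : ProperSpace E := FiniteDimensional.proper ℝ E
  obtain ⟨M, hM⟩ := (isCompact_closedBall (0 : E) R).bddAbove_image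
    (contDiff_coordSq b (k := 0)).continuous.continuousOn
  filter_upwards [Filter.eventually_gt_atTop (max M 1)] with r hr y hy
  have h1 : 1 < r := lt_of_le_of_lt (le_max_right _ _) hr
  have h2 : M < r := lt_of_le_of_lt (le_max_left _ _) hr
  refine radialKernel_pos μ b (by linarith) ?_
  have : coordSq b y ≤ M := hM ⟨y, mem_closedBall_zero_iff.2 hy, rfl⟩
  nlinarith

variable {u : E → ℝ}

/-- The sub-mean value inequality for bounded Lipschitz functions that are subharmonic after
mollification. -/
theorem le_mollify_radialKernel {C : ℝ≥0} (hu : LipschitzWith C u)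
    (hsub : ∀ κ, IsMollifier μ κ → ∀ x, 0 ≤ weightedLap (fun _ => 1) b (mollify μ κ u) x)
    (hr : 0 < r) (x : E) : u x ≤ mollify μ (radialKernel μ b r) u x := by
  have hη := isMollifier_radialKernel μ b hr
  have key : ∀ ε : ℝ, 0 < ε → u x ≤ mollify μ (radialKernel μ b r) u x + 2 * (C * ε) := by
    intro ε hε
    obtain ⟨κ, hκ, hκε⟩ := exists_isMollifier (E := E) μ hε
    have h1 := submean_smooth (μ := μ) b (hκ.contDiff_mollify hu.continuous 2)
      (hκ.lipschitz_mollify hu) (hsub κ hκ) x hr.le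
    have h2 := mollify_radialKernel μ b hr (mollify μ κ u) x
    have h3 : mollify μ κ u x ≤ mollify μ (radialKernel μ b r) (mollify μ κ u) x := by
      rw [h2, le_inv_mul_iff₀ (integral_radialBump_pos μ b)]
      exact h1
    have hb := hκ.abs_mollify_sub_le hκε hu
    have h4 := hη.mollify_mono (x := x) (v := u)
      ((hκ.lipschitz_mollify hu).continuous.sub (continuous_const (y := C * ε))) hu.continuous
      (fun y _ => by
        have := (abs_le.1 (hb (x - y))).2
        simp only [Pi.sub_apply]
        linarith)
    have h5 := hη.mollify_sub_const (hκ.lipschitz_mollify hu).continuous (C * ε) x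
    have h6 := (abs_le.1 (hb x)).1
    change mollify μ (radialKernel μ b r) (fun z => mollify μ κ u z - C * ε) x ≤ _ at h4
    linarith
  have hlim : Filter.Tendsto (fun ε : ℝ => mollify μ (radialKernel μ b r) u x + 2 * (C * ε))
      (nhdsWithin 0 (Set.Ioi 0)) (nhds (mollify μ (radialKernel μ b r) u x + 2 * (C * 0))) :=
    (Continuous.tendsto (by fun_prop) 0).mono_left nhdsWithin_le_nhds
  have := ge_of_tendsto hlim (Filter.eventually_of_mem self_mem_nhdsWithin fun ε hε => key ε hε)
  simpa using this

/-- Averages of a bounded function over large balls become independent of the centre: after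
rescaling to unit size the two centres are at distance `O(1 / r)`. -/
theorem eventually_abs_mollify_radialKernel_sub_le (hu : Continuous u) {C : ℝ}
    (hC : ∀ x, |u x| ≤ C) (x z : E) {δ : ℝ} (hδ : 0 < δ) :
    ∀ᶠ r in Filter.atTop,
      |mollify μ (radialKernel μ b r) u x - mollify μ (radialKernel μ b r) u z| ≤ δ := by
  have hηc := radialBump_contDiff b
  have hη1 : ContDiff ℝ 1 (radialBump b) := hηc.of_le
    (WithTop.coe_le_coe.2 (le_top : (1 : ℕ∞) ≤ ⊤))
  have hηs := radialBump_hasCompactSupport b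
  set c := ∫ y, radialBump b y ∂μ
  have hc : 0 < c := integral_radialBump_pos μ b
  set A := (∫ y, |dirDeriv (x - z) (radialBump b) y| ∂μ) * C with hA
  have key : ∀ r : ℝ, 0 < r →
      |mollify μ (radialKernel μ b r) u x - mollify μ (radialKernel μ b r) u z| ≤ c⁻¹ * A * r⁻¹ := by
    intro r hr
    let w : E → ℝ := fun y => u (r • y)
    have hw : Continuous w := hu.comp (continuous_const_smul r)
    let Φ := mollify μ (radialBump b) w
    have hΦ : ∀ x, mollify μ (radialKernel μ b r) u x = c⁻¹ * Φ (r⁻¹ • x) := by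
      intro x
      rw [mollify_radialKernel μ b hr]
      simp only [Φ, w, mollify, smul_sub, smul_inv_smul₀ hr.ne', c]
    have hΦd : Differentiable ℝ Φ :=
      (contDiff_mollify (k := 1) (mod_cast hη1) hηs hw).differentiable (by norm_num)
    have hbd : ∀ y, ‖dirDeriv (x - z) Φ y‖ ≤ A := by
      intro y
      rw [dirDeriv_mollify hη1 hηs hw]
      exact abs_mollify_le (hη1.dirDeriv (k := 0) (by norm_num) _).continuous (hηs.dirDeriv _)
        (fun x => hC _) y
    have := (convex_univ (𝕜 := ℝ) (E := ℝ)).norm_image_sub_le_of_norm_hasDerivWithin_le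
      (x := 0) (y := r⁻¹)
      (fun t _ => (hasDerivAt_line hΦd (r⁻¹ • z) (x - z) t).hasDerivWithinAt) (fun t _ => hbd _)
      (Set.mem_univ _) (Set.mem_univ _)
    rw [zero_smul, add_zero, sub_zero, ← smul_add, add_sub_cancel,
      Real.norm_of_nonneg (inv_pos.2 hr).le, Real.norm_eq_abs] at this
    rw [hΦ, hΦ, ← mul_sub, abs_mul, abs_of_pos (inv_pos.2 hc), mul_assoc]
    exact mul_le_mul_of_nonneg_left this (inv_pos.2 hc).le
  have hlim : Filter.Tendsto (fun r : ℝ => c⁻¹ * A * r⁻¹) Filter.atTop (nhds (c⁻¹ * A * 0)) :=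
    tendsto_inv_atTop_zero.const_mul _
  rw [mul_zero] at hlim
  filter_upwards [hlim.eventually (eventually_le_nhds hδ), Filter.eventually_gt_atTop 0]
    with r h1 h2 using (key r h2).trans h1

/-- Averages of a bounded subharmonic function over large balls approach its supremum. -/
theorem eventually_le_mollify_radialKernel {C : ℝ≥0} (hu : LipschitzWith C u) {C' : ℝ}
    (hC : ∀ x, |u x| ≤ C')
    (hsub : ∀ κ, IsMollifier μ κ → ∀ x, 0 ≤ weightedLap (fun _ => 1) b (mollify μ κ u) x)
    (x z : E) {δ : ℝ} (hδ : 0 < δ) :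
    ∀ᶠ r in Filter.atTop, u x - δ ≤ mollify μ (radialKernel μ b r) u z := by
  filter_upwards [eventually_abs_mollify_radialKernel_sub_le μ b hu.continuous hC x z hδ,
    Filter.eventually_gt_atTop 0] with r h1 h2
  have h3 := le_mollify_radialKernel μ b hu hsub h2 x
  have := (abs_le.1 h1).2
  linarith

end Averages

/-! ### Bounded subharmonic functions of one complex variable -/

section Liouville

/-- Since `log |ζ|²` is harmonic away from the origin, it does not contribute to the Laplacian at a
local maximum of `g - ε log |ζ|²`. -/
theorem levi_le_of_isLocalMax {g : ℂ → ℝ} (hg : ContDiff ℝ 2 g) {ε : ℝ} {ζ : ℂ} (hζ : ζ ≠ 0)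
    (hmax : IsLocalMax (fun w => g w - ε * Real.log (Complex.normSq w)) ζ) : levi g ζ 1 ≤ 0 := by
  -- The second derivative of `log |ζ + t v|²` at `t = 0`, with `p` the real part of `ζ v̄`.
  have hlog : ∀ v : ℂ, Complex.normSq v = 1 → hess g ζ v
      - ε * ((2 * Complex.normSq ζ - (2 * (ζ * starRingEnd ℂ v).re) ^ 2)
        / (Complex.normSq ζ) ^ 2) ≤ 0 := by
    intro v hv
    set p := (ζ * starRingEnd ℂ v).re with hp
    set q := Complex.normSq ζ with hq
    have hq0 : 0 < q := Complex.normSq_pos.2 hζ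
    have hexp : ∀ t : ℝ, Complex.normSq (ζ + t • v) = q + 2 * t * p + t ^ 2 := by
      intro t
      rw [Complex.normSq_add]
      simp only [Complex.real_smul, map_mul, Complex.normSq_ofReal, hv, Complex.conj_ofReal]
      have : ζ * (t * starRingEnd ℂ v) = t * (ζ * starRingEnd ℂ v) := by ring
      rw [this, Complex.re_ofReal_mul, ← hp]
      ring
    have hP : ∀ t : ℝ, HasDerivAt (fun t : ℝ => q + 2 * t * p + t ^ 2) (2 * p + 2 * t) t := by
      intro t
      have := ((((hasDerivAt_id t).const_mul 2).mul_const p).const_add q).add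
        ((hasDerivAt_id t).pow 2)
      exact this.congr_deriv (by simp)
    have hne : ∀ᶠ t : ℝ in nhds 0, q + 2 * t * p + t ^ 2 ≠ 0 := by
      have hcont : ContinuousAt (fun t : ℝ => q + 2 * t * p + t ^ 2) 0 := by fun_prop
      exact hcont.eventually_ne (by simpa using hq0.ne')
    have hd2 : Differentiable ℝ (dirDeriv v g) :=
      (hg.dirDeriv (k := 1) (by norm_num) v).differentiable (by norm_num)
    have h1 : ∀ᶠ t : ℝ in nhds 0, HasDerivAt
        (fun t : ℝ => g (ζ + t • v) - ε * Real.log (Complex.normSq (ζ + t • v)))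
        (dirDeriv v g (ζ + t • v) - ε * ((2 * p + 2 * t) / (q + 2 * t * p + t ^ 2))) t := by
      filter_upwards [hne] with t ht
      simp only [hexp]
      exact (hasDerivAt_line (hg.differentiable (by norm_num)) ζ v t).sub
        (((hP t).log ht).const_mul ε)
    have h2 := (hasDerivAt_line hd2 ζ v 0).sub
      (((((hasDerivAt_id (0:ℝ)).const_mul 2).const_add (2 * p)).div (hP 0)
        (by simpa using hq0.ne')).const_mul ε)
    have hmax' : IsLocalMax
        (fun t : ℝ => g (ζ + t • v) - ε * Real.log (Complex.normSq (ζ + t • v))) 0 := by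
      have hcont : ContinuousAt (fun t : ℝ => ζ + t • v) 0 := by fun_prop
      have h0 : ζ + (0 : ℝ) • v = ζ := by simp
      have hm : IsLocalMax (fun w => g w - ε * Real.log (Complex.normSq w)) (ζ + (0 : ℝ) • v) := by
        rw [h0]; exact hmax
      exact IsMaxFilter.comp_tendsto (g := fun t : ℝ => ζ + t • v) hm hcont
    have := second_deriv_nonpos_of_isLocalMax h1 h2 hmax'
    refine le_trans (le_of_eq ?_) this
    rw [hess_eq_dirDeriv hg]
    simp
    left
    ring
  have a1 := hlog 1 (by simp)
  have a2 := hlog Complex.I (by simp)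
  have e1 : (ζ * starRingEnd ℂ 1).re = ζ.re := by simp
  have e2 : (ζ * starRingEnd ℂ Complex.I).re = ζ.im := by simp
  rw [e1] at a1
  rw [e2] at a2
  have e3 : ε * ((2 * Complex.normSq ζ - (2 * ζ.re) ^ 2) / (Complex.normSq ζ) ^ 2)
      + ε * ((2 * Complex.normSq ζ - (2 * ζ.im) ^ 2) / (Complex.normSq ζ) ^ 2) = 0 := by
    rw [← mul_add, ← add_div]
    have : 2 * Complex.normSq ζ - (2 * ζ.re) ^ 2 + (2 * Complex.normSq ζ - (2 * ζ.im) ^ 2) = 0 := by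
      rw [Complex.normSq_apply]; ring
    rw [this]; simp
  have e4 : levi g ζ 1 = hess g ζ 1 + hess g ζ Complex.I := by simp [levi]
  linarith

/-- Bounded subharmonic functions on `ℂ` are constant: comparison with `log |ζ|²` on annuli shows
that no value exceeds the value at the origin. -/
theorem eq_of_levi_nonneg {g : ℂ → ℝ} (hg : ContDiff ℝ 2 g) {C : ℝ} (hC : ∀ ζ, |g ζ| ≤ C)
    (hlevi : ∀ ζ, 0 ≤ levi g ζ 1) (ζ : ℂ) : g ζ = g 0 := by
  have main : ∀ g : ℂ → ℝ, ContDiff ℝ 2 g → (∀ ζ, |g ζ| ≤ C) → (∀ ζ, 0 ≤ levi g ζ 1) →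
      ∀ ζ, g ζ ≤ g 0 := by
    intro g hg hC hlevi ζ₀
    by_cases hζ₀ : ζ₀ = 0
    · rw [hζ₀]
    refine le_of_forall_pos_le_add fun τ hτ => ?_
    obtain ⟨a₁, ha₁, hga⟩ := Metric.continuousAt_iff.1 (hg.continuous.continuousAt (x := 0)) τ hτ
    have hn0 : 0 < ‖ζ₀‖ := norm_pos_iff.2 hζ₀
    set a := min (a₁ / 2) (‖ζ₀‖ / 2) with ha
    have ha0 : 0 < a := lt_min (by positivity) (by positivity)
    have hga' : ∀ ζ : ℂ, ‖ζ‖ ≤ a → g ζ ≤ g 0 + τ := by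
      intro ζ hζ
      have h1 : dist ζ 0 < a₁ := by
        rw [dist_zero_right]
        have := min_le_left (a₁ / 2) (‖ζ₀‖ / 2)
        linarith
      have := (abs_lt.1 (Real.dist_eq _ _ ▸ hga h1)).2
      linarith
    -- The barrier `ε log (|ζ|² / a²)` vanishes on the inner circle and is large on the outer one,
    -- of radius `R`.
    have hbar : ∀ ε : ℝ, 0 < ε →
        g ζ₀ ≤ g 0 + τ + ε * (Real.log (Complex.normSq ζ₀) - Real.log (a ^ 2)) := by
      intro ε hε
      have hlim : Filter.Tendsto (fun R : ℝ => ε * (Real.log (R ^ 2) - Real.log (a ^ 2)))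
          Filter.atTop Filter.atTop := by
        refine Filter.Tendsto.const_mul_atTop hε (Filter.tendsto_atTop_add_const_right _ _ ?_)
        exact Real.tendsto_log_atTop.comp (Filter.tendsto_pow_atTop (by norm_num))
      obtain ⟨R, hR1, hR2⟩ := ((hlim.eventually_ge_atTop (2 * C)).and
        (Filter.eventually_gt_atTop ‖ζ₀‖)).exists
      have haR : a < R := by
        have := min_le_right (a₁ / 2) (‖ζ₀‖ / 2)
        linarith
      -- The term `δ |ζ|²` makes `g` strictly subharmonic, which excludes interior maxima.
      have hδ : ∀ δ : ℝ, 0 < δ →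
          g ζ₀ ≤ g 0 + τ + ε * (Real.log (Complex.normSq ζ₀) - Real.log (a ^ 2)) + δ * R ^ 2 := by
        intro δ hδ
        let g₁ : ℂ → ℝ := fun w => g w + δ * ‖w - 0‖ ^ 2
        have hq : ContDiff ℝ 2 fun w : ℂ => ‖w - 0‖ ^ 2 :=
          (contDiff_norm_sq ℂ).comp (contDiff_id.sub contDiff_const)
        have hg₁ : ContDiff ℝ 2 g₁ := hg.add (contDiff_const.mul hq)
        let F : ℂ → ℝ := fun w => g₁ w - ε * Real.log (Complex.normSq w)
        let S : Set ℂ := Metric.closedBall 0 R ∩ {w | a ≤ ‖w‖}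
        have hScomp : IsCompact S := (isCompact_closedBall 0 R).inter_right
          (isClosed_le continuous_const continuous_norm)
        have hS0 : ζ₀ ∈ S := by
          refine ⟨mem_closedBall_zero_iff.2 hR2.le, ?_⟩
          have := min_le_right (a₁ / 2) (‖ζ₀‖ / 2)
          simp only [Set.mem_ofPred_eq]
          linarith
        have hFc : ContinuousOn F S := by
          refine hg₁.continuous.continuousOn.sub (continuousOn_const.mul ?_)
          refine ContinuousOn.log Complex.continuous_normSq.continuousOn fun w hw => ?_
          have : 0 < ‖w‖ := lt_of_lt_of_le ha0 hw.2
          exact (Complex.normSq_pos.2 (norm_pos_iff.1 this)).ne'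
        obtain ⟨ζ₁, hζ₁S, hζ₁⟩ := hScomp.exists_isMaxOn ⟨ζ₀, hS0⟩ hFc
        have hmain : F ζ₀ ≤ F ζ₁ := hζ₁ hS0
        have hnR : ‖ζ₁‖ ≤ R := mem_closedBall_zero_iff.1 hζ₁S.1
        have hδR : δ * ‖ζ₁ - 0‖ ^ 2 ≤ δ * R ^ 2 := by
          rw [sub_zero]
          gcongr
        have hζ₀' : g ζ₀ - ε * Real.log (Complex.normSq ζ₀) ≤ F ζ₀ := by
          have : 0 ≤ δ * ‖ζ₀ - 0‖ ^ 2 := by positivity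
          simp only [F, g₁]
          linarith
        have ha1 : a ≤ ‖ζ₁‖ := hζ₁S.2
        rcases ha1.eq_or_lt with h | h
        · have h1 := hga' ζ₁ h.ge
          have h2 : F ζ₁ ≤ g 0 + τ + δ * R ^ 2 - ε * Real.log (a ^ 2) := by
            simp only [F, g₁]
            rw [Complex.normSq_eq_norm_sq, ← h]
            linarith
          linarith
        rcases hnR.eq_or_lt with h' | h'
        · have h1 := (abs_le.1 (hC ζ₁)).2
          have h3 := (abs_le.1 (hC 0)).1
          have h2 : F ζ₁ ≤ C + δ * R ^ 2 - ε * Real.log (R ^ 2) := by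
            simp only [F, g₁]
            rw [Complex.normSq_eq_norm_sq, h']
            linarith
          linarith
        · exfalso
          have hSn : S ∈ nhds ζ₁ := by
            refine Filter.inter_mem (Filter.mem_of_superset
              (Metric.isOpen_ball.mem_nhds (mem_ball_zero_iff.2 h')) Metric.ball_subset_closedBall) ?_
            exact Filter.mem_of_superset ((isOpen_lt continuous_const continuous_norm).mem_nhds h)
              fun w (hw : a < ‖w‖) => show a ≤ ‖w‖ from hw.le
          have hlm : IsLocalMax F ζ₁ := hζ₁.isLocalMax hSn
          have h1 := levi_le_of_isLocalMax hg₁ (norm_pos_iff.1 (ha0.trans h)) hlm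
          have h2 := hlevi ζ₁
          have h3 : levi g₁ ζ₁ 1 = levi g ζ₁ 1 + 4 * δ := by
            simp only [levi, g₁]
            rw [hess_add hg (contDiff_const.mul hq), hess_add hg (contDiff_const.mul hq),
              hess_const_mul hq, hess_const_mul hq, hess_norm_sq_sub, hess_norm_sq_sub]
            simp
            ring
          linarith
      have hlim : Filter.Tendsto (fun δ : ℝ =>
          g 0 + τ + ε * (Real.log (Complex.normSq ζ₀) - Real.log (a ^ 2)) + δ * R ^ 2)
          (nhdsWithin 0 (Set.Ioi 0))
          (nhds (g 0 + τ + ε * (Real.log (Complex.normSq ζ₀) - Real.log (a ^ 2)) + 0 * R ^ 2)) :=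
        (Continuous.tendsto (by fun_prop) 0).mono_left nhdsWithin_le_nhds
      have := ge_of_tendsto hlim (Filter.eventually_of_mem self_mem_nhdsWithin hδ)
      simpa using this
    have hlim : Filter.Tendsto (fun ε : ℝ =>
        g 0 + τ + ε * (Real.log (Complex.normSq ζ₀) - Real.log (a ^ 2)))
        (nhdsWithin 0 (Set.Ioi 0))
        (nhds (g 0 + τ + 0 * (Real.log (Complex.normSq ζ₀) - Real.log (a ^ 2)))) :=
      (Continuous.tendsto (by fun_prop) 0).mono_left nhdsWithin_le_nhds
    have := ge_of_tendsto hlim (Filter.eventually_of_mem self_mem_nhdsWithin hbar)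
    simpa using this
  -- The opposite inequality is the same statement with the origin moved to `ζ`.
  refine le_antisymm (main g hg hC hlevi ζ) ?_
  have h := main (fun w => g (w + ζ)) (hg.comp (contDiff_id.add contDiff_const))
    (fun w => hC _) (fun w => by
      simp only [levi, hess_comp_add_right]
      exact hlevi _) (-ζ)
  simpa using h

end Liouville

/-! ### Symmetric cones and their duals -/

section Cone

variable {n : ℕ}

/-- The linear forms that are positive on `Γ`, as vectors of coefficients. -/
def dualCone (Γ : ConvexCone ℝ (Fin n → ℝ)) : Set (Fin n → ℝ) :=
  {l | ∀ a ∈ Γ, 0 < ∑ i, l i * a i}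

variable {Γ : ConvexCone ℝ (Fin n → ℝ)}

theorem sum_pos_of_mem_dualCone (horthant : positiveOrthant n ⊆ (Γ : Set (Fin n → ℝ)))
    {l : Fin n → ℝ} (hl : l ∈ dualCone Γ) : 0 < ∑ i, l i := by
  have := hl (fun _ => 1) (horthant fun _ => one_pos)
  simpa using this

theorem nonneg_of_mem_dualCone (horthant : positiveOrthant n ⊆ (Γ : Set (Fin n → ℝ)))
    {l : Fin n → ℝ} (hl : l ∈ dualCone Γ) (i : Fin n) : 0 ≤ l i := by
  have key : ∀ ε : ℝ, 0 < ε → 0 ≤ l i + ε * ∑ j, l j := by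
    intro ε hε
    have h1 : (fun j => (if j = i then 1 else 0) + ε) ∈ Γ := horthant fun j => by
      split_ifs <;> linarith
    have := hl _ h1
    simp only [mul_add, Finset.sum_add_distrib, mul_ite, mul_one, mul_zero, Finset.sum_ite_eq',
      Finset.mem_univ, if_true, ← Finset.sum_mul] at this
    linarith
  have hlim : Filter.Tendsto (fun ε : ℝ => l i + ε * ∑ j, l j) (nhdsWithin 0 (Set.Ioi 0))
      (nhds (l i + 0 * ∑ j, l j)) :=
    (Continuous.tendsto (by fun_prop) 0).mono_left nhdsWithin_le_nhds
  have := ge_of_tendsto hlim (Filter.eventually_of_mem self_mem_nhdsWithin key)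
  simpa using this

/-- An open convex cone that is not empty is the intersection of the open half spaces that contain
it, by the Hahn-Banach theorem. -/
theorem mem_of_dualCone (hopen : IsOpen (Γ : Set (Fin n → ℝ)))
    (horthant : positiveOrthant n ⊆ (Γ : Set (Fin n → ℝ))) {x : Fin n → ℝ}
    (h : ∀ l ∈ dualCone Γ, 0 < ∑ i, l i * x i) : x ∈ Γ := by
  by_contra hx
  obtain ⟨f, hf⟩ := geometric_hahn_banach_open_point Γ.convex hopen (x := x) hx
  have hrep : ∀ y : Fin n → ℝ, f y = ∑ i, f (Pi.single i 1) * y i := by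
    intro y
    conv_lhs => rw [pi_eq_sum_univ' y]
    rw [map_sum]
    refine Finset.sum_congr rfl fun i _ => ?_
    rw [map_smul, smul_eq_mul, mul_comm]
  -- Scaling shows that a linear form bounded above on a cone is nonpositive there.
  have hnonpos : ∀ a ∈ Γ, f a ≤ 0 := by
    intro a ha
    by_contra! hpos
    have h1 := hf _ (Γ.smul_mem (c := (|f x| + 1) / f a) (by positivity) ha)
    rw [map_smul, smul_eq_mul, div_mul_cancel₀ _ hpos.ne'] at h1
    linarith [le_abs_self (f x)]
  have hx0 : 0 ≤ f x := by
    by_contra! hneg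
    have h1 : (fun _ => (1 : ℝ)) ∈ Γ := horthant fun _ => one_pos
    have h2 : 0 < |f fun _ => (1 : ℝ)| + 1 := by positivity
    have h3 := hf _ (Γ.smul_mem (c := -f x / (|f fun _ => (1 : ℝ)| + 1))
      (div_pos (by linarith) h2) h1)
    rw [map_smul, smul_eq_mul, div_mul_eq_mul_div, lt_iff_not_ge] at h3
    refine h3 ?_
    rw [le_div_iff₀ h2]
    have := neg_abs_le (f fun _ => (1 : ℝ))
    nlinarith
  -- Strictness: near a point of the open cone the form takes larger values unless it is zero.
  have hneg : ∀ a ∈ Γ, f a < 0 := by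
    intro a ha
    refine lt_of_le_of_ne (hnonpos a ha) fun h0 => ?_
    have h1 := hf a ha
    have h2 : ∀ᶠ t : ℝ in nhds 0, a + t • x ∈ (Γ : Set (Fin n → ℝ)) := by
      have hc : ContinuousAt (fun t : ℝ => a + t • x) 0 := by fun_prop
      exact hc.eventually (hopen.mem_nhds (by simpa using ha))
    obtain ⟨ε, hε, hball⟩ := Metric.eventually_nhds_iff.1 h2
    have h3 := hnonpos _ (hball (y := ε / 2) (by
      rw [Real.dist_eq, sub_zero, abs_of_pos (by linarith)]; linarith))
    rw [map_add, map_smul, smul_eq_mul, h0] at h3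
    rw [h0] at h1
    nlinarith
  have hmem : (fun i => - f (Pi.single i 1)) ∈ dualCone Γ := by
    intro a ha
    have := hneg a ha
    rw [hrep] at this
    simp only [neg_mul, Finset.sum_neg_distrib]
    linarith
  have := h _ hmem
  simp only [neg_mul, Finset.sum_neg_distrib, ← hrep] at this
  linarith

/-- By Birkhoff's theorem, doubly stochastic matrices are convex combinations of permutation
matrices. -/
theorem mulVec_mem_of_doublyStochastic
    (hsymm : ∀ (σ : Equiv.Perm (Fin n)) (x : Fin n → ℝ), x ∈ Γ → x ∘ σ ∈ Γ)
    {D : Matrix (Fin n) (Fin n) ℝ} (hD : D ∈ doublyStochastic ℝ (Fin n)) {x : Fin n → ℝ}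
    (hx : x ∈ Γ) : D.mulVec x ∈ Γ := by
  have h1 : D ∈ (doublyStochastic ℝ (Fin n) : Set (Matrix (Fin n) (Fin n) ℝ)) := hD
  rw [doublyStochastic_eq_convexHull_permMatrix] at h1
  have hconv : Convex ℝ {M : Matrix (Fin n) (Fin n) ℝ | M.mulVec x ∈ (Γ : Set (Fin n → ℝ))} := by
    refine Γ.convex.is_linear_preimage (f := fun M : Matrix (Fin n) (Fin n) ℝ => M.mulVec x)
      ⟨fun M N => Matrix.add_mulVec M N x, fun c M => Matrix.smul_mulVec c M x⟩
  refine convexHull_min ?_ hconv h1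
  rintro M ⟨σ, rfl⟩
  have := hsymm σ x hx
  simpa [Matrix.permMatrix_mulVec] using this

/-- A proper symmetric cone lies in the half space `∑ a_i > 0`: averaging a vector of the cone over
the permutations of its coordinates gives a constant vector of the cone. -/
theorem one_mem_dualCone (hopen : IsOpen (Γ : Set (Fin n → ℝ)))
    (hsymm : ∀ (σ : Equiv.Perm (Fin n)) (x : Fin n → ℝ), x ∈ Γ → x ∘ σ ∈ Γ)
    (horthant : positiveOrthant n ⊆ (Γ : Set (Fin n → ℝ)))
    (hproper : (Γ : Set (Fin n → ℝ)) ≠ Set.univ) : (fun _ => 1) ∈ dualCone Γ := by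
  have hzero : (0 : Fin n → ℝ) ∉ Γ := by
    intro h0
    refine hproper (Set.eq_univ_of_forall fun x => ?_)
    have h2 : ∀ᶠ t : ℝ in nhds 0, t • x ∈ (Γ : Set (Fin n → ℝ)) := by
      have hc : ContinuousAt (fun t : ℝ => t • x) 0 := by fun_prop
      exact hc.eventually (hopen.mem_nhds (by simpa using h0))
    obtain ⟨ε, hε, hball⟩ := Metric.eventually_nhds_iff.1 h2
    have h3 := hball (y := ε / 2) (by
      rw [Real.dist_eq, sub_zero, abs_of_pos (by linarith)]; linarith)
    have := Γ.smul_mem (c := (ε / 2)⁻¹) (by positivity) h3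
    rwa [inv_smul_smul₀ (by positivity)] at this
  have hn : n ≠ 0 := by
    rintro rfl
    exact hzero (horthant fun i => i.elim0)
  have hn' : (0 : ℝ) < n := by positivity
  intro a ha
  simp only [one_mul]
  by_contra! hle
  have hD : (Matrix.of fun _ _ => (n : ℝ)⁻¹ : Matrix (Fin n) (Fin n) ℝ)
      ∈ doublyStochastic ℝ (Fin n) := by
    rw [mem_doublyStochastic_iff_sum]
    refine ⟨fun i j => by simp, fun i => ?_, fun j => ?_⟩ <;> simp [hn]
  have h1 := mulVec_mem_of_doublyStochastic hsymm hD ha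
  have h2 : (Matrix.of fun _ _ => (n : ℝ)⁻¹ : Matrix (Fin n) (Fin n) ℝ).mulVec a
      = fun _ => (n : ℝ)⁻¹ * ∑ i, a i := by
    ext i
    simp [Matrix.mulVec, dotProduct, Finset.mul_sum]
  rw [h2] at h1
  set s := (n : ℝ)⁻¹ * ∑ i, a i with hs
  have hs0 : s ≤ 0 := mul_nonpos_of_nonneg_of_nonpos (by positivity) hle
  rcases hs0.eq_or_lt with h | h
  · refine hzero ?_
    rw [h] at h1
    exact h1
  · have h3 : (fun _ => -s) ∈ Γ := horthant fun _ => by simpa using h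
    have := Γ.add_mem h1 h3
    refine hzero ?_
    convert this using 1
    ext i
    simp

end Cone

/-! ### The complex Hessian as a quadratic form -/

section Spectral

variable {n : ℕ}

theorem doublyStochastic_inner (e e' : OrthonormalBasis (Fin n) ℂ (EuclideanSpace ℂ (Fin n))) :
    (Matrix.of fun j i => ‖inner ℂ (e i) (e' j)‖ ^ 2 : Matrix (Fin n) (Fin n) ℝ)
      ∈ doublyStochastic ℝ (Fin n) := by
  rw [mem_doublyStochastic_iff_sum]
  refine ⟨fun i j => by simp only [Matrix.of_apply]; positivity, fun j => ?_, fun i => ?_⟩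
  · simp only [Matrix.of_apply]
    rw [e.sum_sq_norm_inner_right]
    simp
  · simp only [Matrix.of_apply]
    rw [e'.sum_sq_norm_inner_left]
    simp

/-- Half of Schur's theorem: a symmetric convex cone that contains the eigenvalues contains the
diagonal in every orthonormal basis. -/
theorem schur_mem {Γ : ConvexCone ℝ (Fin n → ℝ)}
    (hsymm : ∀ (σ : Equiv.Perm (Fin n)) (x : Fin n → ℝ), x ∈ Γ → x ∘ σ ∈ Γ)
    (e e' : OrthonormalBasis (Fin n) ℂ (EuclideanSpace ℂ (Fin n))) {x : Fin n → ℝ} (hx : x ∈ Γ) :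
    (fun j => ∑ i, ‖inner ℂ (e i) (e' j)‖ ^ 2 * x i) ∈ Γ :=
  mulVec_mem_of_doublyStochastic hsymm (doublyStochastic_inner e e') hx

theorem levi_eq_complexHessian (h : EuclideanSpace ℂ (Fin n) → ℝ) (z v : EuclideanSpace ℂ (Fin n)) :
    levi h z v = 4 * (∑ i, ∑ j, complexHessian h z i j * v i * starRingEnd ℂ (v j)).re := by
  have hv : v = ∑ i, ((v i).re • dirX i + (v i).im • dirY i) := by
    ext k
    simp only [PiLp.add_apply, PiLp.smul_apply, WithLp.ofLp_sum, Finset.sum_apply, dirX, dirY,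
      PiLp.single_apply, Finset.sum_add_distrib]
    simp
  have hIv : Complex.I • v = ∑ i, ((v i).re • dirY i + (-(v i).im) • dirX i) := by
    ext k
    simp only [PiLp.add_apply, PiLp.smul_apply, WithLp.ofLp_sum, Finset.sum_apply, dirX, dirY,
      PiLp.single_apply, Finset.sum_add_distrib]
    apply Complex.ext <;> simp
  have hexp : ∀ (a c : Fin n → ℝ) (p q : Fin n → EuclideanSpace ℂ (Fin n)),
      hess h z (∑ i, (a i • p i + c i • q i)) = ∑ i, ∑ j,
        (a i * a j * realHessian h z (p i) (p j) + a i * c j * realHessian h z (p i) (q j)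
          + c i * a j * realHessian h z (q i) (p j) + c i * c j * realHessian h z (q i) (q j)) := by
    intro a c p q
    unfold hess realHessian
    simp only [map_sum, map_add, map_smul, sum_apply, add_apply, smul_apply, smul_eq_mul]
    rw [Finset.sum_comm]
    refine Finset.sum_congr rfl fun i _ => ?_
    rw [Finset.mul_sum, Finset.mul_sum, ← Finset.sum_add_distrib]
    refine Finset.sum_congr rfl fun j _ => ?_
    ring
  have h1 := (congrArg (hess h z) hv).trans (hexp _ _ _ _)
  have h2 := (congrArg (hess h z) hIv).trans (hexp _ _ _ _)
  unfold levi
  rw [h1, h2, ← Finset.sum_add_distrib, Complex.re_sum, Finset.mul_sum]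
  refine Finset.sum_congr rfl fun i _ => ?_
  rw [← Finset.sum_add_distrib, Complex.re_sum, Finset.mul_sum]
  refine Finset.sum_congr rfl fun j _ => ?_
  simp [complexHessian]
  ring

/-- The spectral theorem for the complex Hessian, in terms of the quadratic form `levi h z`. -/
theorem exists_orthonormalBasis_levi {h : EuclideanSpace ℂ (Fin n) → ℝ} (hh : ContDiff ℝ 2 h)
    (z : EuclideanSpace ℂ (Fin n)) :
    ∃ φ : OrthonormalBasis (Fin n) ℂ (EuclideanSpace ℂ (Fin n)), ∀ v,
      levi h z v = 4 * ∑ k, ‖inner ℂ (φ k) v‖ ^ 2 * hessianEigenvalues hh z k := by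
  set hA := complexHessian_isHermitian hh z
  set ψ := hA.eigenvectorBasis with hψ
  -- The Hermitian form is linear in the first slot, so the eigenvectors have to be conjugated.
  let cj : EuclideanSpace ℂ (Fin n) → EuclideanSpace ℂ (Fin n) := fun v =>
    WithLp.toLp 2 fun i => starRingEnd ℂ (v i)
  have hcj : ∀ a b, inner ℂ (cj a) (cj b) = starRingEnd ℂ (inner ℂ a b) := by
    intro a b
    simp [cj, PiLp.inner_apply]
  have hcj2 : ∀ a, cj (cj a) = a := by
    intro a; ext i; simp [cj]
  have hon : Orthonormal ℂ (fun k => cj (ψ k)) := by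
    rw [orthonormal_iff_ite]
    intro i j
    rw [hcj, orthonormal_iff_ite.1 ψ.orthonormal i j]
    split_ifs <;> simp
  obtain ⟨φ, hφ⟩ := Orthonormal.exists_orthonormalBasis_extension_of_card_eq (𝕜 := ℂ)
    (E := EuclideanSpace ℂ (Fin n)) (ι := Fin n) (by simp) (v := fun k => cj (ψ k))
    (s := Set.univ) (hon.comp _ Subtype.val_injective)
  refine ⟨φ, fun v => ?_⟩
  rw [levi_eq_complexHessian]
  congr 1
  set w := cj v with hw
  have h1 : ∀ k, ‖inner ℂ (φ k) v‖ ^ 2 = ‖inner ℂ (ψ k) w‖ ^ 2 := by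
    intro k
    rw [hφ k (Set.mem_univ _), ← hcj2 v, hcj, RCLike.norm_conj]
  simp only [h1]
  have h2 : ∑ i, ∑ j, complexHessian h z i j * v i * starRingEnd ℂ (v j)
      = inner ℂ w (WithLp.toLp 2 ((complexHessian h z).mulVec w.ofLp)) := by
    simp only [PiLp.inner_apply, RCLike.inner_apply, Matrix.mulVec, dotProduct, Finset.sum_mul]
    refine Finset.sum_congr rfl fun i _ => Finset.sum_congr rfl fun j _ => ?_
    simp [hw, cj]
    ring
  have h3 : WithLp.toLp 2 ((complexHessian h z).mulVec w.ofLp)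
      = ∑ k, (inner ℂ (ψ k) w * (hA.eigenvalues k : ℂ)) • ψ k := by
    have hlin : ∀ a : EuclideanSpace ℂ (Fin n), WithLp.toLp 2 ((complexHessian h z).mulVec a.ofLp)
        = Matrix.toEuclideanLin (complexHessian h z) a := fun a => rfl
    rw [hlin]
    conv_lhs => rw [← ψ.sum_repr' w]
    rw [map_sum]
    refine Finset.sum_congr rfl fun k _ => ?_
    rw [map_smul, ← hlin, hψ, hA.mulVec_eigenvectorBasis k, mul_smul]
    rfl
  rw [h2, h3, inner_sum, Complex.re_sum]
  refine Finset.sum_congr rfl fun k _ => ?_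
  rw [inner_smul_right, mul_right_comm, ← inner_conj_symm w (ψ k), Complex.mul_conj,
    Complex.normSq_eq_norm_sq, ← Complex.ofReal_mul, Complex.ofReal_re]
  rfl

end Spectral

/-! ### The dual form of the equation -/

section Dual

variable {n : ℕ}

/-- `Γ`-solutions, tested against the linear forms `h ↦ ∑ l_i levi h z (e_i)` with `l` in the dual
cone and `e` an orthonormal basis. The second condition says that the forms cannot all be bounded
below by a positive multiple of `∑ l_i`; this uniform version of the supersolution property is
the one that is used, and it passes to limits. -/
structure IsDualSolution (Γ : ConvexCone ℝ (Fin n → ℝ)) (u : EuclideanSpace ℂ (Fin n) → ℝ) :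
    Prop where
  sub : ∀ h : EuclideanSpace ℂ (Fin n) → ℝ, ContDiff ℝ 2 h → ∀ z,
    IsLocalMax (fun w => u w - h w) z →
      ∀ e : OrthonormalBasis (Fin n) ℂ (EuclideanSpace ℂ (Fin n)), ∀ l ∈ dualCone Γ,
        0 ≤ ∑ i, l i * levi h z (e i)
  super : ∀ h : EuclideanSpace ℂ (Fin n) → ℝ, ContDiff ℝ 2 h → ∀ z,
    IsLocalMin (fun w => u w - h w) z →
      ∀ c : ℝ, 0 < c → ¬ ∀ e : OrthonormalBasis (Fin n) ℂ (EuclideanSpace ℂ (Fin n)),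
        ∀ l ∈ dualCone Γ, c * ∑ i, l i ≤ ∑ i, l i * levi h z (e i)

theorem IsGammaSolution.isDualSolution {Γ : ConvexCone ℝ (Fin n → ℝ)}
    (hopen : IsOpen (Γ : Set (Fin n → ℝ)))
    (hsymm : ∀ (σ : Equiv.Perm (Fin n)) (x : Fin n → ℝ), x ∈ Γ → x ∘ σ ∈ Γ)
    (horthant : positiveOrthant n ⊆ (Γ : Set (Fin n → ℝ)))
    {u : EuclideanSpace ℂ (Fin n) → ℝ} (hu : IsGammaSolution (Γ : Set (Fin n → ℝ)) u) :
    IsDualSolution Γ u where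
  sub := by
    intro h hh z hz e l hl
    obtain ⟨φ, hφ⟩ := exists_orthonormalBasis_levi hh z
    have h1 := hu.of_isLocalMax h hh z hz
    have h2 : (fun j => ∑ i, ‖inner ℂ (φ i) (e j)‖ ^ 2 * hessianEigenvalues hh z i)
        ∈ closure (Γ : Set (Fin n → ℝ)) := by
      have hc : Continuous fun x : Fin n → ℝ => fun j => ∑ i, ‖inner ℂ (φ i) (e j)‖ ^ 2 * x i := by
        fun_prop
      exact map_mem_closure hc h1 fun x hx => schur_mem hsymm φ e hx
    have hcl : IsClosed {x : Fin n → ℝ | 0 ≤ ∑ i, l i * x i} :=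
      isClosed_le continuous_const (by fun_prop)
    have h3 := closure_minimal (fun x hx => (hl x hx).le) hcl h2
    have h4 : ∑ i, l i * levi h z (e i)
        = 4 * ∑ j, l j * ∑ i, ‖inner ℂ (φ i) (e j)‖ ^ 2 * hessianEigenvalues hh z i := by
      rw [Finset.mul_sum]
      refine Finset.sum_congr rfl fun j _ => ?_
      rw [hφ]; ring
    rw [h4]
    have h5 : 0 ≤ ∑ j, l j * ∑ i, ‖inner ℂ (φ i) (e j)‖ ^ 2 * hessianEigenvalues hh z i := h3
    positivity
  super := by
    intro h hh z hz c hc hall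
    obtain ⟨φ, hφ⟩ := exists_orthonormalBasis_levi hh z
    refine hu.of_isLocalMin h hh z hz (mem_of_dualCone hopen horthant fun l hl => ?_)
    have h1 := hall φ l hl
    have h2 := sum_pos_of_mem_dualCone horthant hl
    have h3 : ∀ j, levi h z (φ j) = 4 * hessianEigenvalues hh z j := by
      intro j
      rw [hφ]
      congr 1
      simp [orthonormal_iff_ite.1 φ.orthonormal, apply_ite norm, ite_pow]
    have h4 : ∑ i, l i * levi h z (φ i) = 4 * ∑ i, l i * hessianEigenvalues hh z i := by
      rw [Finset.mul_sum]
      refine Finset.sum_congr rfl fun j _ => ?_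
      rw [h3]; ring
    rw [h4] at h1
    nlinarith

end Dual

/-! ### Stability under translations and limits -/

section Stability

variable {E : Type*} [NormedAddCommGroup E] [NormedSpace ℝ E] [FiniteDimensional ℝ E]

/-- A penalised local maximum persists under uniformly small perturbations. -/
theorem exists_isLocalMax_of_close {v h : E → ℝ} {z : E} (hz : IsLocalMax (fun w => v w - h w) z)
    (hh : Continuous h) {δ ρ : ℝ} (hδ : 0 < δ) (hρ : 0 < ρ) :
    ∃ θ, 0 < θ ∧ ∀ u : E → ℝ, Continuous u → (∀ x, ‖x - z‖ ≤ ρ → |u x - v x| ≤ θ) →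
      ∃ w, ‖w - z‖ < ρ ∧ IsLocalMax (fun x => u x - (h x + δ * ‖x - z‖ ^ 2)) w := by
  have : ProperSpace E := FiniteDimensional.proper ℝ E
  obtain ⟨ρ₁, hρ₁, hball⟩ := Metric.eventually_nhds_iff.1 hz
  set ρ₂ := min (ρ₁ / 2) ρ with hρ₂
  have hρ₂0 : 0 < ρ₂ := lt_min (by positivity) hρ
  have hmaxv : ∀ x, ‖x - z‖ ≤ ρ₂ → v x - h x ≤ v z - h z := fun x hx => hball (by
    rw [dist_eq_norm]
    have := min_le_left (ρ₁ / 2) ρ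
    linarith)
  refine ⟨δ * ρ₂ ^ 2 / 4, by positivity, fun u hu hclose => ?_⟩
  have hclose' : ∀ x, ‖x - z‖ ≤ ρ₂ → |u x - v x| ≤ δ * ρ₂ ^ 2 / 4 := fun x hx =>
    hclose x (hx.trans (min_le_right _ _))
  have hc : Continuous fun x => u x - (h x + δ * ‖x - z‖ ^ 2) := by fun_prop
  obtain ⟨w, hw, hmax⟩ := (isCompact_closedBall z ρ₂).exists_isMaxOn
    ⟨z, Metric.mem_closedBall_self hρ₂0.le⟩ hc.continuousOn
  rw [Metric.mem_closedBall, dist_eq_norm] at hw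
  have h1 := hmax (Metric.mem_closedBall_self hρ₂0.le)
  simp only [Set.mem_ofPred_eq, sub_self, norm_zero] at h1
  have h2 := hmaxv w hw
  have h3 := (abs_le.1 (hclose' w hw)).2
  have h4 := (abs_le.1 (hclose' z (by simpa using hρ₂0.le))).1
  have h5 : δ * ‖w - z‖ ^ 2 ≤ δ * (ρ₂ ^ 2 / 2) := by linarith
  have h6 : ‖w - z‖ ^ 2 < ρ₂ ^ 2 := by
    have := le_of_mul_le_mul_left h5 hδ
    have : 0 < ρ₂ ^ 2 := by positivity
    linarith
  have h7 : ‖w - z‖ < ρ₂ := lt_of_pow_lt_pow_left₀ 2 hρ₂0.le h6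
  refine ⟨w, h7.trans_le (min_le_right _ _), hmax.isLocalMax ?_⟩
  exact Filter.mem_of_superset (Metric.isOpen_ball.mem_nhds (by
    rwa [Metric.mem_ball, dist_eq_norm])) Metric.ball_subset_closedBall

/-- A uniformly bounded and uniformly Lipschitz sequence converges along every ultrafilter, locally
uniformly. -/
theorem exists_ultrafilter_limit (F : Ultrafilter ℕ) {f : ℕ → E → ℝ} {C : ℝ≥0}
    (hb : ∀ k x, |f k x| ≤ C) (hL : ∀ k, LipschitzWith C (f k)) :
    ∃ v : E → ℝ, (∀ x, |v x| ≤ C) ∧ LipschitzWith C v ∧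
      ∀ R θ : ℝ, 0 < θ → ∀ᶠ k in (F : Filter ℕ), ∀ x, ‖x‖ ≤ R → |f k x - v x| ≤ θ := by
  have : ProperSpace E := FiniteDimensional.proper ℝ E
  have hlim : ∀ x, ∃ y ∈ Set.Icc (-(C : ℝ)) C, Filter.Tendsto (fun k : ℕ => f k x) F (nhds y) := by
    intro x
    obtain ⟨y, hy, hle⟩ := (isCompact_Icc (a := -(C : ℝ)) (b := C)).ultrafilter_le_nhds
      (F.map fun k : ℕ => f k x) (by
        rw [Filter.le_principal_iff]
        exact Filter.mem_map.2 (Filter.univ_mem' fun k => abs_le.1 (hb k x)))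
    exact ⟨y, hy, hle⟩
  choose v hvC hv using hlim
  have hvL : LipschitzWith C v := by
    refine LipschitzWith.of_dist_le_mul fun x y => ?_
    have h1 := ((hv x).sub (hv y)).abs
    rw [Real.dist_eq]
    refine le_of_tendsto h1 (Filter.Eventually.of_forall fun k => ?_)
    have := (hL k).dist_le_mul x y
    rwa [Real.dist_eq] at this
  refine ⟨v, fun x => abs_le.2 (hvC x), hvL, fun R θ hθ => ?_⟩
  set r := θ / (3 * (C + 1)) with hr
  have hr0 : 0 < r := by positivity
  obtain ⟨t, -, htf, hcov⟩ := (isCompact_closedBall (0 : E) R).finite_cover_balls hr0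
  have hev : ∀ᶠ k in (F : Filter ℕ), ∀ y ∈ t, |f k y - v y| ≤ θ / 3 := by
    refine (Filter.eventually_all_finite htf).2 fun y _ => ?_
    have h1 := ((hv y).sub_const (v y)).abs
    rw [sub_self, abs_zero] at h1
    exact h1.eventually (eventually_le_nhds (by positivity))
  filter_upwards [hev] with k hk x hx
  have hx' := hcov (mem_closedBall_zero_iff.2 hx)
  simp only [Set.mem_iUnion, Metric.mem_ball, exists_prop] at hx'
  obtain ⟨y, hy, hxy⟩ := hx'
  have e1 := (hL k).dist_le_mul x y
  have e2 := hvL.dist_le_mul x y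
  have e3 := hk y hy
  have e4 : (C : ℝ) * dist x y ≤ θ / 3 := by
    have : (C : ℝ) * dist x y ≤ (C + 1) * r := by
      have := C.2
      gcongr
      linarith
    refine this.trans (le_of_eq ?_)
    rw [hr]
    field_simp
  rw [Real.dist_eq] at e1 e2
  rw [abs_le] at *
  constructor <;> linarith [e1.1, e1.2, e2.1, e2.2, e3.1, e3.2]

theorem exists_abs_hess_sub_le {h : E → ℝ} (hh : ContDiff ℝ 2 h) (z : E) {ε : ℝ} (hε : 0 < ε) :
    ∃ ρ, 0 < ρ ∧ ∀ w, ‖w - z‖ < ρ → ∀ v, |hess h w v - hess h z v| ≤ ε * ‖v‖ ^ 2 := by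
  have hDn : Continuous fun w => ‖fderiv ℝ (fderiv ℝ h) w - fderiv ℝ (fderiv ℝ h) z‖ :=
    (((hh.fderiv_right (m := 1) (by norm_num)).continuous_fderiv (by norm_num)).sub
      continuous_const).norm
  have hev : ∀ᶠ w in nhds z, ‖fderiv ℝ (fderiv ℝ h) w - fderiv ℝ (fderiv ℝ h) z‖ < ε :=
    hDn.continuousAt.eventually_lt continuousAt_const (by
      rw [sub_self]
      exact ContinuousLinearMap.opNorm_zero.trans_lt hε)
  obtain ⟨ρ, hρ, hnear⟩ := Metric.eventually_nhds_iff.1 hev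
  refine ⟨ρ, hρ, fun w hw v => ?_⟩
  have h1 : hess h w v - hess h z v
      = (fderiv ℝ (fderiv ℝ h) w - fderiv ℝ (fderiv ℝ h) z) v v := by simp [hess]
  have h2 := hnear (y := w) (by rwa [dist_eq_norm])
  rw [h1, ← Real.norm_eq_abs, pow_two, ← mul_assoc]
  refine (ContinuousLinearMap.le_opNorm₂ _ v v).trans ?_
  gcongr

end Stability

section StabilityDual

variable {n : ℕ} {Γ : ConvexCone ℝ (Fin n → ℝ)}

theorem contDiff_norm_sq_sub (z : EuclideanSpace ℂ (Fin n)) :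
    ContDiff ℝ 2 fun y : EuclideanSpace ℂ (Fin n) => ‖y - z‖ ^ 2 :=
  (contDiff_norm_sq ℂ).comp (contDiff_id.sub contDiff_const)

theorem levi_add_const_mul_norm_sq {h : EuclideanSpace ℂ (Fin n) → ℝ} (hh : ContDiff ℝ 2 h)
    (δ : ℝ) (a x v : EuclideanSpace ℂ (Fin n)) :
    levi (fun y => h y + δ * ‖y - a‖ ^ 2) x v = levi h x v + 4 * δ * ‖v‖ ^ 2 := by
  have hq := contDiff_norm_sq_sub a
  unfold levi
  rw [hess_add hh (contDiff_const.mul hq), hess_add hh (contDiff_const.mul hq),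
    hess_const_mul hq, hess_const_mul hq, hess_norm_sq_sub, hess_norm_sq_sub, norm_smul]
  simp
  ring

theorem IsDualSolution.translate {u : EuclideanSpace ℂ (Fin n) → ℝ} (hu : IsDualSolution Γ u)
    (a : EuclideanSpace ℂ (Fin n)) : IsDualSolution Γ fun w => u (a + w) := by
  have hT : ∀ z : EuclideanSpace ℂ (Fin n), Filter.Tendsto (fun w => w + -a) (nhds (a + z))
      (nhds z) := by
    intro z
    have h1 : ContinuousAt (fun w : EuclideanSpace ℂ (Fin n) => w + -a) (a + z) := by fun_prop
    have h2 : a + z + -a = z := by abel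
    simpa only [ContinuousAt, h2] using h1
  have h2 : ∀ z : EuclideanSpace ℂ (Fin n), a + z + -a = z := fun z => by abel
  have h3 : ∀ z : EuclideanSpace ℂ (Fin n), a + (z + -a) = z := fun z => by abel
  have hl : ∀ (h : EuclideanSpace ℂ (Fin n) → ℝ) z v,
      levi (fun w => h (w + -a)) (a + z) v = levi h z v := by
    intro h z v
    simp only [levi, hess_comp_add_right, h2]
  constructor
  · intro h hh z hz e l hl'
    have := hu.sub (fun w => h (w + -a)) (hh.comp (contDiff_id.add contDiff_const)) (a + z) (by
      have := (hT z).eventually hz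
      simpa only [h3, IsLocalMax, IsMaxFilter, h2] using this) e l hl'
    simpa only [hl] using this
  · intro h hh z hz c hc
    have := hu.super (fun w => h (w + -a)) (hh.comp (contDiff_id.add contDiff_const)) (a + z) (by
      have := (hT z).eventually hz
      simpa only [h3, IsLocalMin, IsMinFilter, h2] using this) c hc
    simpa only [hl] using this

/-- Stability under locally uniform convergence. -/
theorem IsDualSolution.of_limit
    (horthant : positiveOrthant n ⊆ (Γ : Set (Fin n → ℝ)))
    {v : EuclideanSpace ℂ (Fin n) → ℝ}
    (happrox : ∀ R θ : ℝ, 0 < θ → ∃ u : EuclideanSpace ℂ (Fin n) → ℝ, IsDualSolution Γ u ∧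
      Continuous u ∧ ∀ x, ‖x‖ ≤ R → |u x - v x| ≤ θ) : IsDualSolution Γ v := by
  have hball : ∀ {z x : EuclideanSpace ℂ (Fin n)} {ρ : ℝ}, ‖x - z‖ ≤ ρ → ‖x‖ ≤ ρ + ‖z‖ := by
    intro z x ρ hx
    have := norm_add_le (x - z) z
    rw [sub_add_cancel] at this
    linarith
  constructor
  · intro h hh z hz e l hl
    by_contra! hneg
    have hl0 := sum_pos_of_mem_dualCone horthant hl
    set S : EuclideanSpace ℂ (Fin n) → ℝ := fun w => ∑ i, l i * levi h w (e i) with hS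
    have hSc : Continuous S := by
      refine continuous_finsetSum _ fun i _ => continuous_const.mul ?_
      exact (continuous_hess hh _).add (continuous_hess hh _)
    set c := - S z with hc
    have hc0 : 0 < c := by simp only [hc]; linarith
    obtain ⟨ρ, hρ, hnear⟩ := Metric.continuousAt_iff.1 (hSc.continuousAt (x := z)) (c / 2)
      (by positivity)
    set δ := c / (8 * ∑ i, l i) with hδ
    have hδ0 : 0 < δ := by positivity
    obtain ⟨θ, hθ, hpert⟩ := exists_isLocalMax_of_close hz hh.continuous hδ0 hρ
    obtain ⟨u, hu, huc, hclose⟩ := happrox (ρ + ‖z‖) θ hθ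
    obtain ⟨w, hw, hmax⟩ := hpert u huc fun x hx => hclose x (hball hx)
    have h1 := hu.sub _ (hh.add (contDiff_const.mul (contDiff_norm_sq_sub z))) w hmax e l hl
    simp only [levi_add_const_mul_norm_sq hh, e.norm_eq_one, mul_add, Finset.sum_add_distrib] at h1
    have h2 := hnear (x := w) (by rwa [dist_eq_norm])
    rw [Real.dist_eq, abs_lt] at h2
    have h3 : ∑ i, l i * (4 * δ * 1 ^ 2) = c / 2 := by
      rw [← Finset.sum_mul, hδ]
      field_simp
      norm_num
    rw [h3] at h1
    have h4 : ∑ i, l i * levi h w (e i) = S w := rfl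
    linarith [h2.2]
  · intro h hh z hz c hc hall
    obtain ⟨ρ, hρ, hnear⟩ := exists_abs_hess_sub_le hh z (ε := c / 8) (by positivity)
    have hz' : IsLocalMax (fun w => (- v w) - (- h w)) z := by
      have := hz.neg
      refine this.congr (Filter.Eventually.of_forall fun w => ?_)
      simp; ring
    have hδ0 : 0 < c / 16 := by positivity
    obtain ⟨θ, hθ, hpert⟩ := exists_isLocalMax_of_close hz' hh.neg.continuous hδ0 hρ
    obtain ⟨u, hu, huc, hclose⟩ := happrox (ρ + ‖z‖) θ hθ
    obtain ⟨w, hw, hmax⟩ := hpert (fun x => - u x) huc.neg fun x hx => by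
      have := hclose x (hball hx)
      rwa [← abs_neg, show -(-u x - -v x) = u x - v x by ring]
    have hq := contDiff_norm_sq_sub z
    refine hu.super (fun y => h y + -(c / 16) * ‖y - z‖ ^ 2) (hh.add (contDiff_const.mul hq)) w ?_
      (c / 2) (by positivity) fun e l hl => ?_
    · have := hmax.neg
      refine this.congr (Filter.Eventually.of_forall fun w => ?_)
      simp; ring
    · have h1 := hall e l hl
      have h3 : ∀ i, levi h z (e i) - c / 2
          ≤ levi (fun y => h y + -(c / 16) * ‖y - z‖ ^ 2) w (e i) := by
        intro i
        rw [levi_add_const_mul_norm_sq hh, e.norm_eq_one]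
        have a1 := hnear w hw (e i)
        have a2 := hnear w hw (Complex.I • e i)
        rw [norm_smul, e.norm_eq_one] at a2
        rw [e.norm_eq_one] at a1
        simp only [Complex.norm_I, one_pow, mul_one] at a1 a2
        have b1 := (abs_le.1 a1).1
        have b2 := (abs_le.1 a2).1
        unfold levi
        linarith
      have h4 : ∑ i, l i * (levi h z (e i) - c / 2)
          ≤ ∑ i, l i * levi (fun y => h y + -(c / 16) * ‖y - z‖ ^ 2) w (e i) :=
        Finset.sum_le_sum fun i _ =>
          mul_le_mul_of_nonneg_left (h3 i) (nonneg_of_mem_dualCone horthant hl i)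
      have h5 : ∑ i, l i * (levi h z (e i) - c / 2)
          = ∑ i, l i * levi h z (e i) - c / 2 * ∑ i, l i := by
        simp only [mul_sub, Finset.sum_sub_distrib, ← Finset.sum_mul]
        ring
      linarith

end StabilityDual

/-! ### Complex directions of invariance -/

section Invariance

variable {E : Type*} [NormedAddCommGroup E] [NormedSpace ℝ E] [NormedSpace ℂ E]
  [IsScalarTower ℝ ℂ E]

/-- The function `u` is constant on all complex lines parallel to `v`. -/
def InvariantAlong (u : E → ℝ) (v : E) : Prop := ∀ z (t : ℂ), u (z + t • v) = u z

theorem InvariantAlong.smul {u : E → ℝ} {v : E} (h : InvariantAlong u v) (c : ℂ) :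
    InvariantAlong u (c • v) := fun z t => by rw [smul_smul]; exact h z _

theorem InvariantAlong.dirDeriv_eq_zero {f : E → ℝ} {v : E} (h : InvariantAlong f v)
    (hf : Differentiable ℝ f) (x : E) : dirDeriv v f x = 0 := by
  have h1 := hasDerivAt_line hf x v 0
  have h2 : (fun s : ℝ => f (x + s • v)) = fun _ => f x := by
    ext s
    rw [← algebraMap_smul ℂ s v]
    exact h x _
  rw [h2, zero_smul, add_zero] at h1
  exact h1.unique (hasDerivAt_const 0 _)

theorem InvariantAlong.hess_eq_zero {f : E → ℝ} {v : E} (h : InvariantAlong f v)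
    (hf : ContDiff ℝ 2 f) (x : E) : hess f x v = 0 := by
  have h1 : dirDeriv v f = fun _ => 0 :=
    funext (h.dirDeriv_eq_zero (hf.differentiable (by norm_num)))
  rw [hess_eq_dirDeriv hf, h1]
  simp [dirDeriv]

theorem InvariantAlong.levi_eq_zero {f : E → ℝ} {v : E} (h : InvariantAlong f v)
    (hf : ContDiff ℝ 2 f) (x : E) : levi f x v = 0 := by
  rw [levi, h.hess_eq_zero hf, (h.smul _).hess_eq_zero hf, add_zero]

theorem InvariantAlong.mollify [FiniteDimensional ℝ E] [MeasurableSpace E] [BorelSpace E]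
    {μ : Measure E} [μ.IsAddHaarMeasure] {u : E → ℝ} {v : E} (h : InvariantAlong u v)
    (κ : E → ℝ) : InvariantAlong (mollify μ κ u) v := by
  intro z t
  rw [← mollify_comp_add_right]
  congr 1
  ext y
  exact h y t

theorem hess_comp_line {w : E → ℝ} (hw : ContDiff ℝ 2 w) (x v : E) (ζ a : ℂ) :
    ContDiff ℝ 2 (fun ζ : ℂ => w (x + ζ • v)) ∧
      hess (fun ζ : ℂ => w (x + ζ • v)) ζ a = hess w (x + ζ • v) (a • v) := by
  have haff : ContDiff ℝ 2 fun ζ : ℂ => x + ζ • v := by fun_prop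
  have key : ∀ f : E → ℝ, ContDiff ℝ 1 f → ∀ ζ : ℂ,
      dirDeriv a (fun ζ : ℂ => f (x + ζ • v)) ζ = dirDeriv (a • v) f (x + ζ • v) := by
    intro f hf ζ
    have hg : ContDiff ℝ 1 fun ζ : ℂ => f (x + ζ • v) := hf.comp (haff.of_le (by norm_num))
    have h1 := hasDerivAt_line (hg.differentiable (by norm_num)) ζ a 0
    have h2 := hasDerivAt_line (hf.differentiable (by norm_num)) (x + ζ • v) (a • v) 0
    have h3 : (fun s : ℝ => f (x + ζ • v + s • a • v)) = fun s : ℝ => f (x + (ζ + s • a) • v) := by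
      ext s
      rw [add_smul, add_assoc, smul_assoc]
    rw [h3] at h2
    have := h1.unique h2
    simpa using this
  have hcomp : ContDiff ℝ 2 fun ζ : ℂ => w (x + ζ • v) := hw.comp haff
  refine ⟨hcomp, ?_⟩
  have h1 : dirDeriv a (fun ζ : ℂ => w (x + ζ • v)) = fun ζ => dirDeriv (a • v) w (x + ζ • v) :=
    funext (key w (hw.of_le (by norm_num)))
  rw [hess_eq_dirDeriv hcomp, h1, key _ (hw.dirDeriv (by norm_num) _),
    ← hess_eq_dirDeriv hw]

/-- A bounded `C²` function whose Levi form is nonnegative in the direction `v` is constant on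
the complex lines parallel to `v`. -/
theorem invariantAlong_of_levi_nonneg {w : E → ℝ} (hw : ContDiff ℝ 2 w) {C : ℝ}
    (hC : ∀ x, |w x| ≤ C) {v : E} (h : ∀ x, 0 ≤ levi w x v) : InvariantAlong w v := by
  intro z t
  have h1 := eq_of_levi_nonneg (g := fun ζ : ℂ => w (z + ζ • v)) (hess_comp_line hw z v 0 0).1
    (fun ζ => hC _) (fun ζ => by
      rw [levi, (hess_comp_line hw z v ζ _).2, (hess_comp_line hw z v ζ _).2]
      simpa [levi] using h (z + ζ • v)) t
  simpa using h1

end Invariance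

/-! ### Mollified solutions -/

section Mollified

variable {n : ℕ} {Γ : ConvexCone ℝ (Fin n → ℝ)}
  {μ : Measure (EuclideanSpace ℂ (Fin n))} [μ.IsAddHaarMeasure]
  {u : EuclideanSpace ℂ (Fin n) → ℝ} {C : ℝ≥0}

/-- The real basis `e_j, i e_j` attached to a complex orthonormal basis. -/
noncomputable def realBasis (e : OrthonormalBasis (Fin n) ℂ (EuclideanSpace ℂ (Fin n))) :
    Module.Basis (Fin 2 × Fin n) ℝ (EuclideanSpace ℂ (Fin n)) :=
  Complex.basisOneI.smulTower e.toBasis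

theorem weightedLap_realBasis (e : OrthonormalBasis (Fin n) ℂ (EuclideanSpace ℂ (Fin n)))
    (l : Fin n → ℝ) (h : EuclideanSpace ℂ (Fin n) → ℝ) (x : EuclideanSpace ℂ (Fin n)) :
    weightedLap (fun p => l p.2) (realBasis e) h x = ∑ i, l i * levi h x (e i) := by
  unfold weightedLap
  rw [Fintype.sum_prod_type, Fin.sum_univ_two, ← Finset.sum_add_distrib]
  refine Finset.sum_congr rfl fun i _ => ?_
  simp only [realBasis, Module.Basis.smulTower_apply, Complex.coe_basisOneI, levi, mul_add]
  simp

/-- Mollified solutions are smooth subsolutions. -/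
theorem IsDualSolution.mollify_nonneg (hu : IsDualSolution Γ u)
    (horthant : positiveOrthant n ⊆ (Γ : Set (Fin n → ℝ))) (hb : ∀ z, |u z| ≤ C)
    (hL : LipschitzWith C u) {η : EuclideanSpace ℂ (Fin n) → ℝ} (hη : IsMollifier μ η)
    (e : OrthonormalBasis (Fin n) ℂ (EuclideanSpace ℂ (Fin n))) {l : Fin n → ℝ}
    (hl : l ∈ dualCone Γ) (x : EuclideanSpace ℂ (Fin n)) :
    0 ≤ ∑ i, l i * levi (mollify μ η u) x (e i) := by
  have hvis : IsLapSubsolution (fun p : Fin 2 × Fin n => l p.2) (realBasis e) u := by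
    intro h hh z hz
    rw [weightedLap_realBasis]
    exact hu.sub h hh z hz e l hl
  have := hvis.weightedLap_mollify_nonneg (μ := μ)
    (fun p => nonneg_of_mem_dualCone horthant hl p.2) (by
      rw [Fintype.sum_prod_type, Fin.sum_univ_two]
      have := sum_pos_of_mem_dualCone horthant hl
      linarith) hL hb hη x
  rwa [weightedLap_realBasis] at this

/-- If the indicator of the directions transverse to the invariant ones is not in `Γ`, mollified
solutions have nonnegative Levi form in the transverse directions: some form in the dual cone only
has weights in `B`, and after a transposition of the basis only the weight of `e j` matters.
Liouville's theorem on complex lines applies. -/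
theorem IsDualSolution.invariantAlong_of_notMem (hu : IsDualSolution Γ u)
    (hopen : IsOpen (Γ : Set (Fin n → ℝ)))
    (horthant : positiveOrthant n ⊆ (Γ : Set (Fin n → ℝ))) (hb : ∀ z, |u z| ≤ C)
    (hL : LipschitzWith C u) (e : OrthonormalBasis (Fin n) ℂ (EuclideanSpace ℂ (Fin n)))
    {B : Finset (Fin n)} (hB : ∀ i ∈ B, InvariantAlong u (e i))
    (hnot : (fun i => if i ∈ B then (0 : ℝ) else 1) ∉ Γ) {j : Fin n} (hj : j ∉ B) :
    InvariantAlong u (e j) := by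
  let μ : Measure (EuclideanSpace ℂ (Fin n)) := Measure.addHaar
  obtain ⟨l, hl, hl1⟩ : ∃ l ∈ dualCone Γ, ∑ i, l i * (if i ∈ B then (0 : ℝ) else 1) ≤ 0 := by
    by_contra! hcon
    exact hnot (mem_of_dualCone hopen horthant hcon)
  have hl0 := nonneg_of_mem_dualCone horthant hl
  have hlB : ∀ i ∉ B, l i = 0 := by
    intro i hi
    have h1 := Finset.single_le_sum (f := fun i => l i * (if i ∈ B then (0 : ℝ) else 1))
      (fun i _ => mul_nonneg (hl0 i) (by split_ifs <;> norm_num)) (Finset.mem_univ i)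
    simp only [hi, if_false, mul_one] at h1
    exact le_antisymm (h1.trans hl1) (hl0 i)
  obtain ⟨i₀, -, hi₀⟩ : ∃ i ∈ Finset.univ, 0 < l i := by
    refine Finset.exists_lt_of_sum_lt (f := fun _ => (0 : ℝ)) ?_
    simpa using sum_pos_of_mem_dualCone horthant hl
  have hmoll : ∀ η : EuclideanSpace ℂ (Fin n) → ℝ, IsMollifier μ η →
      InvariantAlong (mollify μ η u) (e j) := by
    intro η hη
    have hw : ContDiff ℝ 2 (mollify μ η u) := hη.contDiff_mollify hL.continuous 2
    refine invariantAlong_of_levi_nonneg hw (C := 1 * C) (fun x => ?_) fun x => ?_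
    · have := abs_mollify_le (μ := μ) hη.contDiff.continuous hη.compact hb x
      rwa [hη.integral_abs] at this
    · -- Exchange the roles of `e j` and of an invariant direction with positive weight.
      have h1 := hu.mollify_nonneg horthant hb hL hη (e.reindex (Equiv.swap i₀ j)) hl x
      have h2 : ∑ i, l i * levi (mollify μ η u) x (e.reindex (Equiv.swap i₀ j) i)
          = l i₀ * levi (mollify μ η u) x (e j) := by
        rw [Finset.sum_eq_single i₀]
        · simp
        · intro i _ hi
          by_cases hiB : i ∈ B
          · have hij : i ≠ j := fun h => hj (h ▸ hiB)
            rw [OrthonormalBasis.reindex_apply, Equiv.symm_swap,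
              Equiv.swap_apply_of_ne_of_ne hi hij, ((hB i hiB).mollify η).levi_eq_zero hw, mul_zero]
          · rw [hlB i hiB, zero_mul]
        · simp
      rw [h2] at h1
      exact nonneg_of_mul_nonneg_right h1 hi₀
  intro z t
  have key : ∀ ε : ℝ, 0 < ε → |u (z + t • e j) - u z| ≤ 0 + ε := by
    intro ε hε
    obtain ⟨κ, hκ, hκε⟩ := exists_isMollifier (E := EuclideanSpace ℂ (Fin n)) μ
      (ε := ε / (2 * (C + 1))) (by positivity)
    have h1 := hκ.abs_mollify_sub_le hκε hL z
    have h2 := hκ.abs_mollify_sub_le hκε hL (z + t • e j)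
    rw [hmoll κ hκ z t] at h2
    have h3 : (C : ℝ) * (ε / (2 * (C + 1))) ≤ ε / 2 := by
      have : (C : ℝ) * (ε / (2 * (C + 1))) ≤ (C + 1) * (ε / (2 * (C + 1))) := by
        gcongr
        linarith
      refine this.trans (le_of_eq ?_)
      field_simp
    rw [abs_le] at *
    constructor <;> linarith [h1.1, h1.2, h2.1, h2.2]
  have := le_of_forall_pos_le_add key
  exact sub_eq_zero.1 (abs_nonpos_iff.1 this)

end Mollified

/-! ### The gradient form -/

section GradForm

variable {E : Type*} [NormedAddCommGroup E] [NormedSpace ℝ E] [NormedSpace ℂ E]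
  [IsScalarTower ℝ ℂ E]

/-- The quadratic form `v ↦ |∂_v f|² + |∂_{iv} f|²`, four times `|∂f(v)|²`. -/
noncomputable def gradForm (f : E → ℝ) (v x : E) : ℝ :=
  dirDeriv v f x ^ 2 + dirDeriv (Complex.I • v) f x ^ 2

theorem gradForm_nonneg (f : E → ℝ) (v x : E) : 0 ≤ gradForm f v x := by
  unfold gradForm
  positivity

theorem continuous_gradForm {f : E → ℝ} (hf : ContDiff ℝ 1 f) (v : E) :
    Continuous (gradForm f v) :=
  (((hf.dirDeriv (k := 0) (by norm_num) v).continuous).pow 2).add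
    (((hf.dirDeriv (k := 0) (by norm_num) _).continuous).pow 2)

theorem gradForm_smul (f : E → ℝ) (c : ℝ) (v x : E) :
    gradForm f (c • v) x = c ^ 2 * gradForm f v x := by
  unfold gradForm dirDeriv
  rw [smul_comm, map_smul, map_smul]
  simp only [smul_eq_mul]
  ring

theorem gradForm_add_of_invariantAlong {f : E → ℝ} {p : E} (h : InvariantAlong f p)
    (hf : Differentiable ℝ f) (v x : E) : gradForm f (v + p) x = gradForm f v x := by
  have h1 := h.dirDeriv_eq_zero hf x
  have h2 := (h.smul Complex.I).dirDeriv_eq_zero hf x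
  unfold dirDeriv at h1 h2
  unfold gradForm dirDeriv
  rw [smul_add, map_add, map_add, h1, h2, add_zero, add_zero]

theorem InvariantAlong.sum {f : E → ℝ} {ι : Type*} {s : Finset ι} {v : ι → E}
    (h : ∀ i ∈ s, InvariantAlong f (v i)) : InvariantAlong f (∑ i ∈ s, v i) := by
  classical
  induction s using Finset.induction_on with
  | empty => intro z t; simp
  | insert a s ha ih =>
    intro z t
    rw [Finset.sum_insert ha, smul_add, ← add_assoc, ih (fun i hi => h i (by simp [hi])),
      h a (by simp)]

theorem hess_sq {g : E → ℝ} (hg : ContDiff ℝ 2 g) (x v : E) :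
    hess (fun y => g y ^ 2) x v = 2 * g x * hess g x v + 2 * dirDeriv v g x ^ 2 := by
  have hd : Differentiable ℝ g := hg.differentiable (by norm_num)
  have hsq : ContDiff ℝ 2 fun y => g y ^ 2 := hg.pow 2
  have hd1 : Differentiable ℝ (dirDeriv v g) :=
    (hg.dirDeriv (k := 1) (by norm_num) v).differentiable (by norm_num)
  have h1 : dirDeriv v (fun y => g y ^ 2) = fun y => 2 * g y * dirDeriv v g y := by
    ext y
    have e1 := hasDerivAt_line (hsq.differentiable (by norm_num)) y v 0
    have e2 := (hasDerivAt_line hd y v 0).pow 2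
    have := e1.unique e2
    simpa using this
  rw [hess_eq_dirDeriv hsq, hess_eq_dirDeriv hg, h1]
  have hc : ContDiff ℝ 1 fun y => 2 * g y * dirDeriv v g y :=
    (contDiff_const.mul (hg.of_le (by norm_num))).mul (hg.dirDeriv (by norm_num) v)
  have e1 := hasDerivAt_line (hc.differentiable (by norm_num)) x v 0
  have e2 := ((hasDerivAt_line hd x v 0).const_mul 2).mul (hasDerivAt_line hd1 x v 0)
  have := e1.unique e2
  simp only [zero_smul, add_zero] at this
  rw [this]
  ring

theorem levi_sq {g : E → ℝ} (hg : ContDiff ℝ 2 g) (x v : E) :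
    levi (fun y => g y ^ 2) x v = 2 * g x * levi g x v + 2 * gradForm g v x := by
  unfold levi gradForm
  rw [hess_sq hg, hess_sq hg]
  ring

theorem levi_mollify [FiniteDimensional ℝ E] [MeasurableSpace E] [BorelSpace E]
    {μ : Measure E} [μ.IsAddHaarMeasure] {κ f : E → ℝ} (hκ : IsMollifier μ κ)
    (hf : ContDiff ℝ 2 f) (x v : E) :
    levi (mollify μ κ f) x v = mollify μ κ (fun y => levi f y v) x := by
  have h2 := hκ.contDiff_nat 2
  unfold levi
  rw [hess_mollify' h2 hκ.compact hf, hess_mollify' h2 hκ.compact hf]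
  unfold mollify
  rw [← integral_add (hκ.integrable_mul (continuous_hess hf _) x)
    (hκ.integrable_mul (continuous_hess hf _) x)]
  simp only [mul_add]

theorem continuous_levi {f : E → ℝ} (hf : ContDiff ℝ 2 f) (v : E) :
    Continuous fun x => levi f x v :=
  (continuous_hess hf _).add (continuous_hess hf _)

/-- A derivative of a mollified function is small near `z` if the average of the squared derivative
around `z`, with respect to a kernel `κ'` that dominates the translates of `κ`, is small. -/
theorem abs_dirDeriv_mollify_le [FiniteDimensional ℝ E] [MeasurableSpace E] [BorelSpace E]
    {μ : Measure E} [μ.IsAddHaarMeasure] {κ κ' f : E → ℝ} (hκ : IsMollifier μ κ)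
    (hκ' : IsMollifier μ κ') (hf : ContDiff ℝ 2 f) {K θ c : ℝ} (hθ : 0 < θ) {x v z : E}
    (hK : ∀ y, κ (y + x) ≤ K * κ' y) {F : E → ℝ} (hF : Continuous F)
    (hle : ∀ y, dirDeriv v f y ^ 2 ≤ F y) (hc : mollify μ κ' F z ≤ c) (hK0 : 0 ≤ K) :
    |dirDeriv v (mollify μ κ f) (z + x)| ≤ θ + K * c / θ := by
  have hd : Continuous (dirDeriv v f) := (hf.dirDeriv (k := 1) (by norm_num) v).continuous
  have hF0 : ∀ y, 0 ≤ F y := fun y => (sq_nonneg _).trans (hle y)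
  have h1 : dirDeriv v (mollify μ κ f) = mollify μ κ (dirDeriv v f) := by
    have hκ1 : ContDiff ℝ 1 κ := hκ.contDiff_nat 1
    rw [dirDeriv_mollify hκ1 hκ.compact hf.continuous,
      mollify_dirDeriv hκ1 hκ.compact (hf.of_le (by norm_num))]
  have h2 : mollify μ κ F (z + x) ≤ K * c := by
    have e1 : mollify μ κ F (z + x) = ∫ y, κ (y + x) * F (z - y) ∂μ := by
      unfold mollify
      rw [← integral_add_right_eq_self _ x]
      simp only [add_sub_add_right_eq_sub]
    have hint : Integrable (fun y => κ (y + x) * F (z - y)) μ := by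
      have := (hκ.integrable_mul hF (z + x)).comp_add_right x
      simpa only [add_sub_add_right_eq_sub] using this
    calc mollify μ κ F (z + x) = ∫ y, κ (y + x) * F (z - y) ∂μ := e1
      _ ≤ ∫ y, K * (κ' y * F (z - y)) ∂μ := by
        refine integral_mono hint ((hκ'.integrable_mul hF z).const_mul K) fun y => ?_
        simp only
        rw [← mul_assoc]
        exact mul_le_mul_of_nonneg_right (hK y) (hF0 _)
      _ = K * mollify μ κ' F z := by rw [integral_const_mul]; rfl
      _ ≤ K * c := mul_le_mul_of_nonneg_left hc hK0
  -- The elementary inequality `|a| ≤ θ + a² / θ` replaces the Cauchy-Schwarz inequality.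
  have h3 : ∀ y, |dirDeriv v f y| ≤ θ + θ⁻¹ * F y := by
    intro y
    have e1 : θ⁻¹ * dirDeriv v f y ^ 2 ≤ θ⁻¹ * F y :=
      mul_le_mul_of_nonneg_left (hle y) (inv_pos.2 hθ).le
    have e2 : |dirDeriv v f y| ≤ θ + θ⁻¹ * dirDeriv v f y ^ 2 := by
      rw [← sq_abs, ← sub_nonneg]
      have : θ + θ⁻¹ * |dirDeriv v f y| ^ 2 - |dirDeriv v f y|
          = θ⁻¹ * ((|dirDeriv v f y| - θ / 2) ^ 2 + 3 / 4 * θ ^ 2) := by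
        field_simp; ring
      rw [this]
      positivity
    linarith
  have h4 : mollify μ κ (fun y => θ + θ⁻¹ * F y) (z + x)
      = θ + θ⁻¹ * mollify μ κ F (z + x) := by
    unfold mollify
    rw [← integral_const_mul]
    have : ∀ y, κ y * (θ + θ⁻¹ * F (z + x - y)) = κ y * θ + θ⁻¹ * (κ y * F (z + x - y)) :=
      fun y => by ring
    simp only [this]
    rw [integral_add (hκ.integrable.mul_const _) ((hκ.integrable_mul hF _).const_mul _),
      integral_mul_const, hκ.integral, one_mul]
  have h5 : θ + θ⁻¹ * mollify μ κ F (z + x) ≤ θ + K * c / θ := by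
    rw [div_eq_inv_mul]
    have := mul_le_mul_of_nonneg_left h2 (inv_pos.2 hθ).le
    linarith
  have hFc : Continuous fun y => θ + θ⁻¹ * F y := by fun_prop
  rw [h1, abs_le]
  constructor
  · have h6 := hκ.mollify_mono (u := fun y => -(θ + θ⁻¹ * F y)) (v := dirDeriv v f) (x := z + x)
      hFc.neg hd (fun y _ => neg_le_of_abs_le (h3 _))
    have h7 : mollify μ κ (fun y => -(θ + θ⁻¹ * F y)) (z + x)
        = - mollify μ κ (fun y => θ + θ⁻¹ * F y) (z + x) := by
      unfold mollify
      rw [← integral_neg]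
      simp only [mul_neg]
    linarith
  · have h6 := hκ.mollify_mono (u := dirDeriv v f) (v := fun y => θ + θ⁻¹ * F y) (x := z + x)
      hd hFc (fun y _ => le_of_abs_le (h3 _))
    linarith

/-- A kernel that is positive on a large ball dominates the translates of a kernel of small
support. -/
theorem exists_kernel_domination [FiniteDimensional ℝ E] [MeasurableSpace E] [BorelSpace E]
    {μ : Measure E} [μ.IsAddHaarMeasure] {κ κ' : E → ℝ} (hκ : IsMollifier μ κ)
    (hκ' : IsMollifier μ κ') {T : ℝ} (hsupp : ∀ y, κ y ≠ 0 → ‖y‖ ≤ 1)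
    (hpos : ∀ y, ‖y‖ ≤ T + 1 → 0 < κ' y) :
    ∃ K, 0 < K ∧ ∀ x, ‖x‖ ≤ T → ∀ y, κ (y + x) ≤ K * κ' y := by
  have : ProperSpace E := FiniteDimensional.proper ℝ E
  obtain ⟨M, hM⟩ := hκ.compact.exists_bound_of_continuous hκ.contDiff.continuous
  have hM0 : 0 ≤ M := (norm_nonneg _).trans (hM 0)
  by_cases hT : 0 ≤ T + 1
  · obtain ⟨y₀, hy₀, hmin⟩ := (isCompact_closedBall (0 : E) (T + 1)).exists_isMinOn
      ⟨0, Metric.mem_closedBall_self hT⟩ hκ'.contDiff.continuous.continuousOn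
    have hm : 0 < κ' y₀ := hpos y₀ (mem_closedBall_zero_iff.1 hy₀)
    refine ⟨(M + 1) / κ' y₀, by positivity, fun x hx y => ?_⟩
    by_cases h0 : κ (y + x) = 0
    · rw [h0]
      exact mul_nonneg (by positivity) (hκ'.nonneg y)
    · have h1 : ‖y‖ ≤ T + 1 := by
        have h2 := norm_sub_le (y + x) x
        rw [add_sub_cancel_right] at h2
        linarith [hsupp _ h0]
      have h2 : κ' y₀ ≤ κ' y := hmin (mem_closedBall_zero_iff.2 h1)
      have h3 := (le_abs_self _).trans (hM (y + x))
      calc κ (y + x) ≤ (M + 1) / κ' y₀ * κ' y₀ := by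
            rw [div_mul_cancel₀ _ hm.ne']; linarith
        _ ≤ _ := mul_le_mul_of_nonneg_left h2 (by positivity)
  · refine ⟨1, one_pos, fun x hx => ?_⟩
    have := norm_nonneg x
    linarith

end GradForm

section Strict

variable {n : ℕ} {Γ : ConvexCone ℝ (Fin n → ℝ)}
  {μ : Measure (EuclideanSpace ℂ (Fin n))} [μ.IsAddHaarMeasure]
  {u f κ : EuclideanSpace ℂ (Fin n) → ℝ} {C : ℝ≥0}
  {e : OrthonormalBasis (Fin n) ℂ (EuclideanSpace ℂ (Fin n))} {B : Finset (Fin n)}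

/-- If the indicator of the transverse directions lies in the open cone `Γ`, the diagonal, in any
orthonormal basis, of the projection to these directions is uniformly inside `Γ`. -/
theorem exists_trace_lower_bound (hopen : IsOpen (Γ : Set (Fin n → ℝ)))
    (hsymm : ∀ (σ : Equiv.Perm (Fin n)) (x : Fin n → ℝ), x ∈ Γ → x ∘ σ ∈ Γ)
    (hmem : (fun i => if i ∈ B then (0 : ℝ) else 1) ∈ Γ) :
    ∃ τ : ℝ, 0 < τ ∧ ∀ e' : OrthonormalBasis (Fin n) ℂ (EuclideanSpace ℂ (Fin n)),
      ∀ l ∈ dualCone Γ, τ * ∑ j, l j ≤ ∑ j, l j * ∑ i ∈ Bᶜ, ‖inner ℂ (e i) (e' j)‖ ^ 2 := by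
  have h2 : ∀ᶠ t : ℝ in nhds 0, (fun i => (if i ∈ B then (0 : ℝ) else 1) - t)
      ∈ (Γ : Set (Fin n → ℝ)) := by
    have hc : ContinuousAt
        (fun t : ℝ => fun i : Fin n => (if i ∈ B then (0 : ℝ) else 1) - t) 0 := by fun_prop
    exact hc.eventually (hopen.mem_nhds (by simpa using hmem))
  obtain ⟨ε, hε, hball⟩ := Metric.eventually_nhds_iff.1 h2
  refine ⟨ε / 2, by positivity, fun e' l hl => ?_⟩
  have h3 := hball (y := ε / 2) (by
    rw [Real.dist_eq, sub_zero, abs_of_pos (by linarith)]; linarith)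
  have h4 := hl _ (schur_mem hsymm e e' h3)
  have h5 : ∀ j, ∑ i, ‖inner ℂ (e i) (e' j)‖ ^ 2 * ((if i ∈ B then (0 : ℝ) else 1) - ε / 2)
      = ∑ i ∈ Bᶜ, ‖inner ℂ (e i) (e' j)‖ ^ 2 - ε / 2 := by
    intro j
    simp only [mul_sub, Finset.sum_sub_distrib, ← Finset.sum_mul]
    rw [e.sum_sq_norm_inner_right, e'.norm_eq_one]
    congr 1
    · rw [← Finset.sum_filter_add_sum_filter_not Finset.univ (fun i => i ∈ B)]
      rw [Finset.sum_eq_zero (fun i hi => by simp [(Finset.mem_filter.1 hi).2]), zero_add]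
      have : Finset.univ.filter (fun i => ¬ i ∈ B) = Bᶜ := by ext i; simp
      rw [this]
      refine Finset.sum_congr rfl fun i hi => ?_
      simp [Finset.mem_compl.1 hi]
    · ring
  simp only [h5] at h4
  simp only [mul_sub, Finset.sum_sub_distrib, ← Finset.sum_mul] at h4
  linarith

/-- The averaged gradient form only sees the component transverse to the invariant directions. -/
theorem mul_sum_le_mollify_gradForm (hκ : IsMollifier μ κ) (hf : ContDiff ℝ 2 f)
    (hB : ∀ i ∈ B, InvariantAlong f (e i)) {c : ℝ} {z : EuclideanSpace ℂ (Fin n)}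
    (hc : ∀ ξ : EuclideanSpace ℂ (Fin n), ‖ξ‖ = 1 → (∀ i ∈ B, inner ℂ (e i) ξ = 0) →
      c ≤ mollify μ κ (gradForm f ξ) z) (v : EuclideanSpace ℂ (Fin n)) :
    c * ∑ i ∈ Bᶜ, ‖inner ℂ (e i) v‖ ^ 2 ≤ mollify μ κ (gradForm f v) z := by
  have hd : Differentiable ℝ f := hf.differentiable (by norm_num)
  set p := ∑ i ∈ Bᶜ, inner ℂ (e i) v • e i with hp
  have hsum : v = p + ∑ i ∈ B, inner ℂ (e i) v • e i := by
    rw [hp, Finset.sum_compl_add_sum, e.sum_repr']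
  have hgv : gradForm f v = gradForm f p := by
    ext x
    conv_lhs => rw [hsum]
    exact gradForm_add_of_invariantAlong (InvariantAlong.sum fun i hi => (hB i hi).smul _) hd p x
  have hinner : ∀ i, inner ℂ (e i) p = if i ∈ B then 0 else inner ℂ (e i) v := by
    intro i
    rw [hp, inner_sum]
    simp only [inner_smul_right, orthonormal_iff_ite.1 e.orthonormal, mul_ite, mul_one, mul_zero,
      Finset.sum_ite_eq, Finset.mem_compl]
    by_cases hi : i ∈ B <;> simp [hi]
  have hnorm : ‖p‖ ^ 2 = ∑ i ∈ Bᶜ, ‖inner ℂ (e i) v‖ ^ 2 := by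
    rw [← e.sum_sq_norm_inner_right p]
    simp only [hinner]
    rw [← Finset.sum_compl_add_sum B,
      Finset.sum_eq_zero (s := B) (fun i hi => by rw [if_pos hi]; simp), add_zero]
    exact Finset.sum_congr rfl fun i hi => by rw [if_neg (Finset.mem_compl.1 hi)]
  rw [hgv, ← hnorm]
  by_cases hp0 : p = 0
  · rw [hp0]
    refine le_trans (by simp) (hκ.le_mollify (continuous_gradForm (hf.of_le (by norm_num)) _)
      (c := 0) fun y _ => gradForm_nonneg _ _ _)
  · have hpn : 0 < ‖p‖ := norm_pos_iff.2 hp0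
    have h1 := hc (‖p‖⁻¹ • p) (by rw [norm_smul, norm_inv, norm_norm, inv_mul_cancel₀ hpn.ne'])
      (fun i hi => by
        rw [← algebraMap_smul ℂ ‖p‖⁻¹ p, inner_smul_right, hinner, if_pos hi, mul_zero])
    have h2 : mollify μ κ (gradForm f (‖p‖⁻¹ • p)) z
        = (‖p‖ ^ 2)⁻¹ * mollify μ κ (gradForm f p) z := by
      unfold mollify
      rw [← integral_const_mul]
      congr 1
      ext y
      rw [gradForm_smul, inv_pow]
      ring
    rw [h2, le_inv_mul_iff₀ (by positivity)] at h1
    linarith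

/-- The square of a nonnegative smooth subsolution is a subsolution with a gain in the directions
in which the function varies, and averaging preserves this. -/
theorem sum_levi_mollify_sq_ge (hκ : IsMollifier μ κ) {g : EuclideanSpace ℂ (Fin n) → ℝ}
    (hg : ContDiff ℝ 2 g)
    (hg0 : ∀ x, 0 ≤ g x) {l : Fin n → ℝ}
    (hsub : ∀ x, 0 ≤ ∑ i, l i * levi g x (e i)) (z : EuclideanSpace ℂ (Fin n)) :
    2 * ∑ i, l i * mollify μ κ (gradForm g (e i)) z
      ≤ ∑ i, l i * levi (mollify μ κ fun y => g y ^ 2) z (e i) := by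
  have hsq : ContDiff ℝ 2 fun y => g y ^ 2 := hg.pow 2
  simp only [levi_mollify hκ hsq]
  have hc1 : ∀ i, Continuous (gradForm g (e i)) := fun i =>
    continuous_gradForm (hg.of_le (by norm_num)) _
  have hint1 : ∀ i, Integrable (fun y => κ y * gradForm g (e i) (z - y)) μ := fun i =>
    hκ.integrable_mul (hc1 i) z
  have hint2 : ∀ i, Integrable (fun y => κ y * levi (fun y => g y ^ 2) (z - y) (e i)) μ := fun i =>
    hκ.integrable_mul (continuous_levi hsq _) z
  unfold mollify
  simp only [← integral_const_mul]
  rw [← integral_finsetSum _ fun i _ => (hint1 i).const_mul _,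
    ← integral_finsetSum _ fun i _ => (hint2 i).const_mul _, ← integral_const_mul]
  refine integral_mono ((integrable_finsetSum _ fun i _ => (hint1 i).const_mul _).const_mul _)
    (integrable_finsetSum _ fun i _ => (hint2 i).const_mul _) fun y => ?_
  simp only
  have h1 : ∑ i, l i * (κ y * levi (fun y => g y ^ 2) (z - y) (e i))
      = 2 * ∑ i, l i * (κ y * gradForm g (e i) (z - y))
        + κ y * (2 * g (z - y)) * ∑ i, l i * levi g (z - y) (e i) := by
    simp only [levi_sq hg, Finset.mul_sum, ← Finset.sum_add_distrib]
    refine Finset.sum_congr rfl fun i _ => ?_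
    ring
  rw [h1]
  have h2 : 0 ≤ κ y * (2 * g (z - y)) * ∑ i, l i * levi g (z - y) (e i) :=
    mul_nonneg (mul_nonneg (hκ.nonneg y) (by have := hg0 (z - y); positivity)) (hsub _)
  linarith

end Strict

/-! ### Almost invariant directions -/

section AlmostInvariance

theorem abs_sub_le_of_dirDeriv_le {E : Type*} [NormedAddCommGroup E] [NormedSpace ℝ E] {f : E → ℝ}
    (hf : Differentiable ℝ f) {x v : E} {T θ : ℝ}
    (h : ∀ s : ℝ, |s| ≤ T → |dirDeriv v f (x + s • v)| ≤ θ) {t : ℝ} (ht : |t| ≤ T) :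
    |f (x + t • v) - f x| ≤ θ * |t| := by
  have h1 := (convex_Icc (-T) T).norm_image_sub_le_of_norm_hasDerivWithin_le
    (f := fun s : ℝ => f (x + s • v)) (f' := fun s => dirDeriv v f (x + s • v)) (x := 0) (y := t)
    (C := θ) (fun s _ => (hasDerivAt_line hf x v s).hasDerivWithinAt)
    (fun s hs => h s (abs_le.2 hs)) (abs_le.1 (by simpa using (abs_nonneg t).trans ht))
    (abs_le.1 ht)
  simpa using h1

variable {n : ℕ} {Γ : ConvexCone ℝ (Fin n → ℝ)}
  {μ : Measure (EuclideanSpace ℂ (Fin n))} [μ.IsAddHaarMeasure]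
  {u : EuclideanSpace ℂ (Fin n) → ℝ} {C : ℝ≥0}
  {e : OrthonormalBasis (Fin n) ℂ (EuclideanSpace ℂ (Fin n))} {B : Finset (Fin n)}

/-- The averages of `(f - a)²`, where `f` is a mollification of `u`, and of `u` combine to a
subsolution that is strict at the points where the averaged gradient form of `f` is bounded below in
all transverse directions. The supersolution `u` cannot be touched from below at such a point, even
after a small penalisation. -/
theorem IsDualSolution.exists_small_gradForm (hu : IsDualSolution Γ u)
    (hopen : IsOpen (Γ : Set (Fin n → ℝ)))
    (hsymm : ∀ (σ : Equiv.Perm (Fin n)) (x : Fin n → ℝ), x ∈ Γ → x ∘ σ ∈ Γ)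
    (horthant : positiveOrthant n ⊆ (Γ : Set (Fin n → ℝ)))
    (hb : ∀ z, |u z| ≤ C) (hL : LipschitzWith C u)
    (hB : ∀ i ∈ B, InvariantAlong u (e i))
    (hmem : (fun i => if i ∈ B then (0 : ℝ) else 1) ∈ Γ)
    {κ κ₁ κ₂ : EuclideanSpace ℂ (Fin n) → ℝ} (hκ : IsMollifier μ κ) (hκ₁ : IsMollifier μ κ₁)
    (hκ₂ : IsMollifier μ κ₂) {a D α c₀ : ℝ} (ha : ∀ x, a ≤ mollify μ κ u x)
    (hD : ∀ x, mollify μ κ u x - a ≤ D) (hα : 0 < α) (hc₀ : 0 < c₀)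
    (z₀ : EuclideanSpace ℂ (Fin n)) :
    ∃ z₁ ξ : EuclideanSpace ℂ (Fin n),
      u z₁ - (α * mollify μ κ₁ (fun y => (mollify μ κ u y - a) ^ 2) z₁
          + 1 / 2 * mollify μ κ₂ u z₁)
        ≤ u z₀ - (α * mollify μ κ₁ (fun y => (mollify μ κ u y - a) ^ 2) z₀
          + 1 / 2 * mollify μ κ₂ u z₀) ∧
      ‖ξ‖ = 1 ∧ (∀ i ∈ B, inner ℂ (e i) ξ = 0) ∧
      mollify μ κ₁ (gradForm (mollify μ κ u) ξ) z₁ < c₀ := by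
  obtain ⟨τ, hτ, htrace⟩ := exists_trace_lower_bound (e := e) hopen hsymm hmem
  set f := mollify μ κ u with hfdef
  have hf : ContDiff ℝ 2 f := hκ.contDiff_mollify hL.continuous 2
  have hg : ContDiff ℝ 2 fun y => f y - a := hf.sub contDiff_const
  have hsq : ContDiff ℝ 2 fun y => (f y - a) ^ 2 := hg.pow 2
  set p := mollify μ κ₁ fun y => (f y - a) ^ 2 with hp
  set q := mollify μ κ₂ u with hq
  have hpC : ContDiff ℝ 2 p := hκ₁.contDiff_mollify hsq.continuous 2
  have hqC : ContDiff ℝ 2 q := hκ₂.contDiff_mollify hL.continuous 2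
  have hhC : ContDiff ℝ 2 fun x => α * p x + 1 / 2 * q x :=
    (contDiff_const.mul hpC).add (contDiff_const.mul hqC)
  have hpD : ∀ x, p x ≤ D ^ 2 := fun x => hκ₁.mollify_le hsq.continuous fun y _ =>
    pow_le_pow_left₀ (sub_nonneg.2 (ha _)) (hD _) 2
  have hqD : ∀ x, q x ≤ C := fun x => hκ₂.mollify_le hL.continuous fun y _ => (abs_le.1 (hb _)).2
  obtain ⟨z₁, h1, h2⟩ := exists_penalised_max (G := fun x => α * p x + 1 / 2 * q x - u x)
    (hhC.continuous.sub hL.continuous) (C := α * D ^ 2 + 1 / 2 * C + C) (fun x => by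
      have e1 := mul_le_mul_of_nonneg_left (hpD x) hα.le
      have e2 := hqD x
      have e3 := (abs_le.1 (hb x)).1
      linarith) (δ := α * c₀ * τ / 4) (by positivity) z₀
  by_contra! hcon
  have hcon' : ∀ ξ : EuclideanSpace ℂ (Fin n), ‖ξ‖ = 1 → (∀ i ∈ B, inner ℂ (e i) ξ = 0) →
      c₀ ≤ mollify μ κ₁ (gradForm f ξ) z₁ := fun ξ => hcon z₁ ξ (by linarith)
  have hbound := mul_sum_le_mollify_gradForm hκ₁ hf (fun i hi => (hB i hi).mollify κ) hcon'
  refine hu.super (fun x => (α * p x + 1 / 2 * q x) + -(α * c₀ * τ / 4) * ‖x - z₀‖ ^ 2)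
    (hhC.add (contDiff_const.mul (contDiff_norm_sq_sub z₀))) z₁
    (Filter.Eventually.of_forall fun y => by have := h2 y; simp only at this ⊢; linarith)
    (α * c₀ * τ) (by positivity) fun e' l hl => ?_
  have hl0 : ∀ i, 0 ≤ l i := nonneg_of_mem_dualCone horthant hl
  have hgrad : ∀ v, gradForm (fun y => f y - a) v = gradForm f v := fun v => by
    ext x
    simp [gradForm, dirDeriv, fderiv_sub_const]
  have hlevi : ∀ x v, levi (fun y => f y - a) x v = levi f x v := fun x v => by
    simp only [levi, hess]
    have : fderiv ℝ (fun y => f y - a) = fderiv ℝ f := funext fun y => fderiv_sub_const a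
    rw [this]
  have e1 := sum_levi_mollify_sq_ge (e := e') hκ₁ hg (fun x => sub_nonneg.2 (ha x)) (l := l)
    (fun x => by
      simp only [hlevi]
      exact hu.mollify_nonneg horthant hb hL hκ e' hl x) z₁
  simp only [hgrad] at e1
  have e2 := hu.mollify_nonneg horthant hb hL hκ₂ e' hl z₁
  have e3 : c₀ * (τ * ∑ j, l j) ≤ ∑ i, l i * mollify μ κ₁ (gradForm f (e' i)) z₁ :=
    calc c₀ * (τ * ∑ j, l j) ≤ c₀ * ∑ j, l j * ∑ i ∈ Bᶜ, ‖inner ℂ (e i) (e' j)‖ ^ 2 :=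
          mul_le_mul_of_nonneg_left (htrace e' l hl) hc₀.le
      _ = ∑ j, l j * (c₀ * ∑ i ∈ Bᶜ, ‖inner ℂ (e i) (e' j)‖ ^ 2) := by
          rw [Finset.mul_sum]
          exact Finset.sum_congr rfl fun j _ => by ring
      _ ≤ _ := Finset.sum_le_sum fun j _ => mul_le_mul_of_nonneg_left (hbound _) (hl0 j)
  have e4 : ∀ i,
      levi (fun x => (α * p x + 1 / 2 * q x) + -(α * c₀ * τ / 4) * ‖x - z₀‖ ^ 2) z₁ (e' i)
      = α * levi p z₁ (e' i) + 1 / 2 * levi q z₁ (e' i) - α * c₀ * τ := fun i => by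
    rw [levi_add_const_mul_norm_sq hhC, e'.norm_eq_one]
    simp only [levi]
    rw [hess_add (contDiff_const.mul hpC) (contDiff_const.mul hqC),
      hess_add (contDiff_const.mul hpC) (contDiff_const.mul hqC), hess_const_mul hpC,
      hess_const_mul hpC, hess_const_mul hqC, hess_const_mul hqC]
    ring
  have e5 : ∑ i, l i * (α * levi p z₁ (e' i) + 1 / 2 * levi q z₁ (e' i) - α * c₀ * τ)
      = α * ∑ i, l i * levi p z₁ (e' i) + 1 / 2 * ∑ i, l i * levi q z₁ (e' i)
        - α * c₀ * τ * ∑ i, l i := by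
    simp only [Finset.mul_sum, ← Finset.sum_add_distrib, ← Finset.sum_sub_distrib]
    exact Finset.sum_congr rfl fun i _ => by ring
  simp only [e4]
  rw [e5]
  have e6 := mul_le_mul_of_nonneg_left e1 hα.le
  have e7 := mul_le_mul_of_nonneg_left e3 hα.le
  have e8 : α * (c₀ * (τ * ∑ j, l j)) = α * c₀ * τ * ∑ i, l i := by ring
  linarith

/-- A nonconstant solution is, around suitable points and on arbitrarily large balls, almost
invariant along a direction transverse to the given invariant ones, although its oscillation on a
ball of fixed radius around these points is bounded below.

The points are almost minima of `u - h`, where `h` is half the sum of the average of `(f - a)² / D`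
over a huge ball and of the average of `u` over a large ball of fixed radius, `f` is a mollification
of `u`, and `a` and `D` are the infimum and the oscillation of `u`. Evaluating `u - h` where `u` is
almost equal to `a` shows that, at an almost minimum, `u` is close to `a` and its average over the
ball of fixed radius is close to `a + D`. -/
theorem IsDualSolution.exists_almost_invariant_direction (hu : IsDualSolution Γ u)
    (hopen : IsOpen (Γ : Set (Fin n → ℝ)))
    (hsymm : ∀ (σ : Equiv.Perm (Fin n)) (x : Fin n → ℝ), x ∈ Γ → x ∘ σ ∈ Γ)
    (horthant : positiveOrthant n ⊆ (Γ : Set (Fin n → ℝ)))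
    (hproper : (Γ : Set (Fin n → ℝ)) ≠ Set.univ)
    (hb : ∀ z, |u z| ≤ C) (hL : LipschitzWith C u)
    (hB : ∀ i ∈ B, InvariantAlong u (e i))
    (hmem : (fun i => if i ∈ B then (0 : ℝ) else 1) ∈ Γ)
    (hne : ∃ x y, u x < u y) :
    ∃ R d : ℝ, 0 < d ∧ ∀ T θ : ℝ, 0 < T → 0 < θ → ∃ z y ξ : EuclideanSpace ℂ (Fin n),
      ‖y‖ ≤ R ∧ d ≤ |u (z + y) - u z| ∧ ‖ξ‖ = 1 ∧ (∀ i ∈ B, inner ℂ (e i) ξ = 0) ∧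
      ∀ v ∈ ({ξ, Complex.I • ξ} : Set (EuclideanSpace ℂ (Fin n))),
        ∀ x, ‖x‖ ≤ T → ∀ t : ℝ, |t| ≤ T → |u (z + x + t • v) - u (z + x)| ≤ θ := by
  let μ : Measure (EuclideanSpace ℂ (Fin n)) := Measure.addHaar
  have hsub : ∀ κ, IsMollifier μ κ → ∀ x,
      0 ≤ weightedLap (fun _ => 1) (realBasis e) (mollify μ κ u) x := fun κ hκ x => by
    have := hu.mollify_nonneg horthant hb hL hκ e
      (one_mem_dualCone hopen hsymm horthant hproper) x
    rwa [← weightedLap_realBasis] at this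
  have hbelow : BddBelow (Set.range u) := ⟨-C, by rintro _ ⟨x, rfl⟩; exact (abs_le.1 (hb x)).1⟩
  have habove : BddAbove (Set.range u) := ⟨C, by rintro _ ⟨x, rfl⟩; exact (abs_le.1 (hb x)).2⟩
  set a := ⨅ x, u x with ha
  set b := ⨆ x, u x with hbdef
  have hau : ∀ x, a ≤ u x := ciInf_le hbelow
  have hub : ∀ x, u x ≤ b := le_ciSup habove
  obtain ⟨D, hDdef⟩ : ∃ D, D = b - a := ⟨_, rfl⟩
  have hD : 0 < D := by
    obtain ⟨x, y, hxy⟩ := hne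
    linarith [hau x, hub y]
  obtain ⟨z₀, hz₀⟩ := exists_lt_of_ciInf_lt (show ⨅ x, u x < a + D / 32 by linarith)
  obtain ⟨x₀, hx₀⟩ := exists_lt_of_lt_ciSup (show b - D / 32 < ⨆ x, u x by linarith)
  have havg : ∀ᶠ r in Filter.atTop,
      b - D / 16 ≤ mollify μ (radialKernel μ (realBasis e) r) u z₀ := by
    filter_upwards [eventually_le_mollify_radialKernel μ (realBasis e) hL hb hsub x₀ z₀
      (δ := D / 32) (by positivity)] with r hr
    linarith
  obtain ⟨ρ, hρ, hρ0⟩ := (havg.and (Filter.eventually_gt_atTop 0)).exists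
  have hκ₂ := isMollifier_radialKernel μ (realBasis e) hρ0
  set κ₂ := radialKernel μ (realBasis e) ρ
  obtain ⟨R, hR⟩ := hκ₂.compact.isCompact.isBounded.exists_norm_le
  refine ⟨R, D / 4, by positivity, fun T θ hT hθ => ?_⟩
  have hC0 : (0 : ℝ) ≤ C := C.2
  obtain ⟨ε, hε, hε1, hεD, hεθ⟩ : ∃ ε : ℝ, 0 < ε ∧ ε ≤ 1 ∧ C * ε ≤ D / 32 ∧ C * ε ≤ θ / 8 := by
    have h1 : ∀ s : ℝ, 0 < s → ∀ ε, ε ≤ s / (C + 1) → C * ε ≤ s := fun s hs ε h => by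
      rw [le_div_iff₀ (by positivity)] at h
      by_cases h0 : 0 ≤ ε
      · linarith
      · nlinarith
    refine ⟨min 1 (min (D / 32 / (C + 1)) (θ / 8 / (C + 1))), by positivity, min_le_left _ _,
      h1 _ (by positivity) _ ((min_le_right _ _).trans (min_le_left _ _)),
      h1 _ (by positivity) _ ((min_le_right _ _).trans (min_le_right _ _))⟩
  obtain ⟨κ, hκ, hκε⟩ := exists_isMollifier (E := EuclideanSpace ℂ (Fin n)) μ hε
  obtain ⟨r, hr, hrpos, hr0⟩ := (havg.and ((eventually_radialKernel_pos μ (realBasis e)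
    (2 * T + 1)).and (Filter.eventually_gt_atTop 0))).exists
  have hκ₁ := isMollifier_radialKernel μ (realBasis e) hr0
  set κ₁ := radialKernel μ (realBasis e) r
  obtain ⟨K, hK0, hK⟩ := exists_kernel_domination hκ hκ₁ (fun y hy => (hκε y hy).trans hε1) hrpos
  set f := mollify μ κ u with hfdef
  have hfC : ContDiff ℝ 2 f := hκ.contDiff_mollify hL.continuous 2
  have hfa : ∀ x, a ≤ f x := fun x => hκ.le_mollify hL.continuous fun y _ => hau _
  have hfb : ∀ x, f x ≤ b := fun x => hκ.mollify_le hL.continuous fun y _ => hub _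
  have hfu : ∀ x, |f x - u x| ≤ C * ε := hκ.abs_mollify_sub_le hκε hL
  have hfD : ∀ x, f x - a ≤ D := fun x => by linarith [hfb x]
  -- The averaged squared derivative is at most `(θ / (4 T))² / K`, which makes the derivatives
  -- of `κ ⋆ f` at most `θ / (2 T)`.
  set θ' := θ / (4 * T) with hθ'
  have hθ'0 : 0 < θ' := by positivity
  obtain ⟨z₁, ξ, hz₁, hξ, hξB, hgrad⟩ := hu.exists_small_gradForm hopen hsymm horthant hb hL hB hmem
    hκ hκ₁ hκ₂ hfa hfD (α := 1 / (2 * D)) (c₀ := θ' ^ 2 / K) (by positivity) (by positivity) z₀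
  rw [← hfdef] at hz₁ hgrad
  have hgc : Continuous fun y => f y - a := hfC.continuous.sub continuous_const
  have hgc2 : Continuous fun y => (f y - a) ^ 2 := hgc.pow 2
  -- At `z₀` the averages are almost `b`, by the choice of the radii.
  have hp₀ : D / 2 - 3 * D / 32
      ≤ 1 / (2 * D) * mollify μ κ₁ (fun y => (f y - a) ^ 2) z₀ := by
    have e1 : mollify μ κ₁ u z₀ - D / 32 ≤ mollify μ κ₁ f z₀ := by
      rw [← hκ₁.mollify_sub_const hL.continuous]
      have hc : Continuous fun y => u y - D / 32 := hL.continuous.sub continuous_const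
      refine hκ₁.mollify_mono hc hfC.continuous fun y _ => ?_
      have := (abs_le.1 (hfu (z₀ - y))).1
      linarith
    have hc : Continuous fun y => 2 * D * (f y - a) := continuous_const.mul hgc
    have hc' : Continuous fun y => 2 * D * (f y - a) - D ^ 2 := hc.sub continuous_const
    have e2 : mollify μ κ₁ (fun y => 2 * D * (f y - a) - D ^ 2) z₀
        ≤ mollify μ κ₁ (fun y => (f y - a) ^ 2) z₀ :=
      hκ₁.mollify_mono hc' hgc2 fun y _ => by nlinarith [sq_nonneg (f (z₀ - y) - a - D)]
    have e3 : mollify μ κ₁ (fun y => 2 * D * (f y - a) - D ^ 2) z₀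
        = 2 * D * (mollify μ κ₁ f z₀ - a) - D ^ 2 := by
      rw [hκ₁.mollify_sub_const hc, ← hκ₁.mollify_sub_const hfC.continuous]
      congr 1
      unfold mollify
      rw [← integral_const_mul]
      congr 1
      ext y
      ring
    rw [div_mul_eq_mul_div, one_mul, le_div_iff₀ (by positivity)]
    rw [e3] at e2
    refine le_trans ?_ e2
    have e4 : D - 3 * D / 32 ≤ mollify μ κ₁ f z₀ - a := by linarith
    nlinarith
  -- Everywhere the comparison function is at most `D / 2 + b / 2`.
  have hp₁ : 1 / (2 * D) * mollify μ κ₁ (fun y => (f y - a) ^ 2) z₁ ≤ D / 2 := by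
    have e1 : mollify μ κ₁ (fun y => (f y - a) ^ 2) z₁ ≤ D ^ 2 :=
      hκ₁.mollify_le hgc2 fun y _ => pow_le_pow_left₀ (sub_nonneg.2 (hfa _)) (hfD _) 2
    rw [div_mul_eq_mul_div, one_mul, div_le_iff₀ (by positivity)]
    linarith
  have hq₁ : mollify μ κ₂ u z₁ ≤ b := hκ₂.mollify_le hL.continuous fun y _ => hub _
  have huz₁ : u z₁ ≤ a + 5 * D / 32 := by linarith
  have hqz₁ : b - 5 * D / 16 ≤ mollify μ κ₂ u z₁ := by linarith [hau z₁]
  obtain ⟨y, hy, huy⟩ : ∃ y, κ₂ y ≠ 0 ∧ b - 6 * D / 16 < u (z₁ - y) := by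
    by_contra! hcon
    have := hκ₂.mollify_le hL.continuous hcon
    linarith
  refine ⟨z₁, -y, ξ, ?_, ?_, hξ, hξB, fun v hv x hx t ht => ?_⟩
  · rw [norm_neg]
    exact hR y (subset_tsupport _ hy)
  · rw [← sub_eq_add_neg]
    refine le_trans ?_ (le_abs_self _)
    linarith
  · have hle : ∀ y, dirDeriv v f y ^ 2 ≤ gradForm f ξ y := fun y => by
      unfold gradForm
      rcases hv with rfl | rfl
      · linarith [sq_nonneg (dirDeriv (Complex.I • v) f y)]
      · linarith [sq_nonneg (dirDeriv ξ f y)]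
    have hvn : ‖v‖ = 1 := by
      rcases hv with rfl | rfl
      · exact hξ
      · rw [norm_smul, Complex.norm_I, one_mul, hξ]
    have hder : ∀ s : ℝ, |s| ≤ T → |dirDeriv v (mollify μ κ f) (z₁ + x + s • v)| ≤ 2 * θ' := by
      intro s hs
      have e1 : ‖x + s • v‖ ≤ 2 * T := by
        refine (norm_add_le _ _).trans ?_
        rw [norm_smul, hvn, Real.norm_eq_abs]
        linarith
      have e2 := abs_dirDeriv_mollify_le hκ hκ₁ hfC hθ'0 (hK _ e1)
        (continuous_gradForm (hfC.of_le (by norm_num)) ξ) hle hgrad.le hK0.le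
      rw [← add_assoc] at e2
      refine e2.trans (le_of_eq ?_)
      field_simp
      ring
    have hF : ContDiff ℝ 2 (mollify μ κ f) := hκ.contDiff_mollify hfC.continuous 2
    have hFu : ∀ x, |mollify μ κ f x - u x| ≤ 2 * (C * ε) := fun x => by
      have e1 := hκ.abs_mollify_sub_le hκε (hκ.lipschitz_mollify hL) x
      have e2 := hfu x
      have e3 := abs_add_le (mollify μ κ f x - f x) (f x - u x)
      rw [sub_add_sub_cancel] at e3
      linarith
    have e1 := abs_sub_le_of_dirDeriv_le (hF.differentiable (by norm_num)) hder ht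
    have e2 : 2 * θ' * |t| ≤ θ / 2 := by
      have : 2 * θ' * |t| ≤ 2 * θ' * T := mul_le_mul_of_nonneg_left ht (by positivity)
      refine this.trans (le_of_eq ?_)
      rw [hθ']
      field_simp
      norm_num
    have e3 := abs_le.1 (hFu (z₁ + x + t • v))
    have e4 := abs_le.1 (hFu (z₁ + x))
    have e5 := abs_le.1 (e1.trans e2)
    rw [abs_le]
    constructor <;> linarith [e3.1, e3.2, e4.1, e4.2, e5.1, e5.2]

end AlmostInvariance

/-! ### Induction on the number of invariant directions -/

section Induction

variable {n : ℕ} {Γ : ConvexCone ℝ (Fin n → ℝ)} {C : ℝ≥0}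

/-- A nonconstant solution that is invariant along a family of orthonormal directions can be
replaced, by passing to a limit of translates, by a nonconstant one that is invariant along one
more direction. -/
theorem IsDualSolution.exists_limit_invariantAlong
    {u : EuclideanSpace ℂ (Fin n) → ℝ} (hu : IsDualSolution Γ u)
    (hopen : IsOpen (Γ : Set (Fin n → ℝ)))
    (hsymm : ∀ (σ : Equiv.Perm (Fin n)) (x : Fin n → ℝ), x ∈ Γ → x ∘ σ ∈ Γ)
    (horthant : positiveOrthant n ⊆ (Γ : Set (Fin n → ℝ)))
    (hproper : (Γ : Set (Fin n → ℝ)) ≠ Set.univ)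
    (hb : ∀ z, |u z| ≤ C) (hL : LipschitzWith C u)
    {e : OrthonormalBasis (Fin n) ℂ (EuclideanSpace ℂ (Fin n))} {B : Finset (Fin n)}
    (hB : ∀ i ∈ B, InvariantAlong u (e i))
    (hmem : (fun i => if i ∈ B then (0 : ℝ) else 1) ∈ Γ)
    (hne : ∃ x y, u x < u y) :
    ∃ (v : EuclideanSpace ℂ (Fin n) → ℝ) (ξ : EuclideanSpace ℂ (Fin n)),
      IsDualSolution Γ v ∧ (∀ z, |v z| ≤ C) ∧ LipschitzWith C v ∧ (∃ x, v x ≠ v 0) ∧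
      ‖ξ‖ = 1 ∧ (∀ i ∈ B, inner ℂ (e i) ξ = 0) ∧ InvariantAlong v ξ ∧
      ∀ i ∈ B, InvariantAlong v (e i) := by
  obtain ⟨R, d, hd, H⟩ := hu.exists_almost_invariant_direction hopen hsymm horthant hproper hb hL
    hB hmem hne
  choose z y ξ hyR hyd hξ hξB hinv using fun k : ℕ =>
    H (k + 1) (1 / (k + 1)) (by positivity) (by positivity)
  let F : Ultrafilter ℕ := Filter.hyperfilter ℕ
  have hF : (F : Filter ℕ) ≤ Filter.atTop := by
    rw [← Nat.cofinite_eq_atTop]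
    exact Filter.hyperfilter_le_cofinite
  have hLk : ∀ k, LipschitzWith C fun w => u (z k + w) := fun k =>
    LipschitzWith.of_dist_le_mul fun x y => by
      simpa using hL.dist_le_mul (z k + x) (z k + y)
  obtain ⟨v, hvb, hvL, hv⟩ := exists_ultrafilter_limit F (f := fun k w => u (z k + w))
    (fun k x => hb _) hLk
  have hpt : ∀ x, Filter.Tendsto (fun k => u (z k + x)) F (nhds (v x)) := by
    intro x
    rw [Metric.tendsto_nhds]
    intro ε hε
    filter_upwards [hv ‖x‖ (ε / 2) (by positivity)] with k hk
    rw [Real.dist_eq]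
    linarith [hk x le_rfl]
  obtain ⟨ξ', hξ', hlim⟩ := (isCompact_sphere (0 : EuclideanSpace ℂ (Fin n)) 1).ultrafilter_le_nhds
    (F.map ξ) (by
      rw [Filter.le_principal_iff]
      exact Filter.mem_map.2 (Filter.univ_mem' fun k => by simpa using hξ k))
  have hlim : Filter.Tendsto ξ F (nhds ξ') := hlim
  have hreal : ∀ c : ℂ, (∀ k, c • ξ k ∈ ({ξ k, Complex.I • ξ k} : Set _)) → ‖c‖ = 1 →
      ∀ x (t : ℝ), v (x + t • (c • ξ')) = v x := by
    intro c hc hc1 x t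
    have h1 : Filter.Tendsto (fun k => |u (z k + (x + t • (c • ξ'))) - u (z k + x)|) F
        (nhds |v (x + t • (c • ξ')) - v x|) := ((hpt _).sub (hpt _)).abs
    have h2 : Filter.Tendsto (fun k : ℕ => (C : ℝ) * (|t| * ‖ξ' - ξ k‖) + 1 / ((k : ℝ) + 1)) F
        (nhds (C * (|t| * 0) + 0)) := by
      refine Filter.Tendsto.add (Filter.Tendsto.const_mul _ (Filter.Tendsto.const_mul _ ?_))
        (tendsto_one_div_add_atTop_nhds_zero_nat.mono_left hF)
      have := (hlim.const_sub ξ').norm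
      rwa [sub_self, norm_zero] at this
    have h3 : ∀ᶠ k : ℕ in (F : Filter ℕ), max ‖x‖ |t| ≤ (k : ℝ) + 1 := by
      refine hF ?_
      filter_upwards [tendsto_natCast_atTop_atTop.eventually_ge_atTop (max ‖x‖ |t|)] with k hk
      linarith
    have h4 := le_of_tendsto_of_tendsto h1 h2 (by
      filter_upwards [h3] with k hk
      have e1 := hinv k (c • ξ k) (hc k) x ((le_max_left _ _).trans hk) t
        ((le_max_right _ _).trans hk)
      have e2 := hL.dist_le_mul (z k + (x + t • (c • ξ'))) (z k + x + t • (c • ξ k))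
      have e3 : z k + (x + t • (c • ξ')) - (z k + x + t • (c • ξ k)) = t • (c • (ξ' - ξ k)) := by
        rw [smul_sub, smul_sub]
        abel
      rw [Real.dist_eq, dist_eq_norm, e3, norm_smul, norm_smul, hc1, one_mul,
        Real.norm_eq_abs] at e2
      have e4 := abs_add_le (u (z k + (x + t • (c • ξ'))) - u (z k + x + t • (c • ξ k)))
        (u (z k + x + t • (c • ξ k)) - u (z k + x))
      rw [sub_add_sub_cancel] at e4
      linarith)
    rw [mul_zero, mul_zero, add_zero] at h4
    exact sub_eq_zero.1 (abs_nonpos_iff.1 h4)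
  refine ⟨v, ξ', ?_, hvb, hvL, ?_, by simpa using hξ', ?_, ?_, ?_⟩
  · refine IsDualSolution.of_limit horthant fun R θ hθ => ?_
    obtain ⟨k, hk⟩ := (hv R θ hθ).exists
    exact ⟨_, hu.translate (z k), (hLk k).continuous, hk⟩
  · by_contra! hconst
    obtain ⟨k, hk⟩ := (hv R (d / 3) (by positivity)).exists
    have e1 := abs_le.1 (hk (y k) (hyR k))
    have e2 := abs_le.1 (hk 0 (by simpa using (norm_nonneg _).trans (hyR k)))
    rw [hconst (y k)] at e1
    rw [add_zero] at e2
    have e3 := hyd k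
    rcases le_abs.1 e3 with h | h <;> linarith [e1.1, e1.2, e2.1, e2.2]
  · intro i hi
    have h1 : Filter.Tendsto (fun k => inner ℂ (e i) (ξ k)) F (nhds (inner ℂ (e i) ξ')) :=
      tendsto_const_nhds.inner hlim
    simp only [hξB _ i hi] at h1
    exact (tendsto_nhds_unique h1 tendsto_const_nhds)
  · intro x t
    have h1 := hreal 1 (fun k => by simp) (by simp) x t.re
    have h2 := hreal Complex.I (fun k => by simp) (by simp) (x + t.re • (1 : ℂ) • ξ') t.im
    rw [h1] at h2
    rw [← h2]
    congr 1
    conv_lhs => rw [← Complex.re_add_im t]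
    rw [add_smul, ← add_assoc, mul_smul, one_smul, Complex.coe_smul, Complex.coe_smul]
  · intro i hi x t
    have h1 := hpt (x + t • e i)
    simp only [← add_assoc, hB i hi _ t] at h1
    exact tendsto_nhds_unique h1 (hpt x)

theorem exists_orthonormalBasis_insert
    (e : OrthonormalBasis (Fin n) ℂ (EuclideanSpace ℂ (Fin n))) {B : Finset (Fin n)} {j : Fin n}
    (hj : j ∉ B) {ξ : EuclideanSpace ℂ (Fin n)} (hξ : ‖ξ‖ = 1) (hB : ∀ i ∈ B, inner ℂ (e i) ξ = 0) :
    ∃ e' : OrthonormalBasis (Fin n) ℂ (EuclideanSpace ℂ (Fin n)),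
      e' j = ξ ∧ ∀ i ∈ B, e' i = e i := by
  have hne : ∀ i ∈ B, i ≠ j := fun i hi h => hj (h ▸ hi)
  have hon : Orthonormal ℂ ((↑(insert j B) : Set (Fin n)).domRestrict
      fun i => if i = j then ξ else e i) := by
    constructor
    · rintro ⟨i, hi⟩
      simp only [Set.domRestrict_apply]
      split_ifs
      · exact hξ
      · exact e.norm_eq_one i
    · rintro ⟨i, hi⟩ ⟨k, hk⟩ hik
      have hik' : i ≠ k := fun h => hik (Subtype.ext h)
      simp only [Set.domRestrict_apply]
      rw [Finset.mem_coe, Finset.mem_insert] at hi hk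
      split_ifs with h1 h2 h2
      · exact absurd (h1.trans h2.symm) hik'
      · rw [← inner_conj_symm, hB k (hk.resolve_left h2), map_zero]
      · exact hB i (hi.resolve_left h1)
      · exact e.orthonormal.2 hik'
  obtain ⟨e', he'⟩ := hon.exists_orthonormalBasis_extension_of_card_eq (by simp)
  refine ⟨e', ?_, fun i hi => ?_⟩
  · simpa using he' j (by simp)
  · simpa [hne i hi] using he' i (by simp [hi])

/-- Induction on the number of directions along which the solution is not known to be
invariant. -/
theorem IsDualSolution.eq_of_invariantAlong
    (hopen : IsOpen (Γ : Set (Fin n → ℝ)))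
    (hsymm : ∀ (σ : Equiv.Perm (Fin n)) (x : Fin n → ℝ), x ∈ Γ → x ∘ σ ∈ Γ)
    (horthant : positiveOrthant n ⊆ (Γ : Set (Fin n → ℝ)))
    (hproper : (Γ : Set (Fin n → ℝ)) ≠ Set.univ) (m : ℕ) :
    ∀ (u : EuclideanSpace ℂ (Fin n) → ℝ)
      (e : OrthonormalBasis (Fin n) ℂ (EuclideanSpace ℂ (Fin n))) (B : Finset (Fin n)),
      Bᶜ.card = m → IsDualSolution Γ u → (∀ z, |u z| ≤ C) → LipschitzWith C u →
      (∀ i ∈ B, InvariantAlong u (e i)) → ∀ x, u x = u 0 := by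
  induction m with
  | zero =>
    intro u e B hcard _ _ _ hB x
    rw [Finset.card_eq_zero, Finset.compl_eq_empty_iff] at hcard
    have h1 : InvariantAlong u (∑ i, inner ℂ (e i) x • e i) :=
      InvariantAlong.sum fun i _ => (hB i (by simp [hcard])).smul _
    rw [e.sum_repr'] at h1
    simpa using h1 0 1
  | succ m ih =>
    intro u e B hcard hu hb hL hB
    obtain ⟨j, hj⟩ : Bᶜ.Nonempty := Finset.card_pos.1 (by omega)
    have hcard' : (insert j B)ᶜ.card = m := by
      rw [Finset.compl_insert, Finset.card_erase_of_mem hj, hcard, Nat.add_sub_cancel]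
    have hj := Finset.mem_compl.1 hj
    by_cases hmem : (fun i => if i ∈ B then (0 : ℝ) else 1) ∈ Γ
    · by_contra! hcon
      obtain ⟨x, hx⟩ := hcon
      have hne : ∃ x y, u x < u y := by
        rcases lt_or_gt_of_ne hx with h | h
        exacts [⟨_, _, h⟩, ⟨_, _, h⟩]
      obtain ⟨v, ξ, hv, hvb, hvL, ⟨y, hy⟩, hξ, hξB, hvξ, hvB⟩ :=
        hu.exists_limit_invariantAlong hopen hsymm horthant hproper hb hL hB hmem hne
      obtain ⟨e', hej, heB⟩ := exists_orthonormalBasis_insert e hj hξ hξB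
      refine hy (ih v e' (insert j B) hcard' hv hvb hvL (fun i hi => ?_) y)
      rcases Finset.mem_insert.1 hi with rfl | hi
      · rwa [hej]
      · rw [heB i hi]
        exact hvB i hi
    · refine ih u e (insert j B) hcard' hu hb hL fun i hi => ?_
      rcases Finset.mem_insert.1 hi with rfl | hi
      · exact hu.invariantAlong_of_notMem hopen horthant hb hL e hB hmem hj
      · exact hB i hi

end Induction

theorem mainTheorem5 (n : ℕ) (Γ : ConvexCone ℝ (Fin n → ℝ))
    (hopen : IsOpen (Γ : Set (Fin n → ℝ)))
    (hsymm : ∀ (σ : Equiv.Perm (Fin n)) (x : Fin n → ℝ), x ∈ Γ → x ∘ σ ∈ Γ)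
    (horthant : positiveOrthant n ⊆ (Γ : Set (Fin n → ℝ)))
    (hproper : (Γ : Set (Fin n → ℝ)) ≠ Set.univ)
    (u : EuclideanSpace ℂ (Fin n) → ℝ)
    (hu : IsGammaSolution (Γ : Set (Fin n → ℝ)) u)
    (C : ℝ≥0) (hbound : ∀ z, |u z| < C) (hlip : LipschitzWith C u) :
    ∃ c : ℝ, ∀ z, u z = c := by
  exact ⟨u 0, IsDualSolution.eq_of_invariantAlong hopen hsymm horthant hproper _ u
    (EuclideanSpace.basisFun (Fin n) ℂ) ∅ rfl
    (hu.isDualSolution hopen hsymm horthant) (fun z => (hbound z).le) hlip (by simp)⟩
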